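/- Let $\Omega\subset\mathbb{R}^3$ be a bounded open set whose boundary $\Gamma=\partial\Omega$ is a closed Lipschitz surface, i.e. $\Gamma$ is compact and every point of $\Gamma$ has a relatively open neighbourhood in $\Gamma$ that is the bi-Lipschitz image of an open subset of $\mathbb{R}^2$ (this includes boundaries of bounded Lipschitz domains, in particular piecewise smooth ones). All functions are complex valued; $\|\cdot\|$ and $\langle u,v\rangle=\int_\Gamma u\,\bar v$ are the norm and inner product of $L^2(\Gamma)$ with respect to surface measure. Let $\nabla$ be the surface gradient and $H^1(\Gamma)\subset L^2(\Gamma)$ its domain, namely the closure of the tangential gradient of restrictions to $\Gamma$ of smooth functions on $\mathbb{R}^3$. Let $H^{1/2}(\Gamma)$ be the space of $u\in L^2(\Gamma)$ with finite norm $$\|u\|_{H^{1/2}}^2=\|u\|^2+\iint_{\Gamma\times\Gamma}\frac{|u(x)-u(y)|^2}{|x-y|^3},$$ and let $H^{-1/2}(\Gamma)$ be its antidual, the pairing $\langle\theta,v\rangle$ of $\theta\in H^{-1/2}(\Gamma)$ with $v\in H^{1/2}(\Gamma)$ extending the $L^2$ inner product. The Laplace--Beltrami operator $\Delta_\Gamma$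 is understood weakly, $\langle\Delta_\Gamma u,\tau\rangle=-\langle\nabla u,\nabla\tau\rangle$ for $u,\tau\in H^1(\Gamma)$. Let $\kappa>0$. Then: 1. $H^1(\Gamma)\subset H^{1/2}(\Gamma)$, and for every $\theta\in H^{-1/2}(\Gamma)$ there is exactly one $u\in H^1(\Gamma)$ with $\langle(\kappa^2I-\Delta_\Gamma)u,\tau\rangle=\langle\theta,\tau\rangle$ for all $\tau\in H^1(\Gamma)$; thus $R_{\mathrm{SL}}=(\kappa^2I-\Delta_\Gamma)^{-1}$, $R_{\mathrm{SL}}\theta:=u$, is well defined. 2. For every $\theta\in H^{-1/2}(\Gamma)$, $$\langle\theta,R_{\mathrm{SL}}\theta\rangle=\|\nabla(R_{\mathrm{SL}}\theta)\|^2+\kappa^2\|R_{\mathrm{SL}}\theta\|^2,$$ and this is $>0$ if $\theta\neq0$. 3. $R_{\mathrm{SL}}$ is a valid stabilisation operator: it is a compact linear operator $H^{-1/2}(\Gamma)\to H^{1/2}(\Gamma)$, and $\operatorname{Re}\langle\theta,R_{\mathrm{SL}}\theta\rangle>0$ for all $\theta\in H^{-1/2}(\Gamma)\setminus\{0\}$.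 4. For $\kappa=1$, $R_{\mathrm{SL}}$ is the modified Helmholtz regulariser $R_{\mathrm{MH}}=(I-\Delta_\Gamma)^{-1}$, defined by the same weak formulation. -/

import Mathlib

open MeasureTheory Set
open scoped ContDiff NNReal ENNReal

noncomputable section

namespace SurfaceSobolev

/-- Euclidean three-space. -/
abbrev E3 : Type := EuclideanSpace ℝ (Fin 3)

/-- A closed Lipschitz surface in space: a compact set that is locally the bi-Lipschitz image of
an open subset of the Euclidean plane. Boundaries of bounded Lipschitz domains, smooth or only
piecewise smooth (e.g. polyhedral), are of this kind. -/
structure IsClosedLipschitzSurface (Γ : Set E3) : Prop where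
  isCompact : IsCompact Γ
  exists_chart : ∀ x ∈ Γ, ∃ (V : Set E3) (U : Set (EuclideanSpace ℝ (Fin 2)))
    (ψ : EuclideanSpace ℝ (Fin 2) → E3) (K L : ℝ≥0),
    IsOpen V ∧ x ∈ V ∧ IsOpen U ∧ ψ '' U = Γ ∩ V ∧ LipschitzOnWith K ψ U ∧
      ∀ a ∈ U, ∀ b ∈ U, dist a b ≤ L * dist (ψ a) (ψ b)

/-- Surface measure on `Γ`: the two-dimensional Hausdorff measure (normalised so as to give
Lebesgue measure on planes), restricted to `Γ`. -/
def surfaceMeasure (Γ : Set E3) : Measure E3 := (μHE[2] : Measure E3).restrict Γ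

/-- The space `L²(Γ)` of complex-valued functions. -/
abbrev L2 (Γ : Set E3) : Type := Lp ℂ 2 (surfaceMeasure Γ)

/-- The space `L²(Γ; ℂ³)`. -/
abbrev L2Vec (Γ : Set E3) : Type := Lp (EuclideanSpace ℂ (Fin 3)) 2 (surfaceMeasure Γ)

/-! ### The surface gradient and `H¹(Γ)` -/

/-- The tangent space of `Γ` at `x`. On a Lipschitz surface this is a plane for almost every `x`. -/
def tangentSpace (Γ : Set E3) (x : E3) : Submodule ℝ E3 :=
  Submodule.span ℝ (tangentConeAt ℝ Γ x)

/-- The tangential gradient `∇_Γ φ (x) = P_x ∇φ(x)` of a differentiable function `φ` on space,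
where `P_x` is the orthogonal projection onto the tangent space at `x`. As `P_x` is symmetric, its
`i`-th component is the derivative of `φ` in the direction `P_x eᵢ`. -/
def tangentialGradient (Γ : Set E3) (φ : E3 → ℂ) (x : E3) : EuclideanSpace ℂ (Fin 3) :=
  WithLp.toLp 2 fun i =>
    fderiv ℝ φ x ((tangentSpace Γ x).starProjection (EuclideanSpace.single i (1 : ℝ)))

lemma tangentialGradient_add (Γ : Set E3) {φ χ : E3 → ℂ} (hφ : ContDiff ℝ ∞ φ)
    (hχ : ContDiff ℝ ∞ χ) (x : E3) :
    tangentialGradient Γ (φ + χ) x = tangentialGradient Γ φ x + tangentialGradient Γ χ x := by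
  ext i
  simp [tangentialGradient, fderiv_add (hφ.differentiable (by simp) x)
    (hχ.differentiable (by simp) x)]

lemma tangentialGradient_smul (Γ : Set E3) (c : ℂ) {φ : E3 → ℂ} (hφ : ContDiff ℝ ∞ φ) (x : E3) :
    tangentialGradient Γ (c • φ) x = c • tangentialGradient Γ φ x := by
  ext i
  simp [tangentialGradient, fderiv_const_smul (hφ.differentiable (by simp) x)]

lemma tangentialGradient_zero (Γ : Set E3) (x : E3) : tangentialGradient Γ 0 x = 0 := by
  ext i
  simp [tangentialGradient]

/-- The pairs `(φ|_Γ, ∇_Γ φ)` with `φ` smooth on space. -/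
def smoothGradientGraph (Γ : Set E3) : Submodule ℂ (L2 Γ × L2Vec Γ) where
  carrier := {w | ∃ φ : E3 → ℂ, ContDiff ℝ ∞ φ ∧ w.1 =ᵐ[surfaceMeasure Γ] φ ∧
    w.2 =ᵐ[surfaceMeasure Γ] tangentialGradient Γ φ}
  add_mem' := by
    rintro a b ⟨φ, hφ, h1, h2⟩ ⟨χ, hχ, h3, h4⟩
    refine ⟨φ + χ, hφ.add hχ, ?_, ?_⟩
    · filter_upwards [Lp.coeFn_add a.1 b.1, h1, h3] with x e e1 e3
      simp only [Prod.fst_add, e, Pi.add_apply, e1, e3]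
    · filter_upwards [Lp.coeFn_add a.2 b.2, h2, h4] with x e e1 e3
      simp only [Prod.snd_add, e, Pi.add_apply, e1, e3, tangentialGradient_add Γ hφ hχ]
  zero_mem' := by
    refine ⟨0, contDiff_const, ?_, ?_⟩
    · filter_upwards [Lp.coeFn_zero ℂ 2 (surfaceMeasure Γ)] with x e
      simpa using e
    · filter_upwards [Lp.coeFn_zero (EuclideanSpace ℂ (Fin 3)) 2 (surfaceMeasure Γ)] with x e
      simpa [tangentialGradient_zero] using e
  smul_mem' := by
    rintro c a ⟨φ, hφ, h1, h2⟩
    refine ⟨c • φ, contDiff_const.smul hφ, ?_, ?_⟩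
    · filter_upwards [Lp.coeFn_smul c a.1, h1] with x e e1
      simp only [Prod.smul_fst, e, Pi.smul_apply, e1]
    · filter_upwards [Lp.coeFn_smul c a.2, h2] with x e e1
      simp only [Prod.smul_snd, e, Pi.smul_apply, e1, tangentialGradient_smul Γ c hφ]

/-- The surface gradient `∇` on `H¹(Γ)`: the closure, as an unbounded operator from `L²(Γ)` to
`L²(Γ; ℂ³)`, of the tangential gradient on restrictions to `Γ` of smooth functions. -/
def surfaceGradient (Γ : Set E3) : L2 Γ →ₗ.[ℂ] L2Vec Γ :=
  (smoothGradientGraph Γ).topologicalClosure.toLinearPMap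

/-- The Sobolev space `H¹(Γ)`, as a subspace of `L²(Γ)`: the functions that are limits, in the norm
`(‖u‖² + ‖∇u‖²)^{1/2}`, of restrictions to `Γ` of smooth functions. -/
abbrev H1 (Γ : Set E3) : Submodule ℂ (L2 Γ) := (surfaceGradient Γ).domain

/-! ### `H^{1/2}(Γ)` and `H^{-1/2}(Γ)` -/

/-- The difference quotient `(u(x) - u(y)) / |x - y|^{3/2}`, whose `L²(Γ × Γ)` norm is the
Sobolev–Slobodeckij seminorm of order `1/2` on a surface. -/
def halfQuotient (u : E3 → ℂ) (z : E3 × E3) : ℂ :=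
  (dist z.1 z.2 ^ (3 / 2 : ℝ))⁻¹ • (u z.1 - u z.2)

lemma halfQuotient_congr (Γ : Set E3) {u v : E3 → ℂ} (h : u =ᵐ[surfaceMeasure Γ] v) :
    halfQuotient u =ᵐ[(surfaceMeasure Γ).prod (surfaceMeasure Γ)] halfQuotient v := by
  filter_upwards [Measure.quasiMeasurePreserving_fst.ae_eq_comp h,
    Measure.quasiMeasurePreserving_snd.ae_eq_comp h] with z h1 h2
  simp only [Function.comp_apply] at h1 h2
  simp only [halfQuotient, h1, h2]

lemma halfQuotient_add (u v : E3 → ℂ) :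
    halfQuotient (u + v) = halfQuotient u + halfQuotient v := by
  ext z
  simp only [halfQuotient, Pi.add_apply, ← smul_add]
  congr 1
  ring

lemma halfQuotient_smul (c : ℂ) (u : E3 → ℂ) : halfQuotient (c • u) = c • halfQuotient u := by
  ext z
  simp only [halfQuotient, Pi.smul_apply, ← smul_sub]
  rw [smul_comm]

lemma halfQuotient_zero : halfQuotient 0 = 0 := by
  ext z
  simp [halfQuotient]

/-- The subspace of those `u ∈ L²(Γ)` with `∬ |u(x) - u(y)|² / |x - y|³ < ∞`. -/
def halfSubspace (Γ : Set E3) : Submodule ℂ (L2 Γ) where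
  carrier := {u | MemLp (halfQuotient u) 2 ((surfaceMeasure Γ).prod (surfaceMeasure Γ))}
  add_mem' := by
    intro a b ha hb
    refine (memLp_congr_ae (halfQuotient_congr Γ (Lp.coeFn_add a b))).mpr ?_
    rw [halfQuotient_add]
    exact MemLp.add ha hb
  zero_mem' := by
    refine (memLp_congr_ae (halfQuotient_congr Γ (Lp.coeFn_zero ℂ 2 _))).mpr ?_
    rw [halfQuotient_zero]
    exact MemLp.zero
  smul_mem' := by
    intro c a ha
    refine (memLp_congr_ae (halfQuotient_congr Γ (Lp.coeFn_smul c a))).mpr ?_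
    rw [halfQuotient_smul]
    exact MemLp.const_smul ha c

/-- The Sobolev space `H^{1/2}(Γ)` (Sobolev–Slobodeckij). It is a type of its own, as its norm is
not that of `L²(Γ)`. -/
def HHalf (Γ : Set E3) : Type := ↥(halfSubspace Γ)

namespace HHalf

variable {Γ : Set E3}

instance : AddCommGroup (HHalf Γ) := inferInstanceAs (AddCommGroup ↥(halfSubspace Γ))

instance : Module ℂ (HHalf Γ) := inferInstanceAs (Module ℂ ↥(halfSubspace Γ))

/-- The element of `L²(Γ)` underlying an element of `H^{1/2}(Γ)`. -/
def toL2 : HHalf Γ →ₗ[ℂ] L2 Γ := (halfSubspace Γ).subtype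

lemma memLp_halfQuotient (u : HHalf Γ) :
    MemLp (halfQuotient (toL2 u)) 2 ((surfaceMeasure Γ).prod (surfaceMeasure Γ)) := u.2

/-- The embedding `u ↦ (u, (u(x) - u(y)) / |x - y|^{3/2})` into `L²(Γ) × L²(Γ × Γ)`. -/
def embed : HHalf Γ →ₗ[ℂ]
    WithLp 2 (L2 Γ × Lp ℂ 2 ((surfaceMeasure Γ).prod (surfaceMeasure Γ))) where
  toFun u := WithLp.toLp 2 (toL2 u, (memLp_halfQuotient u).toLp (halfQuotient (toL2 u)))
  map_add' u v := by
    have h : halfQuotient (toL2 (u + v)) =ᵐ[(surfaceMeasure Γ).prod (surfaceMeasure Γ)]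
        halfQuotient (toL2 u) + halfQuotient (toL2 v) := by
      rw [map_add, ← halfQuotient_add]
      exact halfQuotient_congr Γ (Lp.coeFn_add _ _)
    refine congrArg (WithLp.toLp 2) (Prod.ext (map_add toL2 u v) ?_)
    exact MemLp.toLp_congr (memLp_halfQuotient (u + v))
      ((memLp_halfQuotient u).add (memLp_halfQuotient v)) h
  map_smul' c u := by
    have h : halfQuotient (toL2 (c • u)) =ᵐ[(surfaceMeasure Γ).prod (surfaceMeasure Γ)]
        c • halfQuotient (toL2 u) := by
      rw [map_smul, ← halfQuotient_smul]
      exact halfQuotient_congr Γ (Lp.coeFn_smul _ _)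
    refine congrArg (WithLp.toLp 2) (Prod.ext (map_smul toL2 c u) ?_)
    exact MemLp.toLp_congr (memLp_halfQuotient (c • u)) ((memLp_halfQuotient u).const_smul c) h

lemma embed_injective : Function.Injective (embed (Γ := Γ)) := by
  intro u v h
  have h1 : toL2 u = toL2 v := congrArg (fun w => w.fst) h
  exact Subtype.ext h1

/-- The norm with `‖u‖² = ‖u‖²_{L²} + ∬ |u(x) - u(y)|² / |x - y|³`. -/
instance : NormedAddCommGroup (HHalf Γ) :=
  NormedAddCommGroup.induced (HHalf Γ) _ embed embed_injective

instance : InnerProductSpace ℂ (HHalf Γ) := InnerProductSpace.induced embed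

end HHalf

/-- The Sobolev space `H^{-1/2}(Γ)`: the space of bounded antilinear functionals on `H^{1/2}(Γ)`,
with the dual norm. The value `θ v` is the duality pairing `⟨θ, v⟩`, which extends the `L²` inner
product `⟨θ, v⟩ = ∫ θ v̄` (linear in `θ`, antilinear in `v`). -/
abbrev HNegHalf (Γ : Set E3) : Type := HHalf Γ →L⋆[ℂ] ℂ

/-! ### Operators -/

/-- The `L²` inner product `⟨u, v⟩ = ∫ u v̄`, linear in the first argument. -/
def pairing (Γ : Set E3) (u v : L2 Γ) : ℂ := inner ℂ v u

/-- The weak Laplace–Beltrami operator, `⟨Δ_Γ u, τ⟩ = -⟨∇u, ∇τ⟩` for `u, τ ∈ H¹(Γ)`. -/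
def laplaceBeltrami (Γ : Set E3) (u τ : H1 Γ) : ℂ :=
  -inner ℂ (surfaceGradient Γ τ) (surfaceGradient Γ u)

/-- The operator `κ² I - Δ_Γ`, in the weak sense `⟨(κ² I - Δ_Γ) u, τ⟩` for `u, τ ∈ H¹(Γ)`. -/
def shiftedLaplacian (Γ : Set E3) (κ : ℝ) (u τ : H1 Γ) : ℂ :=
  (κ : ℂ) ^ 2 * pairing Γ u τ - laplaceBeltrami Γ u τ

/-- The operator `I - Δ_Γ`, in the weak sense. -/
def modifiedHelmholtz (Γ : Set E3) (u τ : H1 Γ) : ℂ :=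
  pairing Γ u τ - laplaceBeltrami Γ u τ

/-- `u` solves `A u = θ` weakly: `u ∈ H¹(Γ)` and `⟨A u, τ⟩ = ⟨θ, τ⟩` for all `τ ∈ H¹(Γ)`. -/
def SolvesWeakly {Γ : Set E3} (A : H1 Γ → H1 Γ → ℂ) (θ : HNegHalf Γ) (u : HHalf Γ) : Prop :=
  ∃ hu : u.toL2 ∈ H1 Γ, ∀ (τ : HHalf Γ) (hτ : τ.toL2 ∈ H1 Γ), A ⟨u.toL2, hu⟩ ⟨τ.toL2, hτ⟩ = θ τ

open Classical in
/-- The inverse of an operator `A` given weakly on `H¹(Γ)`: it sends `θ` to the solution of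
`A u = θ` (and to zero if there is none). -/
def weakInverse {Γ : Set E3} (A : H1 Γ → H1 Γ → ℂ) (θ : HNegHalf Γ) : HHalf Γ :=
  if h : ∃ u, SolvesWeakly A θ u then h.choose else 0

/-- The shifted Laplace regulariser `R_SL = (κ² I - Δ_Γ)⁻¹`. -/
def shiftedLaplaceRegulariser (Γ : Set E3) (κ : ℝ) : HNegHalf Γ → HHalf Γ :=
  weakInverse (shiftedLaplacian Γ κ)

/-- The modified Helmholtz regulariser `R_MH = (I - Δ_Γ)⁻¹`. -/
def modifiedHelmholtzRegulariser (Γ : Set E3) : HNegHalf Γ → HHalf Γ :=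
  weakInverse (modifiedHelmholtz Γ)

/-- Valid stabilisation operators: compact linear operators `R` from `H^{-1/2}(Γ)` to
`H^{1/2}(Γ)` with `Re ⟨θ, R θ⟩ > 0` for all `θ ≠ 0`. -/
def IsStabilisationOperator {Γ : Set E3} (R : HNegHalf Γ → HHalf Γ) : Prop :=
  IsLinearMap ℂ R ∧ IsCompactOperator R ∧ ∀ θ : HNegHalf Γ, θ ≠ 0 → 0 < (θ (R θ)).re

end SurfaceSobolev

end

open SurfaceSobolev

noncomputable section

namespace SurfaceSobolev

open Metric Filter Topology

/-! The weak equation is the Riesz representation theorem in the Hilbert space `energySpace`, which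
is H¹(Γ) with inner product κ²⟨u, v⟩ + ⟨∇u, ∇v⟩. Its embedding J in H^{1/2}(Γ) is bounded, so every
θ in H^{-1/2}(Γ) restricts to a bounded antilinear functional on it, and R_SL is the Riesz map
followed by J (`regulariser_eq`). The energy identity is the weak equation tested with its own
solution. R_SL is compact because J is. It is strictly positive because J has dense range: if R_SL θ
= 0, then θ vanishes on H¹(Γ). For κ = 1 the two weak forms coincide. The analytic content is four
facts about a surface that is merely Lipschitz.

Closability (`snd_eq_zero_of_fst_eq_zero`): if (0, g) is a limit of pairs (φ, ∇φ), then g = 0. By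
Rademacher's theorem the tangent space is almost everywhere the range of the derivative of a chart
(`tangentSpace_eq`). Integration by parts in the chart then shows that g is annihilated by tangent
vectors. Normal vectors annihilate every tangential gradient, hence also g.

Interpolation (`exists_lintegral_halfQuotient_le`): pairs at distance less than δ contribute at most
Cδ‖∇u‖² to the Gagliardo seminorm, because |h|² / |h|³ is integrable near 0 in the plane; the other
pairs contribute at most a constant times δ⁻³‖u‖². This gives the inclusion of H¹(Γ) in H^{1/2}(Γ),
with a small factor in front of the gradient.

Density (`eq_zero_of_forall_H1`): Γ is Ahlfors regular of dimension two, so weighted averages of u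
at scale ε are smooth, differ from u in L² by O(√ε) times the seminorm, and stay bounded in H^{1/2}.
They converge strongly only in L², but a functional bounded on H^{1/2} cannot tell such a limit from
a weak one (`inner_eq_zero_of_tendsto`).

Compactness (`isCompactOperator_toHHalf`): averages at the centres of a finite ε-net form an
operator of finite rank that controls ‖u‖² up to a multiple of ε times the squared seminorm. With
the interpolation inequality, ‖Jw‖² ≤ η‖w‖² + B‖Tw‖² with T of finite rank and η arbitrarily small,
and this forces J to be compact. -/

/-- The Euclidean plane. -/
abbrev E2 : Type := EuclideanSpace ℝ (Fin 2)

/-! ### Bi-Lipschitz charts; surface measure against Lebesgue measure. -/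

/-- A bi-Lipschitz chart of `Γ` at `ψ a`, defined and Lipschitz on the whole plane, whose
restriction to `ball a ρ` covers `Γ ∩ ball (ψ a) (2 * s)`. -/
structure IsChart (Γ : Set E3) (ψ : E2 → E3) (a : E2) (ρ s : ℝ) (K L : ℝ≥0) : Prop where
  lipschitz : LipschitzWith K ψ
  dist_le : ∀ b ∈ ball a (2 * ρ), ∀ b' ∈ ball a (2 * ρ), dist b b' ≤ L * dist (ψ b) (ψ b')
  radius_pos : 0 < ρ
  scale_pos : 0 < s
  mem : ∀ b ∈ ball a (2 * ρ), ψ b ∈ Γ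
  covers : Γ ∩ ball (ψ a) (2 * s) ⊆ ψ '' ball a ρ

/-- A Lipschitz map on `U` extends to the whole plane at the cost of a larger constant. The doubled
radii `2 * ρ` and `2 * s` leave room for small discs about points of `ball a ρ` and for small balls
about points of `ball (ψ a) s`. -/
lemma IsClosedLipschitzSurface.exists_isChart {Γ : Set E3} (h : IsClosedLipschitzSurface Γ)
    {x : E3} (hx : x ∈ Γ) :
    ∃ (ψ : E2 → E3) (a : E2) (ρ s : ℝ) (K L : ℝ≥0), IsChart Γ ψ a ρ s K L ∧ ψ a = x := by
  obtain ⟨V, U, φ, K, L, hV, hxV, hU, himg, hK, hL⟩ := h.exists_chart x hx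
  obtain ⟨ψ, hψ, hψφ⟩ : ∃ ψ : E2 → E3, LipschitzWith (lipschitzExtensionConstant E3 * K) ψ ∧
      EqOn φ ψ U := hK.extend_finite_dimension
  obtain ⟨a, haU, rfl⟩ : x ∈ φ '' U := himg ▸ ⟨hx, hxV⟩
  obtain ⟨r, hr, hrU⟩ := Metric.isOpen_iff.1 hU a haU
  obtain ⟨t, ht, htV⟩ := Metric.isOpen_iff.1 hV _ hxV
  have hsub : ball a (2 * (r / 2)) ⊆ U := by rwa [mul_div_cancel₀ _ two_ne_zero]
  -- The first bound keeps `ball (ψ a) (2 * s)` inside `V`. By the second, points of Γ in that ball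
  -- have parameters within `ρ = r / 2` of `a`; `L + 1` avoids dividing by zero.
  have hs : 0 < min (t / 2) (r / 2 / (2 * (L + 1))) := by positivity
  refine ⟨ψ, a, r / 2, min (t / 2) (r / 2 / (2 * (L + 1))), _, L,
    ⟨hψ, fun b hb b' hb' => ?_, by positivity, hs, fun b hb => ?_, ?_⟩, (hψφ haU).symm⟩
  · rw [← hψφ (hsub hb), ← hψφ (hsub hb')]
    exact hL b (hsub hb) b' (hsub hb')
  · rw [← hψφ (hsub hb)]
    exact (himg.subset ⟨b, hsub hb, rfl⟩).1
  · rintro y ⟨hy, hyb⟩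
    rw [← hψφ haU, mem_ball] at hyb
    have hyV : y ∈ V := htV <| by
      rw [mem_ball]
      linarith [min_le_left (t / 2) (r / 2 / (2 * (L + 1)))]
    obtain ⟨b, hbU, rfl⟩ : y ∈ φ '' U := himg ▸ ⟨hy, hyV⟩
    refine ⟨b, ?_, (hψφ hbU).symm⟩
    have h1 := hL b hbU a haU
    have h2 : dist (φ b) (φ a) < r / 2 / (L + 1) := by
      refine hyb.trans_le ((mul_le_mul_of_nonneg_left (min_le_right _ _) zero_le_two).trans
        (le_of_eq ?_))
      field_simp
    have h3 : (L : ℝ) * dist (φ b) (φ a) ≤ (L + 1) * dist (φ b) (φ a) := by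
      nlinarith [dist_nonneg (x := φ b) (y := φ a)]
    rw [mem_ball]
    refine (h1.trans h3).trans_lt ?_
    rw [lt_div_iff₀ (by positivity)] at h2
    linarith

lemma _root_.LipschitzOnWith.euclideanHausdorffMeasure_image_le {X Y : Type*} [MetricSpace X]
    [MeasurableSpace X] [BorelSpace X] [MetricSpace Y] [MeasurableSpace Y] [BorelSpace Y]
    {f : X → Y} {s : Set X} {K : ℝ≥0} (hf : LipschitzOnWith K f s) :
    (μHE[2] : Measure Y) (f '' s) ≤ (K : ℝ≥0∞) ^ 2 * (μHE[2] : Measure X) s := by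
  have h := hf.hausdorffMeasure_image_le (d := 2) zero_le_two
  have hc : ∀ (c : ℝ≥0) (m : ℝ≥0∞), c • m = c * m := fun c m => rfl
  simp only [Measure.euclideanHausdorffMeasure_def, Measure.smul_apply, hc]
  rw [mul_left_comm]
  norm_cast at h ⊢
  gcongr

namespace IsChart

variable {Γ : Set E3} {ψ : E2 → E3} {a : E2} {ρ s : ℝ} {K L : ℝ≥0}

lemma ball_subset (h : IsChart Γ ψ a ρ s K L) : ball a ρ ⊆ ball a (2 * ρ) :=
  ball_subset_ball (by linarith [h.radius_pos])

lemma injOn (h : IsChart Γ ψ a ρ s K L) : InjOn ψ (ball a (2 * ρ)) := by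
  intro b hb b' hb' hbb
  have := h.dist_le b hb b' hb'
  rw [hbb, dist_self, mul_zero] at this
  exact dist_le_zero.1 this

/-- The inverse chart is `L`-Lipschitz on the image, so it enlarges two-dimensional measure by at
most `L ^ 2`. -/
lemma volume_le (h : IsChart Γ ψ a ρ s K L) {T : Set E2} (hT : T ⊆ ball a (2 * ρ)) :
    volume T ≤ (L : ℝ≥0∞) ^ 2 * (μHE[2] : Measure E3) (ψ '' T) := by
  have hinj := h.injOn.mono hT
  have hg : LipschitzOnWith L (Function.invFunOn ψ T) (ψ '' T) := by
    refine LipschitzOnWith.of_dist_le_mul ?_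
    rintro _ ⟨b, hb, rfl⟩ _ ⟨b', hb', rfl⟩
    rw [hinj.leftInvOn_invFunOn hb, hinj.leftInvOn_invFunOn hb']
    exact h.dist_le b (hT hb) b' (hT hb')
  have := hg.euclideanHausdorffMeasure_image_le
  rwa [hinj.leftInvOn_invFunOn.image_image,
    EuclideanSpace.euclideanHausdorffMeasure_eq_volume] at this

/-- Through this bound null sets and L² functions on Γ pull back to the parameter disc;
`restrict_le` is the comparison in the other direction. -/
lemma map_le (h : IsChart Γ ψ a ρ s K L) :
    Measure.map ψ (volume.restrict (ball a (2 * ρ))) ≤ (L : ℝ≥0∞) ^ 2 • surfaceMeasure Γ := by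
  refine Measure.le_iff.2 fun S hS => ?_
  have hψ := h.lipschitz.continuous.measurable
  rw [Measure.map_apply hψ hS, Measure.restrict_apply (hψ hS), Measure.smul_apply,
    surfaceMeasure, Measure.restrict_apply hS, smul_eq_mul]
  refine (h.volume_le inter_subset_right).trans ?_
  gcongr
  rintro _ ⟨b, ⟨hb, hb'⟩, rfl⟩
  exact ⟨hb, h.mem b hb'⟩

lemma restrict_le (h : IsChart Γ ψ a ρ s K L) :
    (surfaceMeasure Γ).restrict (ball (ψ a) (2 * s)) ≤
      (K : ℝ≥0∞) ^ 2 • Measure.map ψ (volume.restrict (ball a ρ)) := by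
  refine Measure.le_iff.2 fun S hS => ?_
  have hψ := h.lipschitz.continuous.measurable
  rw [Measure.smul_apply, Measure.map_apply hψ hS, Measure.restrict_apply (hψ hS),
    Measure.restrict_apply hS, surfaceMeasure, Measure.restrict_apply (hS.inter measurableSet_ball),
    smul_eq_mul, ← EuclideanSpace.euclideanHausdorffMeasure_eq_volume]
  refine le_trans (measure_mono ?_) (h.lipschitz.lipschitzOnWith.euclideanHausdorffMeasure_image_le)
  rintro y ⟨⟨hyS, hyb⟩, hyΓ⟩
  obtain ⟨b, hb, rfl⟩ := h.covers ⟨hyΓ, hyb⟩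
  exact ⟨b, ⟨hyS, hb⟩, rfl⟩

/-- A property holding almost everywhere in the parameter domain holds almost everywhere on the
corresponding piece of the surface. -/
lemma ae_restrict (h : IsChart Γ ψ a ρ s K L) (hΓ : MeasurableSet Γ) {p : E3 → Prop}
    (hp : ∀ᵐ b ∂volume.restrict (ball a ρ), ψ b ∈ ball (ψ a) (2 * s) → p (ψ b)) :
    ∀ᵐ x ∂(surfaceMeasure Γ).restrict (ball (ψ a) (2 * s)), p x := by
  rw [ae_iff, Measure.restrict_apply₀' measurableSet_ball.nullMeasurableSet, surfaceMeasure,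
    Measure.restrict_apply' hΓ]
  rw [ae_iff, Measure.restrict_apply₀' measurableSet_ball.nullMeasurableSet] at hp
  have h1 := (h.lipschitz.lipschitzOnWith (s := {b | ¬(ψ b ∈ ball (ψ a) (2 * s) → p (ψ b))} ∩
    ball a ρ)).euclideanHausdorffMeasure_image_le
  rw [EuclideanSpace.euclideanHausdorffMeasure_eq_volume, hp, mul_zero] at h1
  refine measure_mono_null ?_ (le_antisymm h1 zero_le)
  rintro y ⟨⟨hyp, hyb⟩, hyΓ⟩
  obtain ⟨b, hb, rfl⟩ := h.covers ⟨hyΓ, hyb⟩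
  exact ⟨b, ⟨fun hh => hyp (hh hyb), hb⟩, rfl⟩

end IsChart

/-! ### From charts to the whole surface; Ahlfors regularity. -/

namespace IsClosedLipschitzSurface

variable {Γ : Set E3}

/-- A property of pieces of `Γ` that is inherited by subsets and unions holds for `Γ` if it holds
in the ball `ball (ψ a) s` of every chart. -/
lemma induction_on_charts (h : IsClosedLipschitzSurface Γ) {p : Set E3 → Prop} (he : p ∅)
    (hmono : ∀ ⦃S T⦄, S ⊆ T → p T → p S) (hunion : ∀ ⦃S T⦄, p S → p T → p (S ∪ T))
    (hchart : ∀ ψ a ρ s K L, IsChart Γ ψ a ρ s K L → p (ball (ψ a) s)) : p Γ := by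
  refine h.isCompact.induction_on he hmono hunion fun x hx => ?_
  obtain ⟨ψ, a, ρ, s, K, L, hc, rfl⟩ := h.exists_isChart hx
  exact ⟨_, mem_nhdsWithin_of_mem_nhds (ball_mem_nhds _ hc.scale_pos), hchart _ _ _ _ _ _ hc⟩

lemma measurableSet (h : IsClosedLipschitzSurface Γ) : MeasurableSet Γ :=
  h.isCompact.isClosed.measurableSet

lemma ae_mem (h : IsClosedLipschitzSurface Γ) : ∀ᵐ x ∂surfaceMeasure Γ, x ∈ Γ :=
  ae_restrict_mem h.measurableSet

lemma restrict_self (h : IsClosedLipschitzSurface Γ) :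
    (surfaceMeasure Γ).restrict Γ = surfaceMeasure Γ := by
  rw [surfaceMeasure, Measure.restrict_restrict h.measurableSet, inter_self]

/-- Almost everywhere properties may be checked in charts. -/
lemma ae_of_charts (h : IsClosedLipschitzSurface Γ) {p : E3 → Prop}
    (hp : ∀ ψ a ρ s K L, IsChart Γ ψ a ρ s K L →
      ∀ᵐ x ∂(surfaceMeasure Γ).restrict (ball (ψ a) (2 * s)), p x) :
    ∀ᵐ x ∂surfaceMeasure Γ, p x := by
  have := h.induction_on_charts (p := fun S => ∀ᵐ x ∂(surfaceMeasure Γ).restrict S, p x)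
    (by simp) (fun S T hST hT => ae_restrict_of_ae_restrict_of_subset hST hT)
    (fun S T hS hT => (ae_restrict_union_iff _ _ _).2 ⟨hS, hT⟩)
    (fun ψ a ρ s K L hc => ae_restrict_of_ae_restrict_of_subset
      (ball_subset_ball (by linarith [hc.scale_pos])) (hp _ _ _ _ _ _ hc))
  rwa [h.restrict_self] at this

lemma measure_lt_top (h : IsClosedLipschitzSurface Γ) : surfaceMeasure Γ univ < ⊤ := by
  have := h.induction_on_charts (p := fun S => surfaceMeasure Γ S < ⊤)
    (by simp) (fun S T hST hT => (measure_mono hST).trans_lt hT)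
    (fun S T hS hT => (measure_union_le _ _).trans_lt (ENNReal.add_lt_top.2 ⟨hS, hT⟩))
    (fun ψ a ρ s K L hc => by
      have h1 := hc.restrict_le (ball (ψ a) (2 * s))
      rw [Measure.restrict_apply_self] at h1
      refine (measure_mono (ball_subset_ball (by linarith [hc.scale_pos]))).trans_lt
        (h1.trans_lt ?_)
      rw [Measure.smul_apply, smul_eq_mul]
      refine ENNReal.mul_lt_top (by finiteness) ((measure_mono (subset_univ _)).trans_lt ?_)
      rw [Measure.map_apply hc.lipschitz.continuous.measurable MeasurableSet.univ]
      simpa only [preimage_univ, Measure.restrict_apply_univ] using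
        measure_ball_lt_top (μ := (volume : Measure E2)) (x := a) (r := ρ))
  rwa [← Measure.restrict_apply_univ, h.restrict_self] at this

lemma isFiniteMeasure (h : IsClosedLipschitzSurface Γ) : IsFiniteMeasure (surfaceMeasure Γ) :=
  ⟨h.measure_lt_top⟩

/-- The parameters of points in a ball of radius `r` are at mutual distance at most `2 * L * r`, so
they lie in a disc of that radius about any one of them. -/
lemma _root_.SurfaceSobolev.IsChart.measure_ball_le {ψ : E2 → E3} {a : E2} {ρ s : ℝ} {K L : ℝ≥0}
    (hc : IsChart Γ ψ a ρ s K L) {x : E3} {r : ℝ}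
    (hsub : ball x r ⊆ ball (ψ a) (2 * s)) :
    surfaceMeasure Γ (ball x r) ≤
      ((K : ℝ≥0∞) ^ 2 * (2 * L) ^ 2 * NNReal.pi) * ENNReal.ofReal r ^ 2 := by
  have h1 := hc.restrict_le (ball x r)
  have hψ := hc.lipschitz.continuous.measurable (measurableSet_ball (x := x) (ε := r))
  rw [Measure.restrict_eq_self _ hsub, Measure.smul_apply, smul_eq_mul,
    Measure.map_apply hc.lipschitz.continuous.measurable measurableSet_ball,
    Measure.restrict_apply hψ] at h1
  refine h1.trans ?_
  rw [mul_assoc, mul_assoc]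
  gcongr
  rcases (ψ ⁻¹' ball x r ∩ ball a ρ).eq_empty_or_nonempty with he | ⟨b₀, hb₀, hb₀'⟩
  · simp [he]
  have hsub' : ψ ⁻¹' ball x r ∩ ball a ρ ⊆ closedBall b₀ (2 * L * r) := by
    rintro b ⟨hb, hb'⟩
    have h2 := hc.dist_le b (hc.ball_subset hb') b₀ (hc.ball_subset hb₀')
    have h3 : dist (ψ b) (ψ b₀) ≤ 2 * r := by
      have h4 : dist (ψ b) x < r := hb
      have h5 : dist (ψ b₀) x < r := hb₀
      linarith [dist_triangle_right (ψ b) (ψ b₀) x]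
    rw [mem_closedBall]
    nlinarith [mul_le_mul_of_nonneg_left h3 L.coe_nonneg]
  refine (measure_mono hsub').trans (le_of_eq ?_)
  have hL : ENNReal.ofReal (2 * L * r) = 2 * L * ENNReal.ofReal r := by
    rw [ENNReal.ofReal_mul (by positivity), ENNReal.ofReal_mul (by positivity),
      ENNReal.ofReal_coe_nnreal, ENNReal.ofReal_ofNat]
  have hpi : ENNReal.ofReal Real.pi = NNReal.pi := by
    rw [← NNReal.coe_real_pi, ENNReal.ofReal_coe_nnreal]
  rw [EuclideanSpace.volume_closedBall_fin_two, hL, hpi]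
  ring

/-- Upper Ahlfors regularity. -/
lemma exists_measure_ball_le (h : IsClosedLipschitzSurface Γ) :
    ∃ C : ℝ≥0∞, C ≠ ⊤ ∧ ∀ x ∈ Γ, ∀ r : ℝ, 0 < r →
      surfaceMeasure Γ (ball x r) ≤ C * ENNReal.ofReal r ^ 2 := by
  refine h.induction_on_charts (p := fun S => ∃ C : ℝ≥0∞, C ≠ ⊤ ∧ ∀ x ∈ S, ∀ r : ℝ, 0 < r →
      surfaceMeasure Γ (ball x r) ≤ C * ENNReal.ofReal r ^ 2) ⟨0, by simp⟩
    (fun S T hST ⟨C, h1, hC⟩ => ⟨C, h1, fun x hx => hC x (hST hx)⟩) ?_ ?_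
  · rintro S T ⟨C, h1, hC⟩ ⟨C', h1', hC'⟩
    refine ⟨C + C', by finiteness, fun x hx r hr => ?_⟩
    rw [add_mul]
    rcases hx with hx | hx
    · exact (hC x hx r hr).trans le_self_add
    · exact (hC' x hx r hr).trans le_add_self
  · intro ψ a ρ s K L hc
    have hfin := h.isFiniteMeasure
    have hs := ENNReal.ofReal_pos.2 hc.scale_pos
    have hm : surfaceMeasure Γ univ ≠ ⊤ := hfin.measure_univ_lt_top.ne
    -- The first summand serves radii up to `s`, where the chart applies. For larger radii the total
    -- mass suffices, since `r / s > 1`.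
    refine ⟨(K : ℝ≥0∞) ^ 2 * (2 * L) ^ 2 * NNReal.pi + surfaceMeasure Γ univ /
      ENNReal.ofReal s ^ 2, ?_, fun x hx r hr => ?_⟩
    · exact ENNReal.add_ne_top.2 ⟨by finiteness, ENNReal.div_ne_top hm (by positivity)⟩
    rw [add_mul]
    rcases le_or_gt r s with hrs | hrs
    · exact (hc.measure_ball_le (ball_subset_ball' (by linarith [mem_ball.1 hx]))).trans
        le_self_add
    · refine le_trans ?_ le_add_self
      refine (measure_mono (subset_univ _)).trans ?_
      rw [ENNReal.mul_comm_div]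
      refine le_mul_of_one_le_right' ?_
      rw [ENNReal.le_div_iff_mul_le (.inl (by positivity)) (.inl (by finiteness)), one_mul]
      gcongr

/-- Lower Ahlfors regularity. -/
lemma exists_le_measure_ball (h : IsClosedLipschitzSurface Γ) :
    ∃ c : ℝ≥0∞, ∃ r₀ : ℝ, c ≠ 0 ∧ 0 < r₀ ∧ ∀ x ∈ Γ, ∀ r : ℝ, 0 < r → r ≤ r₀ →
      c * ENNReal.ofReal r ^ 2 ≤ surfaceMeasure Γ (ball x r) := by
  have := h.induction_on_charts (p := fun S => ∃ c : ℝ≥0∞, ∃ r₀ : ℝ, c ≠ 0 ∧ 0 < r₀ ∧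
      ∀ x ∈ Γ ∩ S, ∀ r : ℝ, 0 < r → r ≤ r₀ →
      c * ENNReal.ofReal r ^ 2 ≤ surfaceMeasure Γ (ball x r)) ⟨1, 1, by simp⟩
    (fun S T hST ⟨c, r₀, h1, h2, hC⟩ => ⟨c, r₀, h1, h2, fun x hx => hC x ⟨hx.1, hST hx.2⟩⟩) ?_ ?_
  · simpa only [inter_self] using this
  · rintro S T ⟨c, r₀, h1, h2, hC⟩ ⟨c', r₀', h1', h2', hC'⟩
    refine ⟨min c c', min r₀ r₀', (lt_min (pos_iff_ne_zero.2 h1) (pos_iff_ne_zero.2 h1')).ne',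
      lt_min h2 h2', ?_⟩
    rintro x ⟨hx, hx' | hx'⟩ r hr hrr
    · exact le_trans (by gcongr; exact min_le_left _ _)
        (hC x ⟨hx, hx'⟩ r hr (hrr.trans (min_le_left _ _)))
    · exact le_trans (by gcongr; exact min_le_right _ _)
        (hC' x ⟨hx, hx'⟩ r hr (hrr.trans (min_le_right _ _)))
  · intro ψ a ρ s K L hc
    have hs := hc.scale_pos
    have hρ := hc.radius_pos
    -- The disc of radius `r / (K + 1)` about the parameter is mapped into the ball of radius `r`,
    -- and its image loses at most a factor `(L + 1) ^ 2` of area. The bound on `r` keeps this disc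
    -- in `ball a (2 * ρ)`.
    refine ⟨NNReal.pi / (K + 1) ^ 2 / (L + 1) ^ 2, (K + 1) * ρ, ?_, by positivity, ?_⟩
    · refine ENNReal.div_ne_zero.2 ⟨ENNReal.div_ne_zero.2 ⟨?_, by finiteness⟩, by finiteness⟩
      simpa using NNReal.pi_ne_zero
    rintro x ⟨hx, hxb⟩ r hr hrr
    obtain ⟨b, hb, rfl⟩ := hc.covers ⟨hx, ball_subset_ball (by linarith) hxb⟩
    have hK : (0 : ℝ) < K + 1 := by positivity
    have hrK : r / (K + 1) ≤ ρ := by rwa [div_le_iff₀ hK, mul_comm]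
    have hsub : ball b (r / (K + 1)) ⊆ ball a (2 * ρ) :=
      ball_subset_ball' (by linarith [mem_ball.1 hb])
    have h1 := hc.volume_le hsub
    have hpi : ENNReal.ofReal Real.pi = NNReal.pi := by
      rw [← NNReal.coe_real_pi, ENNReal.ofReal_coe_nnreal]
    have hKe : ENNReal.ofReal ((K : ℝ) + 1) = K + 1 := by
      rw [ENNReal.ofReal_add K.coe_nonneg zero_le_one, ENNReal.ofReal_coe_nnreal, ENNReal.ofReal_one]
    rw [EuclideanSpace.volume_ball_fin_two, hpi, ENNReal.ofReal_div_of_pos hK, hKe] at h1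
    have h2 : ψ '' ball b (r / (K + 1)) ⊆ ball (ψ b) r ∩ Γ := by
      rintro _ ⟨b', hb', rfl⟩
      refine ⟨?_, hc.mem _ (hsub hb')⟩
      have h3 := hc.lipschitz.dist_le_mul b' b
      rw [mem_ball, lt_div_iff₀ hK] at hb'
      rw [mem_ball]
      nlinarith [dist_nonneg (x := b') (y := b)]
    have h3 : (μHE[2] : Measure E3) (ψ '' ball b (r / (K + 1))) ≤
        surfaceMeasure Γ (ball (ψ b) r) := by
      rw [surfaceMeasure, Measure.restrict_apply measurableSet_ball]
      exact measure_mono h2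
    have h4 : (L : ℝ≥0∞) ^ 2 * (μHE[2] : Measure E3) (ψ '' ball b (r / (K + 1))) ≤
        surfaceMeasure Γ (ball (ψ b) r) * (L + 1) ^ 2 := by
      rw [mul_comm]
      gcongr
      exact le_self_add
    refine le_trans (le_of_eq ?_) (ENNReal.div_le_of_le_mul (h1.trans h4))
    simp only [div_eq_mul_inv, mul_pow, ENNReal.inv_pow]
    ring

end IsClosedLipschitzSurface

/-! ### Tangent planes and measurability of the tangential gradient. -/

namespace IsChart

variable {Γ : Set E3} {ψ : E2 → E3} {a : E2} {ρ s : ℝ} {K L : ℝ≥0}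

lemma fderiv_mem_tangentConeAt (h : IsChart Γ ψ a ρ s K L) {b : E2} (hb : b ∈ ball a (2 * ρ))
    (hd : DifferentiableAt ℝ ψ b) (v : E2) : fderiv ℝ ψ b v ∈ tangentConeAt ℝ Γ (ψ b) := by
  have h1 := (hd.hasFDerivAt.hasFDerivWithinAt (s := ball a (2 * ρ))).mapsTo_tangent_cone
  rw [tangentConeAt_of_mem_nhds (isOpen_ball.mem_nhds hb)] at h1
  exact tangentConeAt_mono (by rintro _ ⟨c, hc, rfl⟩; exact h.mem c hc) (h1 (mem_univ v))

lemma fderiv_mem_tangentSpace (h : IsChart Γ ψ a ρ s K L) {b : E2} (hb : b ∈ ball a (2 * ρ))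
    (hd : DifferentiableAt ℝ ψ b) (v : E2) : fderiv ℝ ψ b v ∈ tangentSpace Γ (ψ b) :=
  Submodule.subset_span (h.fderiv_mem_tangentConeAt hb hd v)

/-- A tangent vector is a limit of `c n • d n` with `ψ b + d n` in Γ. These points have parameters
`b' n`, and the lower Lipschitz bound gives `‖b' n - b‖ ≤ L * ‖d n‖`. So the remainder in the
differentiability of `ψ`, multiplied by `c n`, tends to zero, and the vector is a limit of elements
of the range, which is closed. -/
lemma tangentSpace_eq (h : IsChart Γ ψ a ρ s K L) {b : E2} (hb : b ∈ ball a (2 * ρ))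
    (hbs : ψ b ∈ ball (ψ a) (2 * s)) (hd : DifferentiableAt ℝ ψ b) :
    tangentSpace Γ (ψ b) = LinearMap.range (fderiv ℝ ψ b : E2 →ₗ[ℝ] E3) := by
  refine le_antisymm (Submodule.span_le.2 fun y hy => ?_) ?_
  · obtain ⟨α, l, hl, c, d, hd0, hdΓ, hcd⟩ := exists_fun_of_mem_tangentConeAt hy
    have hex : ∀ᶠ n in l, ∃ b' ∈ ball a ρ, ψ b' = ψ b + d n := by
      have h1 : ∀ᶠ n in l, ψ b + d n ∈ ball (ψ a) (2 * s) := by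
        have : Tendsto (fun n => ψ b + d n) l (𝓝 (ψ b)) := by simpa using hd0.const_add (ψ b)
        exact this.eventually (isOpen_ball.mem_nhds hbs)
      filter_upwards [h1, hdΓ] with n h2 h3
      exact h.covers ⟨h3, h2⟩
    choose! b' hb' hψb' using fun n (hn : ∃ b' ∈ ball a ρ, ψ b' = ψ b + d n) => hn
    have hbound : ∀ᶠ n in l, ‖b' n - b‖ ≤ L * ‖d n‖ := by
      filter_upwards [hex] with n hn
      have := h.dist_le (b' n) (h.ball_subset (hb' n hn)) b hb
      rwa [hψb' n hn, dist_eq_norm, dist_eq_norm, add_sub_cancel_left] at this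
    have hbt : Tendsto b' l (𝓝 b) := by
      rw [tendsto_iff_norm_sub_tendsto_zero]
      refine squeeze_zero' (Eventually.of_forall fun _ => norm_nonneg _) hbound ?_
      simpa using hd0.norm.const_mul (L : ℝ)
    have ho : (fun n => ψ (b' n) - ψ b - fderiv ℝ ψ b (b' n - b)) =o[l] fun n => b' n - b :=
      (hasFDerivAt_iff_isLittleO.1 hd.hasFDerivAt).comp_tendsto hbt
    have ho2 : (fun n => c n • (ψ (b' n) - ψ b - fderiv ℝ ψ b (b' n - b))) =o[l]
        fun n => c n • d n :=
      (Asymptotics.isBigO_refl c l).smul_isLittleO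
        (ho.trans_isBigO (Asymptotics.IsBigO.of_bound _ hbound))
    have ho3 : Tendsto (fun n => c n • (ψ (b' n) - ψ b - fderiv ℝ ψ b (b' n - b))) l (𝓝 0) :=
      (Asymptotics.isLittleO_one_iff ℝ).1 (ho2.trans_isBigO (hcd.isBigO_one ℝ))
    have hlim : Tendsto (fun n => fderiv ℝ ψ b (c n • (b' n - b))) l (𝓝 y) := by
      have := hcd.sub ho3
      rw [sub_zero] at this
      refine this.congr' ?_
      filter_upwards [hex] with n hn
      rw [hψb' n hn, map_smul, ← smul_sub]
      congr 1
      abel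
    have hclosed : IsClosed (LinearMap.range (fderiv ℝ ψ b : E2 →ₗ[ℝ] E3) : Set E3) :=
      Submodule.closed_of_finiteDimensional _
    exact hclosed.mem_of_tendsto hlim (Eventually.of_forall fun n => ⟨_, rfl⟩)
  · rintro _ ⟨v, rfl⟩
    exact h.fderiv_mem_tangentSpace hb hd v

/-- It expresses the parameter as a continuous function of the point, so that measurability passes
from the plane to Γ. -/
lemma exists_leftInverse (h : IsChart Γ ψ a ρ s K L) :
    ∃ g : E3 → E2, Continuous g ∧ ∀ b ∈ ball a (2 * ρ), g (ψ b) = b := by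
  have hg : LipschitzOnWith L (Function.invFunOn ψ (ball a (2 * ρ))) (ψ '' ball a (2 * ρ)) := by
    refine LipschitzOnWith.of_dist_le_mul ?_
    rintro _ ⟨b, hb, rfl⟩ _ ⟨b', hb', rfl⟩
    rw [h.injOn.leftInvOn_invFunOn hb, h.injOn.leftInvOn_invFunOn hb']
    exact h.dist_le b hb b' hb'
  obtain ⟨g, hg, hgeq⟩ := hg.extend_finite_dimension
  exact ⟨g, hg.continuous, fun b hb => by
    rw [← hgeq ⟨b, hb, rfl⟩, h.injOn.leftInvOn_invFunOn hb]⟩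

end IsChart

/-- The projection onto the range of a linear map depends measurably on the map. -/
lemma measurable_starProjection_range {α : Type*} [MeasurableSpace α] {A : α → E2 →L[ℝ] E3}
    (hA : ∀ v, Measurable fun x => A x v) (w : E3) :
    Measurable fun x => (LinearMap.range (A x : E2 →ₗ[ℝ] E3)).starProjection w := by
  -- The distance from `w` to the range is an infimum over countably many parameters, hence
  -- measurable. Pythagoras then yields the norm of the projection, and polarisation yields its
  -- coordinates.
  have hnorm : ∀ w : E3, Measurable fun x =>
      ‖w - (LinearMap.range (A x : E2 →ₗ[ℝ] E3)).starProjection w‖ := by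
    intro w
    have : ∀ x, ‖w - (LinearMap.range (A x : E2 →ₗ[ℝ] E3)).starProjection w‖ =
        ⨅ n, ‖w - A x (TopologicalSpace.denseSeq E2 n)‖ := by
      intro x
      rw [Submodule.starProjection_minimal]
      have hbdd : ∀ {ι : Type} (f : ι → E3), BddBelow (range fun i => ‖w - f i‖) := fun f =>
        ⟨0, by rintro _ ⟨i, rfl⟩; exact norm_nonneg _⟩
      refine le_antisymm ?_ (le_ciInf ?_)
      · exact le_ciInf fun n => ciInf_le (hbdd _)
          (⟨A x (TopologicalSpace.denseSeq E2 n), _, rfl⟩ : LinearMap.range (A x : E2 →ₗ[ℝ] E3))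
      · rintro ⟨_, v, rfl⟩
        refine (TopologicalSpace.denseRange_denseSeq E2).induction_on
          (p := fun v => ⨅ n, ‖w - A x (TopologicalSpace.denseSeq E2 n)‖ ≤ ‖w - A x v‖) v
          (isClosed_le continuous_const (by fun_prop)) fun n => ciInf_le (hbdd _) n
    simp_rw [this]
    exact Measurable.iInf fun n => ((hA _).const_sub w).norm
  have hsq : ∀ w : E3, Measurable fun x =>
      ‖(LinearMap.range (A x : E2 →ₗ[ℝ] E3)).starProjection w‖ ^ 2 := by
    intro w
    have : ∀ x, ‖(LinearMap.range (A x : E2 →ₗ[ℝ] E3)).starProjection w‖ ^ 2 =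
        ‖w‖ ^ 2 - ‖w - (LinearMap.range (A x : E2 →ₗ[ℝ] E3)).starProjection w‖ ^ 2 := by
      intro x
      rw [Submodule.norm_sq_eq_add_norm_sq_starProjection w (LinearMap.range (A x : E2 →ₗ[ℝ] E3)),
        Submodule.starProjection_orthogonal_val, add_sub_cancel_right]
    simp_rw [this]
    exact ((hnorm w).pow_const 2).const_sub _
  have hinner : ∀ e : E3, Measurable fun x =>
      inner ℝ e ((LinearMap.range (A x : E2 →ₗ[ℝ] E3)).starProjection w) := by
    intro e
    have : ∀ x, inner ℝ e ((LinearMap.range (A x : E2 →ₗ[ℝ] E3)).starProjection w) =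
        (‖(LinearMap.range (A x : E2 →ₗ[ℝ] E3)).starProjection (e + w)‖ ^ 2 -
        ‖(LinearMap.range (A x : E2 →ₗ[ℝ] E3)).starProjection (e - w)‖ ^ 2) / 4 := by
      intro x
      set P := (LinearMap.range (A x : E2 →ₗ[ℝ] E3)).starProjection
      have h1 : inner ℝ e (P w) = inner ℝ (P e) (P w) := by
        rw [Submodule.inner_starProjection_left_eq_right,
          Submodule.starProjection_eq_self_iff.2 (Submodule.starProjection_apply_mem _ w)]
      have h2 := re_inner_eq_norm_add_mul_self_sub_norm_sub_mul_self_div_four (𝕜 := ℝ) (P e) (P w)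
      rw [h1, map_add, map_sub, sq, sq]
      exact h2
    simp_rw [this]
    exact ((hsq _).sub (hsq _)).div_const 4
  have hsum : ∀ x, (LinearMap.range (A x : E2 →ₗ[ℝ] E3)).starProjection w =
      ∑ i, inner ℝ (EuclideanSpace.basisFun (Fin 3) ℝ i)
        ((LinearMap.range (A x : E2 →ₗ[ℝ] E3)).starProjection w) •
          EuclideanSpace.basisFun (Fin 3) ℝ i :=
    fun x => ((EuclideanSpace.basisFun (Fin 3) ℝ).sum_repr' _).symm
  rw [funext hsum]
  exact Finset.measurable_sum _ fun i _ => (hinner _).smul_const _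

lemma measurable_starProjection_range_fderiv {ψ : E2 → E3} (w : E3) :
    Measurable fun b => (LinearMap.range (fderiv ℝ ψ b : E2 →ₗ[ℝ] E3)).starProjection w :=
  measurable_starProjection_range (fun v => measurable_fderiv_apply_const ℝ ψ v) w

namespace IsClosedLipschitzSurface

variable {Γ : Set E3}

lemma aestronglyMeasurable_of_charts {F : Type*} [TopologicalSpace F]
    [TopologicalSpace.PseudoMetrizableSpace F] (h : IsClosedLipschitzSurface Γ) {f : E3 → F}
    (hf : ∀ ψ a ρ s K L, IsChart Γ ψ a ρ s K L →
      AEStronglyMeasurable f ((surfaceMeasure Γ).restrict (ball (ψ a) (2 * s)))) :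
    AEStronglyMeasurable f (surfaceMeasure Γ) := by
  have := h.induction_on_charts
    (p := fun S => AEStronglyMeasurable f ((surfaceMeasure Γ).restrict S)) (by simp)
    (fun S T hST hT => hT.mono_set hST)
    (fun S T hS hT => aestronglyMeasurable_union_iff.2 ⟨hS, hT⟩)
    (fun ψ a ρ s K L hc => (hf _ _ _ _ _ _ hc).mono_set
      (ball_subset_ball (by linarith [hc.scale_pos])))
  rwa [h.restrict_self] at this

/-- By Rademacher and `tangentSpace_eq`, in a chart this is almost everywhere the projection onto
the range of `fderiv ℝ ψ`, taken at the parameter of the point. -/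
lemma aestronglyMeasurable_starProjection (h : IsClosedLipschitzSurface Γ) (w : E3) :
    AEStronglyMeasurable (fun x => (tangentSpace Γ x).starProjection w) (surfaceMeasure Γ) := by
  refine h.aestronglyMeasurable_of_charts fun ψ a ρ s K L hc => ?_
  obtain ⟨g, hg, hgψ⟩ := hc.exists_leftInverse
  refine ((measurable_starProjection_range_fderiv (ψ := ψ) w).comp
    hg.measurable).aestronglyMeasurable.congr ?_
  refine hc.ae_restrict h.measurableSet ?_
  filter_upwards [ae_restrict_of_ae hc.lipschitz.ae_differentiableAt,
    ae_restrict_mem measurableSet_ball] with b hb hba hbs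
  simp only [Function.comp_apply, hgψ b (hc.ball_subset hba),
    hc.tangentSpace_eq (hc.ball_subset hba) hbs hb]

lemma memLp_of_continuous {F : Type*} [NormedAddCommGroup F]
    [SecondCountableTopologyEither E3 F] (h : IsClosedLipschitzSurface Γ)
    {f : E3 → F} (hf : Continuous f) : MemLp f 2 (surfaceMeasure Γ) := by
  have := h.isFiniteMeasure
  obtain ⟨M, hM⟩ := h.isCompact.exists_bound_of_continuousOn hf.continuousOn
  exact MemLp.of_bound hf.aestronglyMeasurable M (h.ae_mem.mono hM)

lemma aestronglyMeasurable_tangentialGradient (h : IsClosedLipschitzSurface Γ) {φ : E3 → ℂ}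
    (hφ : ContDiff ℝ ∞ φ) :
    AEStronglyMeasurable (tangentialGradient Γ φ) (surfaceMeasure Γ) := by
  refine (PiLp.continuous_toLp 2 _).comp_aestronglyMeasurable ?_
  rw [aestronglyMeasurable_iff_aemeasurable, aemeasurable_pi_iff]
  intro i
  exact (isBoundedBilinearMap_apply.continuous.comp_aestronglyMeasurable
    ((hφ.continuous_fderiv (by simp)).aestronglyMeasurable.prodMk
      (h.aestronglyMeasurable_starProjection _))).aemeasurable

lemma norm_tangentialGradient_le (φ : E3 → ℂ) (x : E3) :
    ‖tangentialGradient Γ φ x‖ ≤ 2 * ‖fderiv ℝ φ x‖ := by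
  rw [tangentialGradient, EuclideanSpace.norm_eq]
  refine Real.sqrt_le_iff.2 ⟨by positivity, ?_⟩
  -- There are three components, each bounded by the norm of the derivative, and 3 ≤ 2².
  have : ∀ i : Fin 3, ‖fderiv ℝ φ x ((tangentSpace Γ x).starProjection
      (EuclideanSpace.single i (1 : ℝ)))‖ ^ 2 ≤ ‖fderiv ℝ φ x‖ ^ 2 := by
    intro i
    gcongr
    refine ((fderiv ℝ φ x).le_opNorm _).trans (mul_le_of_le_one_right (norm_nonneg _) ?_)
    exact (Submodule.norm_starProjection_apply_le _ _).trans (by simp)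
  refine (Finset.sum_le_sum fun i _ => this i).trans ?_
  rw [Finset.sum_const, Finset.card_univ, Fintype.card_fin, nsmul_eq_mul]
  push_cast
  nlinarith [sq_nonneg ‖fderiv ℝ φ x‖]

lemma memLp_tangentialGradient (h : IsClosedLipschitzSurface Γ) {φ : E3 → ℂ}
    (hφ : ContDiff ℝ ∞ φ) : MemLp (tangentialGradient Γ φ) 2 (surfaceMeasure Γ) := 
  ((h.memLp_of_continuous (hφ.continuous_fderiv (by simp))).norm.const_mul 2).mono'
    (h.aestronglyMeasurable_tangentialGradient hφ)
    (Eventually.of_forall (norm_tangentialGradient_le φ))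

/-- The element of the graph of the gradient given by a smooth function. -/
lemma mem_smoothGradientGraph (h : IsClosedLipschitzSurface Γ) {φ : E3 → ℂ}
    (hφ : ContDiff ℝ ∞ φ) :
    ((h.memLp_of_continuous hφ.continuous).toLp φ,
      (h.memLp_tangentialGradient hφ).toLp (tangentialGradient Γ φ)) ∈ smoothGradientGraph Γ :=
  ⟨φ, hφ, (h.memLp_of_continuous hφ.continuous).coeFn_toLp,
    (h.memLp_tangentialGradient hφ).coeFn_toLp⟩

end IsClosedLipschitzSurface

/-! ### Integration by parts in charts; closability of the surface gradient. -/

/-- The bilinear pairing `∑ i, t i * g i` of a real vector with a complex one. -/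
def dot (t : E3) (g : EuclideanSpace ℂ (Fin 3)) : ℂ := ∑ i, (t i : ℂ) * g i

lemma dot_add_left (t t' : E3) (g : EuclideanSpace ℂ (Fin 3)) :
    dot (t + t') g = dot t g + dot t' g := by
  simp [dot, add_mul, Finset.sum_add_distrib]

lemma dot_smul_left (c : ℝ) (t : E3) (g : EuclideanSpace ℂ (Fin 3)) :
    dot (c • t) g = c * dot t g := by
  simp [dot, Finset.mul_sum, mul_assoc]

lemma dot_sub_right (t : E3) (g g' : EuclideanSpace ℂ (Fin 3)) :
    dot t (g - g') = dot t g - dot t g' := by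
  simp [dot, mul_sub, Finset.sum_sub_distrib]

lemma norm_dot_le (t : E3) (g : EuclideanSpace ℂ (Fin 3)) : ‖dot t g‖ ≤ 3 * ‖t‖ * ‖g‖ := by
  refine (norm_sum_le _ _).trans ((Finset.sum_le_sum (g := fun _ => ‖t‖ * ‖g‖) fun i _ => ?_).trans
    (by simp [mul_assoc]))
  rw [norm_mul, Complex.norm_real]
  exact mul_le_mul (PiLp.norm_apply_le t i) (PiLp.norm_apply_le g i) (norm_nonneg _) (norm_nonneg _)

lemma continuous_dot : Continuous fun z : E3 × EuclideanSpace ℂ (Fin 3) => dot z.1 z.2 := by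
  unfold dot
  fun_prop

lemma eq_zero_of_forall_dot {g : EuclideanSpace ℂ (Fin 3)} (h : ∀ t, dot t g = 0) : g = 0 := by
  ext i
  have := h (EuclideanSpace.single i 1)
  simpa [dot, Pi.single_apply, apply_ite, Finset.sum_ite_eq] using this

lemma dot_tangentialGradient (Γ : Set E3) (φ : E3 → ℂ) (x t : E3) :
    dot t (tangentialGradient Γ φ x) = fderiv ℝ φ x ((tangentSpace Γ x).starProjection t) := by
  have ht : t = ∑ i, t i • EuclideanSpace.single i (1 : ℝ) := by
    simpa using ((EuclideanSpace.basisFun (Fin 3) ℝ).sum_repr t).symm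
  conv_rhs => rw [ht]
  simp only [map_sum, map_smul, dot, tangentialGradient, Complex.real_smul]

lemma dot_tangentialGradient_of_mem {Γ : Set E3} (φ : E3 → ℂ) {x t : E3}
    (ht : t ∈ tangentSpace Γ x) :
    dot t (tangentialGradient Γ φ x) = fderiv ℝ φ x t := by
  rw [dot_tangentialGradient, Submodule.starProjection_eq_self_iff.2 ht]

lemma dot_tangentialGradient_of_mem_orthogonal {Γ : Set E3} (φ : E3 → ℂ) {x t : E3}
    (ht : t ∈ (tangentSpace Γ x)ᗮ) : dot t (tangentialGradient Γ φ x) = 0 := by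
  rw [dot_tangentialGradient, (Submodule.starProjection_apply_eq_zero_iff _).2 ht, map_zero]

/-- A smooth function may be replaced by a Lipschitz one without changing it near a bounded set. -/
lemma exists_lipschitz_eqOn {Γ : Set E3} (h : Bornology.IsBounded Γ) {φ : E3 → ℂ}
    (hφ : ContDiff ℝ ∞ φ) :
    ∃ χ : E3 → ℂ, ContDiff ℝ ∞ χ ∧ (∃ C, LipschitzWith C χ) ∧ EqOn χ φ Γ ∧
      EqOn (tangentialGradient Γ χ) (tangentialGradient Γ φ) Γ := by
  obtain ⟨R, hR0, hR⟩ := h.subset_ball_lt 0 0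
  let f : ContDiffBump (0 : E3) := ⟨R, R + 1, hR0, by linarith⟩
  have hsm : ContDiff ℝ ∞ fun x => f x • φ x := f.contDiff.smul hφ
  have hev : ∀ x ∈ Γ, (fun x => f x • φ x) =ᶠ[𝓝 x] φ := by
    intro x hx
    filter_upwards [f.eventuallyEq_one_of_mem_ball (hR hx)] with y hy
    simp [hy]
  refine ⟨fun x => f x • φ x, hsm, ?_, fun x hx => (hev x hx).eq_of_nhds, fun x hx => ?_⟩
  · exact hsm.lipschitzWith_of_hasCompactSupport f.hasCompactSupport.smul_right (by simp)
  · simp only [tangentialGradient, (hev x hx).fderiv_eq]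

/-- The real and imaginary parts reduce it to integration by parts for real Lipschitz functions. -/
lemma _root_.LipschitzWith.integral_smul_lineDeriv_complex {v : E2 → ℂ} {C : ℝ≥0}
    (hv : LipschitzWith C v) {η : E2 → ℝ} (hη : ContDiff ℝ ∞ η) (hηc : HasCompactSupport η)
    (h : E2) :
    ∫ b, η b • lineDeriv ℝ v b h = -∫ b, lineDeriv ℝ η b h • v b := by
  obtain ⟨D, hD⟩ := hη.lipschitzWith_of_hasCompactSupport hηc (by simp)
  have hline : ∀ b w, lineDeriv ℝ η b w = fderiv ℝ η b w := fun b w =>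
    (hη.differentiable (by simp) b).lineDeriv_eq_fderiv
  have hi1 : Integrable fun b => η b • lineDeriv ℝ v b h := by
    refine ((hη.continuous.integrable_of_hasCompactSupport hηc).norm.mul_const
      (C * ‖h‖)).mono' (hη.continuous.aestronglyMeasurable.smul
        (measurable_lineDeriv hv.continuous).aestronglyMeasurable) (Eventually.of_forall fun b => ?_)
    rw [norm_smul]
    gcongr
    exact norm_lineDeriv_le_of_lipschitz ℝ hv
  have hi2 : Integrable fun b => lineDeriv ℝ η b h • v b := by
    simp only [hline]
    exact (((hη.continuous_fderiv (by simp)).clm_apply continuous_const).smul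
      hv.continuous).integrable_of_hasCompactSupport (hηc.fderiv_apply ℝ h).smul_right
  have key : ∀ (T : ℂ →L[ℝ] ℝ), T (∫ b, η b • lineDeriv ℝ v b h) =
      T (-∫ b, lineDeriv ℝ η b h • v b) := by
    intro T
    have h1 := (T.lipschitz.comp hv).integral_lineDeriv_mul_eq (μ := volume) hD hηc h
    rw [map_neg, ← T.integral_comp_comm hi1, ← T.integral_comp_comm hi2, ← integral_neg]
    simp only [map_smul, smul_eq_mul]
    convert! h1 using 1
    · refine integral_congr_ae ?_
      filter_upwards [hv.ae_differentiableAt] with b hb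
      rw [mul_comm, hb.lineDeriv_eq_fderiv,
        (T.differentiableAt.comp b hb).lineDeriv_eq_fderiv, fderiv_comp b T.differentiableAt hb]
      simp
    · simp only [hline, map_neg, Function.comp_apply, neg_mul]
  exact Complex.ext (key Complex.reCLM) (key Complex.imCLM)

namespace IsChart

variable {Γ : Set E3} {ψ : E2 → E3} {a : E2} {ρ s : ℝ} {K L : ℝ≥0}

lemma ae_comp (hc : IsChart Γ ψ a ρ s K L) {p : E3 → Prop} (hp : ∀ᵐ x ∂surfaceMeasure Γ, p x) :
    ∀ᵐ b ∂volume.restrict (ball a (2 * ρ)), p (ψ b) :=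
  ae_of_ae_map hc.lipschitz.continuous.measurable.aemeasurable
    ((Measure.absolutelyContinuous_of_le hc.map_le).ae_le
      (Measure.smul_absolutelyContinuous.ae_le hp))

lemma aestronglyMeasurable_comp {F : Type*} [TopologicalSpace F]
    (hc : IsChart Γ ψ a ρ s K L) {f : E3 → F} (hf : AEStronglyMeasurable f (surfaceMeasure Γ)) :
    AEStronglyMeasurable (fun b => f (ψ b)) (volume.restrict (ball a (2 * ρ))) :=
  AEStronglyMeasurable.comp_aemeasurable
    ((hf.smul_measure ((L : ℝ≥0∞) ^ 2)).mono_measure hc.map_le)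
    hc.lipschitz.continuous.measurable.aemeasurable

lemma lintegral_comp_le (hc : IsChart Γ ψ a ρ s K L) {f : E3 → ℝ≥0∞}
    (hf : AEMeasurable f (surfaceMeasure Γ)) :
    ∫⁻ b in ball a (2 * ρ), f (ψ b) ≤ (L : ℝ≥0∞) ^ 2 * ∫⁻ x, f x ∂surfaceMeasure Γ := by
  rw [← lintegral_map' ((hf.smul_measure _).mono_measure hc.map_le)
      hc.lipschitz.continuous.measurable.aemeasurable]
  exact (lintegral_mono' hc.map_le le_rfl).trans (lintegral_smul_measure _ _).le

variable {F : Type*} [NormedAddCommGroup F]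

lemma lintegral_enorm_comp_le (hc : IsChart Γ ψ a ρ s K L) {f : E3 → F}
    (hf : AEStronglyMeasurable f (surfaceMeasure Γ)) :
    ∫⁻ b in ball a (2 * ρ), ‖f (ψ b)‖ₑ ≤ (L : ℝ≥0∞) ^ 2 * (eLpNorm f 2 (surfaceMeasure Γ) *
      surfaceMeasure Γ univ ^ (1 / (1 : ℝ≥0∞).toReal - 1 / (2 : ℝ≥0∞).toReal)) := by
  refine (hc.lintegral_comp_le hf.enorm).trans ?_
  gcongr
  rw [← eLpNorm_one_eq_lintegral_enorm]
  exact eLpNorm_le_eLpNorm_mul_rpow_measure_univ one_le_two hf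

lemma integrable_comp (hc : IsChart Γ ψ a ρ s K L) (hΓ : surfaceMeasure Γ univ < ⊤)
    {f : E3 → F} (hf : MemLp f 2 (surfaceMeasure Γ)) :
    IntegrableOn (fun b => f (ψ b)) (ball a (2 * ρ)) := by
  refine ⟨hc.aestronglyMeasurable_comp hf.1, (hc.lintegral_enorm_comp_le hf.1).trans_lt ?_⟩
  have := hf.2
  refine ENNReal.mul_lt_top (by finiteness) (ENNReal.mul_lt_top hf.2 ?_)
  exact ENNReal.rpow_lt_top_of_nonneg (by norm_num) hΓ.ne

/-- Integration in a chart against bounded coefficients is continuous on `L²(Γ)`. -/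
lemma tendsto_setIntegral (hc : IsChart Γ ψ a ρ s K L) (hΓ : surfaceMeasure Γ univ < ⊤)
    {G : Type*} [NormedAddCommGroup G] [NormedSpace ℝ G] {T : E2 → F → G} {M : ℝ}
    (hsub : ∀ b z z', T b (z - z') = T b z - T b z') (hM : ∀ b z, ‖T b z‖ ≤ M * ‖z‖)
    (hmeas : ∀ {f : E3 → F}, AEStronglyMeasurable f (surfaceMeasure Γ) →
      AEStronglyMeasurable (fun b => T b (f (ψ b))) (volume.restrict (ball a (2 * ρ))))
    {u : ℕ → Lp F 2 (surfaceMeasure Γ)} {u₀ : Lp F 2 (surfaceMeasure Γ)}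
    (hu : Tendsto u atTop (𝓝 u₀)) :
    Tendsto (fun n => ∫ b in ball a (2 * ρ), T b (u n (ψ b))) atTop
      (𝓝 (∫ b in ball a (2 * ρ), T b (u₀ (ψ b)))) := by
  have hint : ∀ w : Lp F 2 (surfaceMeasure Γ),
      IntegrableOn (fun b => T b (w (ψ b))) (ball a (2 * ρ)) := fun w =>
    ((hc.integrable_comp hΓ (Lp.memLp w)).norm.const_mul M).mono' (hmeas (Lp.memLp w).1)
      (Eventually.of_forall fun b => hM _ _)
  refine tendsto_integral_of_L1 _ (hmeas (Lp.memLp u₀).1) (Eventually.of_forall fun n => hint _) ?_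
  have h1 : ∀ n, ∫⁻ b in ball a (2 * ρ), ‖T b (u n (ψ b)) - T b (u₀ (ψ b))‖ₑ ≤
      ENNReal.ofReal M * ((L : ℝ≥0∞) ^ 2 *
        (eLpNorm (u n - u₀ : E3 → F) 2 (surfaceMeasure Γ) *
          surfaceMeasure Γ univ ^ (1 / (1 : ℝ≥0∞).toReal - 1 / (2 : ℝ≥0∞).toReal))) := by
    intro n
    refine le_trans ?_ (mul_le_mul_right (hc.lintegral_enorm_comp_le
      ((Lp.memLp (u n)).1.sub (Lp.memLp u₀).1)) _)
    rw [← lintegral_const_mul' _ _ (by finiteness)]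
    refine lintegral_mono fun b => ?_
    rw [← hsub, ← ofReal_norm, ← ofReal_norm, Pi.sub_apply,
      ← ENNReal.ofReal_mul' (norm_nonneg _)]
    exact ENNReal.ofReal_le_ofReal (hM _ _)
  refine tendsto_of_tendsto_of_tendsto_of_le_of_le tendsto_const_nhds ?_ (fun _ => zero_le) h1
  have h2 := (Lp.tendsto_Lp_iff_tendsto_eLpNorm' u u₀).1 hu
  have h3 : surfaceMeasure Γ univ ^ (1 / (1 : ℝ≥0∞).toReal - 1 / (2 : ℝ≥0∞).toReal) ≠ ⊤ :=
    (ENNReal.rpow_lt_top_of_nonneg (by norm_num) hΓ.ne).ne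
  have h4 := ENNReal.Tendsto.const_mul (a := ENNReal.ofReal M) (ENNReal.Tendsto.const_mul
    (a := (L : ℝ≥0∞) ^ 2) (ENNReal.Tendsto.mul_const h2 (.inr h3)) (.inr (by finiteness)))
    (.inr (by finiteness))
  simpa using h4

end IsChart

namespace IsChart

variable {Γ : Set E3} {ψ : E2 → E3} {a : E2} {ρ s : ℝ} {K L : ℝ≥0}

lemma aestronglyMeasurable_dot_fderiv {Ψ : E2 → E3} {ν : Measure E2}
    {g : E2 → EuclideanSpace ℂ (Fin 3)} (hg : AEStronglyMeasurable g ν) (v : E2) :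
    AEStronglyMeasurable (fun b => dot (fderiv ℝ Ψ b v) (g b)) ν :=
  have h1 : AEStronglyMeasurable (fun b => fderiv ℝ Ψ b v) ν :=
    (measurable_fderiv_apply_const ℝ Ψ v).aestronglyMeasurable
  Continuous.comp_aestronglyMeasurable (g := fun z : E3 × _ => dot z.1 z.2)
    (f := fun b => (fderiv ℝ Ψ b v, g b)) continuous_dot (h1.prodMk hg)

/-- Integration by parts in a chart for the restriction of a smooth function. -/
lemma integral_dot_smooth (hc : IsChart Γ ψ a ρ s K L) (hΓ : IsClosedLipschitzSurface Γ)
    {w : L2 Γ × L2Vec Γ} (hw : w ∈ smoothGradientGraph Γ) {η : E2 → ℝ} (hη : ContDiff ℝ ∞ η)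
    (hηc : HasCompactSupport η) (hηs : tsupport η ⊆ ball a (2 * ρ)) (v : E2) :
    ∫ b in ball a (2 * ρ), η b • dot (fderiv ℝ ψ b v) (w.2 (ψ b)) =
      -∫ b in ball a (2 * ρ), lineDeriv ℝ η b v • w.1 (ψ b) := by
  obtain ⟨φ, hφ, h1, h2⟩ := hw
  obtain ⟨χ, hχ, ⟨C, hC⟩, hχ1, hχ2⟩ := exists_lipschitz_eqOn hΓ.isCompact.isBounded hφ
  have key := (hC.comp hc.lipschitz).integral_smul_lineDeriv_complex hη hηc v
  have hout : ∀ b ∉ ball a (2 * ρ), η b = 0 := fun b hb => image_eq_zero_of_notMem_tsupport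
    fun hb' => hb (hηs hb')
  have hout' : ∀ b ∉ ball a (2 * ρ), lineDeriv ℝ η b v = 0 := fun b hb => by
    rw [(hη.differentiable (by simp) b).lineDeriv_eq_fderiv]
    have : fderiv ℝ η b = 0 := image_eq_zero_of_notMem_tsupport
      fun hb' => hb (hηs (tsupport_fderiv_subset ℝ hb'))
    rw [this, zero_apply]
  rw [← setIntegral_eq_integral_of_forall_compl_eq_zero (s := ball a (2 * ρ)) (μ := volume)
      (f := fun b => η b • lineDeriv ℝ (χ ∘ ψ) b v) fun b hb => by simp [hout b hb],
    ← setIntegral_eq_integral_of_forall_compl_eq_zero (s := ball a (2 * ρ)) (μ := volume)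
      (f := fun b => lineDeriv ℝ η b v • (χ ∘ ψ) b) fun b hb => by simp [hout' b hb]] at key
  convert! key using 1
  · refine integral_congr_ae ?_
    filter_upwards [hc.ae_comp h2, ae_restrict_of_ae hc.lipschitz.ae_differentiableAt,
      ae_restrict_mem measurableSet_ball] with b hb hd hbm
    have hχd := hχ.differentiable (by simp) (ψ b)
    rw [hb, ← hχ2 (hc.mem b hbm), dot_tangentialGradient_of_mem _
      (hc.fderiv_mem_tangentSpace hbm hd v), (hχd.comp b hd).lineDeriv_eq_fderiv,
      fderiv_comp b hχd hd, ContinuousLinearMap.comp_apply]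
  · congr 1
    refine integral_congr_ae ?_
    filter_upwards [hc.ae_comp h1, ae_restrict_mem measurableSet_ball] with b hb hbm
    rw [hb, Function.comp_apply, hχ1 (hc.mem b hbm)]

/-- The coefficients are bounded because `ψ` and `η` are Lipschitz, so both sides are continuous in
the pair for the L² topologies and the identity extends from smooth functions to the closure. -/
lemma integral_dot (hc : IsChart Γ ψ a ρ s K L) (hΓ : IsClosedLipschitzSurface Γ)
    {w : L2 Γ × L2Vec Γ} (hw : w ∈ (smoothGradientGraph Γ).topologicalClosure) {η : E2 → ℝ}
    (hη : ContDiff ℝ ∞ η)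
    (hηc : HasCompactSupport η) (hηs : tsupport η ⊆ ball a (2 * ρ)) (v : E2) :
    ∫ b in ball a (2 * ρ), η b • dot (fderiv ℝ ψ b v) (w.2 (ψ b)) =
      -∫ b in ball a (2 * ρ), lineDeriv ℝ η b v • w.1 (ψ b) := by
  obtain ⟨u, hu, hlim⟩ := mem_closure_iff_seq_limit.1 hw
  obtain ⟨M, hM⟩ := hη.continuous.bounded_above_of_compact_support hηc
  obtain ⟨D, hD⟩ := hη.lipschitzWith_of_hasCompactSupport hηc (by simp)
  have h1 := hc.tendsto_setIntegral (T := fun b z => η b • dot (fderiv ℝ ψ b v) z)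
    (M := M * (3 * (K * ‖v‖))) hΓ.measure_lt_top
    (fun b z z' => by simp only [dot_sub_right, smul_sub])
    (fun b z => by
      have hK : ‖fderiv ℝ ψ b v‖ ≤ K * ‖v‖ := ((fderiv ℝ ψ b).le_opNorm v).trans
        (mul_le_mul_of_nonneg_right (norm_fderiv_le_of_lipschitz ℝ hc.lipschitz) (norm_nonneg v))
      rw [norm_smul, mul_assoc]
      refine mul_le_mul (hM b) ((norm_dot_le _ _).trans ?_) (norm_nonneg _)
        ((norm_nonneg _).trans (hM b))
      gcongr)
    (fun hf => hη.continuous.aestronglyMeasurable.smul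
      (aestronglyMeasurable_dot_fderiv (hc.aestronglyMeasurable_comp hf) v))
    ((continuous_snd.tendsto _).comp hlim)
  have h2 := hc.tendsto_setIntegral (T := fun b (z : ℂ) => lineDeriv ℝ η b v • z)
    (M := D * ‖v‖) hΓ.measure_lt_top (fun b z z' => smul_sub _ _ _)
    (fun b z => by
      rw [norm_smul]
      gcongr
      exact norm_lineDeriv_le_of_lipschitz ℝ hD)
    (fun hf => (measurable_lineDeriv hη.continuous).aestronglyMeasurable.smul
      (hc.aestronglyMeasurable_comp hf))
    ((continuous_fst.tendsto _).comp hlim)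
  refine tendsto_nhds_unique h1 (h2.neg.congr fun n => ?_)
  exact (hc.integral_dot_smooth hΓ (hu n) hη hηc hηs v).symm

end IsChart

namespace IsClosedLipschitzSurface

variable {Γ : Set E3}

/-- Tangential gradients of smooth functions satisfy this at every point, and an almost everywhere
convergent subsequence carries it to the limit. -/
lemma ae_dot_eq_zero_of_mem_orthogonal {w : L2 Γ × L2Vec Γ}
    (hw : w ∈ (smoothGradientGraph Γ).topologicalClosure) :
    ∀ᵐ x ∂surfaceMeasure Γ, ∀ t ∈ (tangentSpace Γ x)ᗮ, dot t (w.2 x) = 0 := by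
  obtain ⟨u, hu, hlim⟩ := mem_closure_iff_seq_limit.1 hw
  have h2 : Tendsto (fun n => (u n).2) atTop (𝓝 w.2) := (continuous_snd.tendsto _).comp hlim
  obtain ⟨ns, -, hns⟩ := (tendstoInMeasure_of_tendsto_Lp h2).exists_seq_tendsto_ae
  choose φ _ _ hφ using hu
  filter_upwards [hns, ae_all_iff.2 fun n => hφ n] with x hx hφx t ht
  refine tendsto_nhds_unique ((continuous_dot.tendsto (t, w.2 x)).comp
    (tendsto_const_nhds.prodMk_nhds hx)) (tendsto_const_nhds.congr fun n => ?_)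
  simp only [Function.comp_apply, hφx, dot_tangentialGradient_of_mem_orthogonal _ ht]

/-- The tangential gradient is closable. -/
lemma snd_eq_zero_of_fst_eq_zero (h : IsClosedLipschitzSurface Γ) {w : L2 Γ × L2Vec Γ}
    (hw : w ∈ (smoothGradientGraph Γ).topologicalClosure) (hw0 : w.1 = 0) : w.2 = 0 := by
  have htan : ∀ᵐ x ∂surfaceMeasure Γ, ∀ t ∈ tangentSpace Γ x, dot t (w.2 x) = 0 := by
    refine h.ae_of_charts fun ψ a ρ s K L hc => hc.ae_restrict h.measurableSet ?_
    -- With `w.1 = 0`, integration by parts makes this function orthogonal to all test functions on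
    -- the disc.
    have hzero : ∀ v, ∀ᵐ b, b ∈ ball a (2 * ρ) → dot (fderiv ℝ ψ b v) (w.2 (ψ b)) = 0 := by
      intro v
      refine isOpen_ball.ae_eq_zero_of_integral_contDiff_smul_eq_zero ?_ fun η hη hηc hηs => ?_
      · refine IntegrableOn.locallyIntegrableOn ?_
        refine ((hc.integrable_comp h.measure_lt_top (Lp.memLp w.2)).norm.const_mul
          (3 * (K * ‖v‖))).mono' (IsChart.aestronglyMeasurable_dot_fderiv
            (hc.aestronglyMeasurable_comp (Lp.memLp w.2).1) v) (Eventually.of_forall fun b => ?_)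
        have hK : ‖fderiv ℝ ψ b v‖ ≤ K * ‖v‖ := ((fderiv ℝ ψ b).le_opNorm v).trans
          (mul_le_mul_of_nonneg_right (norm_fderiv_le_of_lipschitz ℝ hc.lipschitz) (norm_nonneg v))
        refine (norm_dot_le _ _).trans ?_
        gcongr
      · rw [← setIntegral_eq_integral_of_forall_compl_eq_zero (s := ball a (2 * ρ)) fun b hb => by
          rw [image_eq_zero_of_notMem_tsupport fun hb' => hb (hηs hb'), zero_smul]]
        rw [hc.integral_dot h hw hη hηc hηs v, hw0, neg_eq_zero]
        refine integral_eq_zero_of_ae ?_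
        filter_upwards [hc.ae_comp (Lp.coeFn_zero ℂ 2 (surfaceMeasure Γ))] with b hb
        rw [hb]
        simp
    -- The null set in `hzero` depends on `v`; two basis directions suffice by linearity, so only
    -- two such sets are discarded.
    have h0 := hzero (EuclideanSpace.single 0 1)
    have h1 := hzero (EuclideanSpace.single 1 1)
    filter_upwards [ae_restrict_of_ae h0, ae_restrict_of_ae h1,
      ae_restrict_of_ae hc.lipschitz.ae_differentiableAt, ae_restrict_mem measurableSet_ball]
      with b hb0 hb1 hd hbm hbs t ht
    have hb := hc.ball_subset hbm
    rw [hc.tangentSpace_eq hb hbs hd] at ht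
    obtain ⟨v, rfl⟩ := ht
    have hv : v = v 0 • EuclideanSpace.single 0 1 + v 1 • EuclideanSpace.single 1 1 := by
      ext i
      fin_cases i <;> simp
    rw [hv]
    simp only [ContinuousLinearMap.coe_coe, map_add, map_smul, dot_add_left, dot_smul_left, hb0 hb,
      hb1 hb, mul_zero, add_zero]
  refine (Lp.eq_zero_iff_ae_eq_zero).2 ?_
  filter_upwards [htan, ae_dot_eq_zero_of_mem_orthogonal hw] with x hx hx'
  refine eq_zero_of_forall_dot fun t => ?_
  rw [← Submodule.starProjection_add_starProjection_orthogonal (K := tangentSpace Γ x) t,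
    dot_add_left, hx _ (Submodule.starProjection_apply_mem _ _),
    hx' _ (Submodule.starProjection_apply_mem _ _), add_zero]

end IsClosedLipschitzSurface

/-! ### Integrals of power kernels for measures of quadratic growth. -/

section Kernel

variable {α : Type*} [MeasurableSpace α]

/-- The Cauchy–Schwarz inequality for the integral of a function over a set. -/
lemma sq_lintegral_le (μ : Measure α) {f : α → ℝ≥0∞} (hf : AEMeasurable f μ) :
    (∫⁻ x, f x ∂μ) ^ 2 ≤ μ univ * ∫⁻ x, f x ^ 2 ∂μ := by
  have h := ENNReal.lintegral_mul_le_Lp_mul_Lq μ Real.HolderConjugate.two_two hf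
    (aemeasurable_const (b := (1 : ℝ≥0∞)))
  simp only [Pi.mul_apply, mul_one, lintegral_const,
    ENNReal.rpow_ofNat] at h
  refine (pow_le_pow_left₀ zero_le h 2).trans (le_of_eq ?_)
  rw [mul_pow, ← ENNReal.rpow_natCast, ← ENNReal.rpow_natCast, ← ENNReal.rpow_mul,
    ← ENNReal.rpow_mul]
  norm_num [mul_comm]

/-- Bound of an integral by a sum over a countable cover on whose members the integrand is
bounded. -/
lemma lintegral_le_tsum {μ : Measure α} {f : α → ℝ≥0∞} {c : ℕ → ℝ≥0∞} {B : ℕ → Set α}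
    (hB : ∀ k, MeasurableSet (B k)) (h : ∀ᵐ x ∂μ, ∃ k, x ∈ B k ∧ f x ≤ c k) :
    ∫⁻ x, f x ∂μ ≤ ∑' k, c k * μ (B k) := by
  calc ∫⁻ x, f x ∂μ ≤ ∫⁻ x, ∑' k, (B k).indicator (fun _ => c k) x ∂μ := by
        refine lintegral_mono_ae ?_
        filter_upwards [h] with x hx
        obtain ⟨k, hk, hfk⟩ := hx
        refine hfk.trans (le_trans ?_ (ENNReal.le_tsum k))
        rw [indicator_of_mem hk]
    _ = ∑' k, c k * μ (B k) := by
        rw [lintegral_tsum fun k => (measurable_const.indicator (hB k)).aemeasurable]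
        simp only [lintegral_indicator_const (hB _)]

variable {X : Type*} [MetricSpace X] [MeasurableSpace X] [OpensMeasurableSpace X]

/-- The kernel `1 / |x - y|` is integrable against measures of quadratic growth. -/
lemma lintegral_inv_edist_ball_le {μ : Measure X} {x : X} {C : ℝ≥0∞} (hC : C ≠ ⊤)
    (hμ : ∀ r : ℝ, 0 < r → μ (ball x r) ≤ C * ENNReal.ofReal r ^ 2) {δ : ℝ} (hδ : 0 < δ) :
    ∫⁻ y in ball x δ, (edist x y)⁻¹ ∂μ ≤ 16 * C * ENNReal.ofReal δ := by
  -- At `y = x` the integrand is `⊤`, which no shell bound dominates, so the point has to be null.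
  have hx : μ {x} = 0 := by
    have h1 : Tendsto (fun n : ℕ => C * ENNReal.ofReal ((1 / 2) ^ n) ^ 2) atTop (𝓝 0) := by
      have h2 : Tendsto (fun n : ℕ => ENNReal.ofReal ((1 / 2 : ℝ) ^ n)) atTop (𝓝 0) := by
        simpa using ENNReal.tendsto_ofReal
          (tendsto_pow_atTop_nhds_zero_of_lt_one (r := (1 / 2 : ℝ)) (by norm_num) (by norm_num))
      have h3 := ENNReal.Tendsto.const_mul (a := C) (ENNReal.Tendsto.pow (n := 2) h2) (.inr hC)
      simpa using h3
    refine le_antisymm (ge_of_tendsto' h1 fun n => ?_) zero_le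
    exact (measure_mono (singleton_subset_iff.2 (mem_ball_self (by positivity)))).trans
      (hμ _ (by positivity))
  have hd : ENNReal.ofReal δ ≠ 0 := by simpa using hδ
  have hd' : ENNReal.ofReal δ ≠ ⊤ := by finiteness
  have hne : ∀ᵐ y ∂μ.restrict (ball x δ), y ≠ x := ae_restrict_of_ae (by
    rw [ae_iff]; simpa using hx)
  -- On the shell `δ / 2 ^ (k + 1) < dist x y ≤ δ / 2 ^ k` the kernel is at most `2 ^ (k + 1) / δ`.
  -- The outer inequality is not strict, so the open ball has twice that radius. The terms decay
  -- like `2⁻¹ ^ k`.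
  refine (lintegral_le_tsum (B := fun k => ball x (2 * δ * (1 / 2) ^ k))
    (c := fun k => (ENNReal.ofReal (δ * (1 / 2) ^ (k + 1)))⁻¹)
    (fun k => measurableSet_ball) ?_).trans ?_
  · filter_upwards [hne, ae_restrict_mem measurableSet_ball] with y hy hyb
    have hpos : 0 < dist x y := dist_pos.2 hy.symm
    obtain ⟨k, hk1, hk2⟩ := exists_nat_pow_near_of_lt_one (x := dist x y / δ) (y := (1 / 2 : ℝ))
      (by positivity) ((div_le_one hδ).2 (by rw [dist_comm]; exact (mem_ball.1 hyb).le))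
      (by norm_num) (by norm_num)
    rw [lt_div_iff₀ hδ] at hk1
    rw [div_le_iff₀ hδ] at hk2
    have hp : (0 : ℝ) < (1 / 2) ^ k * δ := by positivity
    refine ⟨k, ?_, ?_⟩
    · rw [mem_ball, dist_comm]
      linarith
    · rw [ENNReal.inv_le_inv, edist_dist]
      exact ENNReal.ofReal_le_ofReal (by linarith)
  · calc ∑' k, (ENNReal.ofReal (δ * (1 / 2) ^ (k + 1)))⁻¹ *
          (μ.restrict (ball x δ)) (ball x (2 * δ * (1 / 2) ^ k))
        ≤ ∑' k : ℕ, (8 * C * ENNReal.ofReal δ) * 2⁻¹ ^ k := by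
          refine ENNReal.tsum_le_tsum fun k => ?_
          have he : ENNReal.ofReal (δ * (1 / 2) ^ (k + 1)) ≠ 0 := by
            rw [Ne, ENNReal.ofReal_eq_zero, not_le]
            positivity
          have he4 : ENNReal.ofReal (2 * δ * (1 / 2) ^ k) =
              4 * ENNReal.ofReal (δ * (1 / 2) ^ (k + 1)) := by
            rw [← ENNReal.ofReal_ofNat, ← ENNReal.ofReal_mul (by norm_num)]
            congr 1
            ring
          have he2 : ENNReal.ofReal (δ * (1 / 2) ^ (k + 1)) = ENNReal.ofReal δ * 2⁻¹ ^ (k + 1) := by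
            rw [ENNReal.ofReal_mul hδ.le, ENNReal.ofReal_pow (by norm_num), one_div,
              ENNReal.ofReal_inv_of_pos (by norm_num), ENNReal.ofReal_ofNat]
          have h1 : (μ.restrict (ball x δ)) (ball x (2 * δ * (1 / 2) ^ k)) ≤
              C * (4 * ENNReal.ofReal (δ * (1 / 2) ^ (k + 1))) ^ 2 := by
            rw [← he4]
            exact (Measure.restrict_apply_le _ _).trans (hμ _ (by positivity))
          refine (mul_le_mul_right h1 _).trans (le_of_eq ?_)
          calc (ENNReal.ofReal (δ * (1 / 2) ^ (k + 1)))⁻¹ *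
                (C * (4 * ENNReal.ofReal (δ * (1 / 2) ^ (k + 1))) ^ 2)
              = 16 * C * ((ENNReal.ofReal (δ * (1 / 2) ^ (k + 1)))⁻¹ *
                ENNReal.ofReal (δ * (1 / 2) ^ (k + 1))) * ENNReal.ofReal (δ * (1 / 2) ^ (k + 1)) := by
                ring
            _ = 8 * (2 * 2⁻¹) * C * ENNReal.ofReal δ * 2⁻¹ ^ k := by
                rw [ENNReal.inv_mul_cancel he (by finiteness), he2, pow_succ]
                ring
            _ = 8 * C * ENNReal.ofReal δ * 2⁻¹ ^ k := by
                rw [ENNReal.mul_inv_cancel two_ne_zero (by finiteness), mul_one]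
      _ = 16 * C * ENNReal.ofReal δ := by
          rw [ENNReal.tsum_mul_left, ENNReal.tsum_geometric, ENNReal.one_sub_inv_two, inv_inv]
          ring

/-- The integral of `1 / |x - y|³` away from the singularity. -/
lemma lintegral_inv_edist_cube_le {μ : Measure X} {x : X} {C : ℝ≥0∞}
    (hμ : ∀ r : ℝ, 0 < r → μ (ball x r) ≤ C * ENNReal.ofReal r ^ 2) {δ : ℝ} (hδ : 0 < δ) :
    ∫⁻ y in (ball x δ)ᶜ, (edist x y ^ 3)⁻¹ ∂μ ≤ 8 * C * (ENNReal.ofReal δ)⁻¹ := by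
  have hd : ENNReal.ofReal δ ≠ 0 := by simpa using hδ
  have hd' : ENNReal.ofReal δ ≠ ⊤ := by finiteness
  -- Shells `δ * 2 ^ k ≤ dist x y < δ * 2 ^ (k + 1)`: the cube in the kernel beats the quadratic
  -- growth by a factor `2⁻¹ ^ k`.
  refine (lintegral_le_tsum (B := fun k => ball x (δ * 2 ^ (k + 1)))
    (c := fun k => ((ENNReal.ofReal δ * 2 ^ k) ^ 3)⁻¹)
    (fun k => measurableSet_ball) ?_).trans ?_
  · filter_upwards [ae_restrict_mem measurableSet_ball.compl] with y hyb
    rw [mem_compl_iff, mem_ball, not_lt, dist_comm] at hyb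
    obtain ⟨k, hk1, hk2⟩ := exists_nat_pow_near (x := dist x y / δ) (y := (2 : ℝ))
      ((one_le_div hδ).2 hyb) (by norm_num)
    rw [le_div_iff₀ hδ] at hk1
    rw [div_lt_iff₀ hδ] at hk2
    refine ⟨k, ?_, ?_⟩
    · rw [mem_ball, dist_comm]
      linarith
    · have h2 : ENNReal.ofReal δ * 2 ^ k = ENNReal.ofReal (δ * 2 ^ k) := by
        rw [ENNReal.ofReal_mul hδ.le, ENNReal.ofReal_pow zero_le_two, ENNReal.ofReal_ofNat]
      rw [ENNReal.inv_le_inv, edist_dist, h2]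
      gcongr
      linarith
  · calc ∑' k, ((ENNReal.ofReal δ * 2 ^ k) ^ 3)⁻¹ * (μ.restrict (ball x δ)ᶜ) (ball x (δ * 2 ^ (k + 1)))
        ≤ ∑' k : ℕ, (4 * C * (ENNReal.ofReal δ)⁻¹) * 2⁻¹ ^ k := by
          refine ENNReal.tsum_le_tsum fun k => ?_
          have he : ENNReal.ofReal δ * 2 ^ k ≠ 0 := mul_ne_zero hd (by positivity)
          have he' : ENNReal.ofReal δ * 2 ^ k ≠ ⊤ := by finiteness
          have h2 : ENNReal.ofReal (δ * 2 ^ (k + 1)) = 2 * (ENNReal.ofReal δ * 2 ^ k) := by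
            rw [ENNReal.ofReal_mul hδ.le, ENNReal.ofReal_pow zero_le_two, ENNReal.ofReal_ofNat]
            ring
          have h1 : (μ.restrict (ball x δ)ᶜ) (ball x (δ * 2 ^ (k + 1))) ≤
              C * (2 * (ENNReal.ofReal δ * 2 ^ k)) ^ 2 := by
            rw [← h2]
            exact (Measure.restrict_apply_le _ _).trans (hμ _ (by positivity))
          refine (mul_le_mul_right h1 _).trans (le_of_eq ?_)
          generalize hE : ENNReal.ofReal δ * 2 ^ k = e at he he'
          calc (e ^ 3)⁻¹ * (C * (2 * e) ^ 2) = 4 * C * ((e⁻¹ * e) * (e⁻¹ * e)) * e⁻¹ := by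
                rw [ENNReal.inv_pow]
                ring
            _ = 4 * C * (ENNReal.ofReal δ)⁻¹ * 2⁻¹ ^ k := by
                rw [ENNReal.inv_mul_cancel he he', ← hE,
                  ENNReal.mul_inv (.inl hd) (.inl hd'), ENNReal.inv_pow]
                ring
      _ = 8 * C * (ENNReal.ofReal δ)⁻¹ := by
          rw [ENNReal.tsum_mul_left, ENNReal.tsum_geometric, ENNReal.one_sub_inv_two, inv_inv]
          ring

end Kernel

/-! ### The Gagliardo seminorm in the plane. -/

/-- The fundamental theorem of calculus for Lipschitz curves in the complex plane. -/
lemma _root_.LipschitzWith.integral_deriv_eq_sub_complex {γ : ℝ → ℂ} {C : ℝ≥0}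
    (hγ : LipschitzWith C γ) (a b : ℝ) : ∫ t in a..b, deriv γ t = γ b - γ a := by
  have hint : IntervalIntegrable (deriv γ) volume a b := by
    refine (intervalIntegrable_const (c := (C : ℝ))).mono_fun'
      (measurable_deriv γ).aestronglyMeasurable (Eventually.of_forall fun t => ?_)
    exact norm_deriv_le_of_lipschitz hγ
  have key : ∀ T : ℂ →L[ℝ] ℝ, T (∫ t in a..b, deriv γ t) = T (γ b - γ a) := by
    intro T
    have h1 := ((T.lipschitz.comp hγ).lipschitzOnWith
      (s := uIcc a b)).absolutelyContinuousOnInterval.integral_deriv_eq_sub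
    rw [← T.intervalIntegral_comp_comm hint, map_sub]
    refine Eq.trans (intervalIntegral.integral_congr_ae ?_) h1
    filter_upwards [hγ.ae_differentiableAt] with t ht _
    have := (T.hasFDerivAt (x := γ t)).comp_hasDerivAt t ht.hasDerivAt
    exact this.deriv.symm
  exact Complex.ext (key Complex.reCLM) (key Complex.imCLM)

section Flat

variable {v : E2 → ℂ} {C : ℝ≥0}

/-- The increment is the integral of the directional derivative along the segment; Cauchy–Schwarz on
the unit interval squares it. -/
lemma enorm_sub_sq_le_lintegral_lineDeriv (hv : LipschitzWith C v) (b h : E2) :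
    ‖v (b + h) - v b‖ₑ ^ 2 ≤ ∫⁻ t in Ioc (0 : ℝ) 1, ‖lineDeriv ℝ v (b + t • h) h‖ₑ ^ 2 := by
  have hγ : LipschitzWith (C * ‖h‖₊) fun t : ℝ => v (b + t • h) := by
    refine hv.comp (LipschitzWith.of_dist_le_mul fun t t' => ?_)
    rw [dist_add_left, dist_eq_norm, ← sub_smul, norm_smul, mul_comm, dist_eq_norm, coe_nnnorm]
  have hderiv : ∀ t : ℝ, deriv (fun t : ℝ => v (b + t • h)) t = lineDeriv ℝ v (b + t • h) h := by
    intro t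
    have := deriv_comp_const_add (fun t : ℝ => v (b + t • h)) t 0
    rw [add_zero] at this
    rw [lineDeriv, ← this]
    congr 1
    ext t'
    rw [add_smul, add_assoc]
  have h1 := hγ.integral_deriv_eq_sub_complex 0 1
  simp only [one_smul, zero_smul, add_zero, hderiv] at h1
  rw [← h1, intervalIntegral.integral_of_le zero_le_one]
  have hmeas : Measurable fun t : ℝ => ‖lineDeriv ℝ v (b + t • h) h‖ₑ :=
    ((measurable_lineDeriv hv.continuous).comp (by fun_prop)).enorm
  refine (pow_le_pow_left₀ zero_le (enorm_integral_le_lintegral_enorm _) 2).trans ?_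
  refine (sq_lintegral_le _ hmeas.aemeasurable).trans ?_
  simp

/-- Convexity keeps the segment in `D` when both ends are there, which the indicator ensures. After
Fubini, translation invariance removes the shift by `t • h`. -/
lemma lintegral_translate_le (hv : LipschitzWith C v) {D : Set E2} (hD : Convex ℝ D)
    (hDm : MeasurableSet D) (h : E2) :
    ∫⁻ b in D, D.indicator 1 (b + h) * ‖v (b + h) - v b‖ₑ ^ 2 ≤
      ‖h‖ₑ ^ 2 * ∫⁻ b in D, ‖fderiv ℝ v b‖ₑ ^ 2 := by
  have hmeas : Measurable fun b : E2 => ‖lineDeriv ℝ v b h‖ₑ ^ 2 :=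
    (measurable_lineDeriv hv.continuous).enorm.pow_const 2
  calc ∫⁻ b in D, D.indicator 1 (b + h) * ‖v (b + h) - v b‖ₑ ^ 2
      ≤ ∫⁻ b in D, ∫⁻ t in Ioc (0 : ℝ) 1,
          D.indicator (fun b => ‖lineDeriv ℝ v b h‖ₑ ^ 2) (b + t • h) := by
        refine setLIntegral_mono' hDm fun b hb => ?_
        by_cases hbh : b + h ∈ D
        · rw [indicator_of_mem hbh, Pi.one_apply, one_mul]
          refine (enorm_sub_sq_le_lintegral_lineDeriv hv b h).trans (le_of_eq ?_)
          refine setLIntegral_congr_fun measurableSet_Ioc fun t ht => ?_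
          rw [indicator_of_mem]
          exact hD.add_smul_mem hb hbh ⟨ht.1.le, ht.2⟩
        · simp [hbh]
    _ = ∫⁻ t in Ioc (0 : ℝ) 1, ∫⁻ b in D,
          D.indicator (fun b => ‖lineDeriv ℝ v b h‖ₑ ^ 2) (b + t • h) :=
        lintegral_lintegral_swap ((hmeas.indicator hDm).comp (by fun_prop)).aemeasurable
    _ ≤ ∫⁻ t in Ioc (0 : ℝ) 1, ∫⁻ b in D, ‖lineDeriv ℝ v b h‖ₑ ^ 2 := by
        refine lintegral_mono fun t => ?_
        refine (setLIntegral_le_lintegral _ _).trans (le_of_eq ?_)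
        rw [lintegral_add_right_eq_self (D.indicator fun b => ‖lineDeriv ℝ v b h‖ₑ ^ 2) (t • h),
          lintegral_indicator hDm]
    _ = ∫⁻ b in D, ‖lineDeriv ℝ v b h‖ₑ ^ 2 := by simp
    _ ≤ ∫⁻ b in D, ‖h‖ₑ ^ 2 * ‖fderiv ℝ v b‖ₑ ^ 2 := by
        refine lintegral_mono_ae ?_
        filter_upwards [ae_restrict_of_ae hv.ae_differentiableAt] with b hb
        rw [hb.lineDeriv_eq_fderiv, mul_comm, ← mul_pow]
        gcongr
        exact (fderiv ℝ v b).le_opENorm h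
    _ = ‖h‖ₑ ^ 2 * ∫⁻ b in D, ‖fderiv ℝ v b‖ₑ ^ 2 := lintegral_const_mul' _ _ (by finiteness)

/-- The Gagliardo seminorm of order `1/2` over pairs at distance less than `δ` is controlled by
`δ` times the Dirichlet integral. -/
lemma lintegral_flat_le (hv : LipschitzWith C v) {D : Set E2} (hD : Convex ℝ D)
    (hDm : MeasurableSet D) {δ : ℝ} (hδ : 0 < δ) :
    ∫⁻ b in D, ∫⁻ b' in D ∩ ball b δ, (edist b b' ^ 3)⁻¹ * ‖v b - v b'‖ₑ ^ 2 ≤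
      16 * NNReal.pi * ENNReal.ofReal δ * ∫⁻ b in D, ‖fderiv ℝ v b‖ₑ ^ 2 := by
  have hind : Measurable (D.indicator (1 : E2 → ℝ≥0∞)) := measurable_one.indicator hDm
  have hvm := hv.continuous.measurable
  have hm : Measurable fun z : E2 × E2 =>
      D.indicator (1 : E2 → ℝ≥0∞) (z.1 + z.2) * ‖v (z.1 + z.2) - v z.1‖ₑ ^ 2 :=
    (hind.comp (by fun_prop)).mul
      (((hvm.comp (by fun_prop)).sub (hvm.comp (by fun_prop))).enorm.pow_const 2)
  -- Substituting `b' = b + h` allows the integral over `b` to be done first. It gains `‖h‖ ^ 2`, so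
  -- only the integrable kernel `1 / ‖h‖` remains.
  have hinner : ∀ b, ∫⁻ b' in D ∩ ball b δ, (edist b b' ^ 3)⁻¹ * ‖v b - v b'‖ₑ ^ 2 =
      ∫⁻ h in ball 0 δ, (‖h‖ₑ ^ 3)⁻¹ * (D.indicator 1 (b + h) * ‖v (b + h) - v b‖ₑ ^ 2) := by
    intro b
    rw [← lintegral_indicator (hDm.inter measurableSet_ball), ← lintegral_indicator
      measurableSet_ball, ← lintegral_add_left_eq_self _ b]
    refine lintegral_congr fun h => ?_
    by_cases h1 : h ∈ ball 0 δ
    · by_cases h2 : b + h ∈ D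
      · rw [indicator_of_mem h1, indicator_of_mem h2, indicator_of_mem
          (show b + h ∈ D ∩ ball b δ from ⟨h2, by simpa using h1⟩), Pi.one_apply, one_mul,
          edist_eq_enorm_sub, sub_add_cancel_left, enorm_neg, ← enorm_neg (v b - _), neg_sub]
      · rw [indicator_of_mem h1, indicator_of_notMem (fun h3 => h2 h3.1), indicator_of_notMem h2,
          zero_mul, mul_zero]
    · rw [indicator_of_notMem h1, indicator_of_notMem fun h3 => h1 (by simpa using h3.2)]
  simp_rw [hinner]
  rw [lintegral_lintegral_swap (((measurable_snd.enorm.pow_const 3).inv.mul hm).aemeasurable)]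
  have hstep : ∀ h : E2, ∫⁻ b in D, (‖h‖ₑ ^ 3)⁻¹ * (D.indicator 1 (b + h) *
      ‖v (b + h) - v b‖ₑ ^ 2) ≤ (edist 0 h)⁻¹ * ∫⁻ b in D, ‖fderiv ℝ v b‖ₑ ^ 2 := by
    intro h
    have hmh : Measurable fun b => D.indicator 1 (b + h) * ‖v (b + h) - v b‖ₑ ^ 2 :=
      hm.comp (by fun_prop : Measurable fun b : E2 => (b, h))
    rw [lintegral_const_mul _ hmh]
    refine (mul_le_mul_right (lintegral_translate_le hv hD hDm h) _).trans ?_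
    rw [← mul_assoc, edist_zero_left]
    gcongr
    -- At `h = 0` the left side is `⊤ * 0 = 0`.
    rcases eq_or_ne ‖h‖ₑ 0 with h0 | h0
    · simp [h0]
    · have ht : ‖h‖ₑ ≠ ⊤ := enorm_ne_top
      rw [ENNReal.inv_pow]
      calc (‖h‖ₑ)⁻¹ ^ 3 * ‖h‖ₑ ^ 2 = ((‖h‖ₑ)⁻¹ * ‖h‖ₑ) * ((‖h‖ₑ)⁻¹ * ‖h‖ₑ) * (‖h‖ₑ)⁻¹ := by ring
        _ = (‖h‖ₑ)⁻¹ := by rw [ENNReal.inv_mul_cancel h0 ht, one_mul, one_mul]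
        _ ≤ _ := le_rfl
  refine (lintegral_mono fun h => hstep h).trans ?_
  have hme : Measurable fun h : E2 => (edist 0 h)⁻¹ := by
    simp only [edist_zero_left]
    exact measurable_enorm.inv
  rw [lintegral_mul_const _ hme]
  gcongr
  refine lintegral_inv_edist_ball_le (by finiteness) (fun r hr => ?_) hδ
  rw [EuclideanSpace.volume_ball_fin_two, mul_comm, ← NNReal.coe_real_pi,
    ENNReal.ofReal_coe_nnreal]

end Flat

/-! ### The Gagliardo seminorm on the surface; inclusion of H¹ in H^{1/2}. -/

lemma enorm_halfQuotient_sq (u : E3 → ℂ) (z : E3 × E3) :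
    ‖halfQuotient u z‖ₑ ^ 2 = (edist z.1 z.2 ^ 3)⁻¹ * ‖u z.1 - u z.2‖ₑ ^ 2 := by
  rcases eq_or_ne z.1 z.2 with h | h
  -- On the diagonal both sides vanish: the difference of values is zero, and `⊤ * 0 = 0`.
  · simp [halfQuotient, h]
  · have hd : 0 < dist z.1 z.2 := dist_pos.2 h
    rw [halfQuotient, enorm_smul, mul_pow]
    congr 1
    rw [Real.enorm_eq_ofReal (by positivity), edist_dist, ← ENNReal.ofReal_pow (by positivity),
      ← ENNReal.ofReal_pow dist_nonneg, ← ENNReal.ofReal_inv_of_pos (by positivity), inv_pow,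
      ← Real.rpow_mul_natCast dist_nonneg]
    norm_num

lemma measurable_enorm_halfQuotient_sq {u : E3 → ℂ} (hu : Measurable u) :
    Measurable fun z => ‖halfQuotient u z‖ₑ ^ 2 := by
  simp_rw [enorm_halfQuotient_sq]
  exact (measurable_edist.pow_const 3).inv.mul
    (((hu.comp measurable_fst).sub (hu.comp measurable_snd)).enorm.pow_const 2)

lemma inv_cube_le {e e' M : ℝ≥0∞} (h0 : M ≠ 0) (ht : M ≠ ⊤) (h : e ≤ M * e') :
    (e' ^ 3)⁻¹ ≤ M ^ 3 * (e ^ 3)⁻¹ := by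
  calc (e' ^ 3)⁻¹ = M ^ 3 * ((M * e') ^ 3)⁻¹ := by
        rw [mul_pow, ENNReal.mul_inv (.inl (pow_ne_zero 3 h0)) (.inl (by finiteness)), ← mul_assoc,
          ENNReal.mul_inv_cancel (pow_ne_zero 3 h0) (by finiteness), one_mul]
    _ ≤ M ^ 3 * (e ^ 3)⁻¹ := by gcongr

namespace IsChart

variable {Γ : Set E3} {ψ : E2 → E3} {a : E2} {ρ s : ℝ} {K L : ℝ≥0}

lemma lintegral_ball_le (hc : IsChart Γ ψ a ρ s K L) {f : E3 → ℝ≥0∞} (hf : Measurable f) :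
    ∫⁻ x in ball (ψ a) (2 * s), f x ∂surfaceMeasure Γ ≤
      (K : ℝ≥0∞) ^ 2 * ∫⁻ b in ball a ρ, f (ψ b) := by
  refine (lintegral_mono' hc.restrict_le le_rfl).trans ?_
  rw [lintegral_smul_measure, lintegral_map hf hc.lipschitz.continuous.measurable]
  rfl

lemma enorm_fderiv_comp_le (hc : IsChart Γ ψ a ρ s K L) {φ : E3 → ℂ} (hφ : Differentiable ℝ φ)
    {b : E2} (hb : b ∈ ball a (2 * ρ)) (hd : DifferentiableAt ℝ ψ b) :
    ‖fderiv ℝ (φ ∘ ψ) b‖ₑ ≤ 3 * K * ‖tangentialGradient Γ φ (ψ b)‖ₑ := by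
  have h1 : ‖fderiv ℝ (φ ∘ ψ) b‖ ≤ 3 * K * ‖tangentialGradient Γ φ (ψ b)‖ := by
    refine ContinuousLinearMap.opNorm_le_bound _ (by positivity) fun v => ?_
    have hK : ‖fderiv ℝ ψ b v‖ ≤ K * ‖v‖ := ((fderiv ℝ ψ b).le_opNorm v).trans
      (mul_le_mul_of_nonneg_right (norm_fderiv_le_of_lipschitz ℝ hc.lipschitz) (norm_nonneg v))
    rw [fderiv_comp b (hφ _) hd, ContinuousLinearMap.comp_apply,
      ← dot_tangentialGradient_of_mem _ (hc.fderiv_mem_tangentSpace hb hd v)]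
    calc _ ≤ 3 * ‖fderiv ℝ ψ b v‖ * ‖tangentialGradient Γ φ (ψ b)‖ := norm_dot_le _ _
      _ ≤ 3 * (K * ‖v‖) * ‖tangentialGradient Γ φ (ψ b)‖ := by gcongr
      _ = _ := by ring
  rw [← ofReal_norm, ← ofReal_norm]
  refine (ENNReal.ofReal_le_ofReal h1).trans (le_of_eq ?_)
  rw [ENNReal.ofReal_mul (by positivity), ENNReal.ofReal_mul (by positivity),
    ENNReal.ofReal_ofNat, ENNReal.ofReal_coe_nnreal]

/-- Both variables are pulled back to the disc: the measures cost `K ^ 4`, the kernel `(L + 1) ^ 3`,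
and the distance bound becomes `(L + 1) * δ`. The flat estimate applies there, and returning the
gradient to Γ costs `9 * K ^ 2 * L ^ 2`. The condition `δ ≤ s` keeps `ball x δ` in the region
covered by the chart. -/
lemma lintegral_near_le (hc : IsChart Γ ψ a ρ s K L) {χ : E3 → ℂ} {C : ℝ≥0}
    (hχ : LipschitzWith C χ) (hχd : Differentiable ℝ χ)
    (hm : AEMeasurable (fun x => ‖tangentialGradient Γ χ x‖ₑ) (surfaceMeasure Γ))
    {δ : ℝ} (hδ : 0 < δ) (hδs : δ ≤ s) :
    ∫⁻ x in ball (ψ a) s, ∫⁻ y in ball x δ, ‖halfQuotient χ (x, y)‖ₑ ^ 2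
        ∂surfaceMeasure Γ ∂surfaceMeasure Γ ≤
      ((K : ℝ≥0∞) ^ 4 * (L + 1) ^ 3 * (16 * NNReal.pi * (L + 1)) * (9 * K ^ 2 * L ^ 2)) *
        ENNReal.ofReal δ * ∫⁻ x, ‖tangentialGradient Γ χ x‖ₑ ^ 2 ∂surfaceMeasure Γ := by
  have hs := hc.scale_pos
  set H : E3 × E3 → ℝ≥0∞ := {z : E3 × E3 | dist z.2 z.1 < δ}.indicator
    fun z => ‖halfQuotient χ z‖ₑ ^ 2 with hH
  have hset : MeasurableSet {z : E3 × E3 | dist z.2 z.1 < δ} :=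
    (isOpen_lt (by fun_prop) continuous_const).measurableSet
  have hHm : Measurable H :=
    (measurable_enorm_halfQuotient_sq hχ.continuous.measurable).indicator hset
  have hψ := hc.lipschitz.continuous.measurable
  have hinner : ∀ x ∈ ball (ψ a) s, ∫⁻ y in ball x δ, ‖halfQuotient χ (x, y)‖ₑ ^ 2
      ∂surfaceMeasure Γ ≤ (K : ℝ≥0∞) ^ 2 * ∫⁻ b' in ball a ρ, H (x, ψ b') := by
    intro x hx
    refine le_trans ?_ (hc.lintegral_ball_le (hHm.comp measurable_prodMk_left))
    have hsub : ball x δ ⊆ ball (ψ a) (2 * s) :=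
      ball_subset_ball' (by linarith [mem_ball.1 hx])
    rw [← lintegral_indicator measurableSet_ball]
    rw [← lintegral_indicator measurableSet_ball]
    refine lintegral_mono fun y => ?_
    by_cases hy : y ∈ ball x δ
    · rw [indicator_of_mem hy, indicator_of_mem (hsub hy)]
      simp only [Function.comp_apply, hH]
      rw [indicator_of_mem (show (x, y) ∈ {z : E3 × E3 | dist z.2 z.1 < δ} from hy)]
    · rw [indicator_of_notMem hy]
      exact zero_le
  have hL1 : (0 : ℝ) < L + 1 := by positivity
  have hpt : ∀ b ∈ ball a ρ, ∀ b' ∈ ball a ρ, H (ψ b, ψ b') ≤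
      (ball b ((L + 1) * δ)).indicator (fun b' => ((L : ℝ≥0∞) + 1) ^ 3 *
        ((edist b b' ^ 3)⁻¹ * ‖(χ ∘ ψ) b - (χ ∘ ψ) b'‖ₑ ^ 2)) b' := by
    intro b hb b' hb'
    by_cases h1 : dist (ψ b') (ψ b) < δ
    · have h2 := hc.dist_le b' (hc.ball_subset hb') b (hc.ball_subset hb)
      have h3 : b' ∈ ball b ((L + 1) * δ) := by
        rw [mem_ball]
        nlinarith [L.coe_nonneg, dist_nonneg (x := ψ b') (y := ψ b)]
      rw [hH, indicator_of_mem (show (ψ b, ψ b') ∈ {z : E3 × E3 | dist z.2 z.1 < δ} from h1),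
        indicator_of_mem h3, enorm_halfQuotient_sq, ← mul_assoc]
      refine mul_le_mul_left (inv_cube_le (M := (L : ℝ≥0∞) + 1) (by positivity)
        (by finiteness) ?_) _
      have h4 : dist b b' ≤ (L + 1) * dist (ψ b) (ψ b') := by
        rw [dist_comm b, dist_comm (ψ b)]
        nlinarith [dist_nonneg (x := ψ b') (y := ψ b)]
      rw [edist_dist, edist_dist]
      refine (ENNReal.ofReal_le_ofReal h4).trans (le_of_eq ?_)
      rw [ENNReal.ofReal_mul hL1.le, ENNReal.ofReal_add L.coe_nonneg zero_le_one,
        ENNReal.ofReal_coe_nnreal, ENNReal.ofReal_one]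
    · rw [hH, indicator_of_notMem (show (ψ b, ψ b') ∉ {z : E3 × E3 | dist z.2 z.1 < δ} from h1)]
      exact zero_le
  have hgrad : ∫⁻ b in ball a ρ, ‖fderiv ℝ (χ ∘ ψ) b‖ₑ ^ 2 ≤
      9 * K ^ 2 * L ^ 2 * ∫⁻ x, ‖tangentialGradient Γ χ x‖ₑ ^ 2 ∂surfaceMeasure Γ := by
    calc ∫⁻ b in ball a ρ, ‖fderiv ℝ (χ ∘ ψ) b‖ₑ ^ 2
        ≤ ∫⁻ b in ball a (2 * ρ), ‖fderiv ℝ (χ ∘ ψ) b‖ₑ ^ 2 :=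
          lintegral_mono_set hc.ball_subset
      _ ≤ ∫⁻ b in ball a (2 * ρ), 9 * K ^ 2 * ‖tangentialGradient Γ χ (ψ b)‖ₑ ^ 2 := by
          refine lintegral_mono_ae ?_
          filter_upwards [ae_restrict_of_ae hc.lipschitz.ae_differentiableAt,
            ae_restrict_mem measurableSet_ball] with b hd hb
          refine (pow_le_pow_left₀ zero_le (hc.enorm_fderiv_comp_le hχd hb hd) 2).trans
            (le_of_eq ?_)
          ring
      _ = 9 * K ^ 2 * ∫⁻ b in ball a (2 * ρ), ‖tangentialGradient Γ χ (ψ b)‖ₑ ^ 2 :=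
          lintegral_const_mul' _ _ (by finiteness)
      _ ≤ 9 * K ^ 2 * (L ^ 2 * ∫⁻ x, ‖tangentialGradient Γ χ x‖ₑ ^ 2 ∂surfaceMeasure Γ) := by
          gcongr
          exact hc.lintegral_comp_le (hm.pow_const 2)
      _ = _ := by ring
  have hflat := lintegral_flat_le (hχ.comp hc.lipschitz) (convex_ball a ρ) measurableSet_ball
    (δ := (L + 1) * δ) (by positivity)
  calc ∫⁻ x in ball (ψ a) s, ∫⁻ y in ball x δ, ‖halfQuotient χ (x, y)‖ₑ ^ 2
        ∂surfaceMeasure Γ ∂surfaceMeasure Γ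
      ≤ ∫⁻ x in ball (ψ a) s, ((K : ℝ≥0∞) ^ 2 * ∫⁻ b' in ball a ρ, H (x, ψ b'))
        ∂surfaceMeasure Γ := setLIntegral_mono' measurableSet_ball hinner
    _ = (K : ℝ≥0∞) ^ 2 * ∫⁻ x in ball (ψ a) s, (∫⁻ b' in ball a ρ, H (x, ψ b'))
        ∂surfaceMeasure Γ := lintegral_const_mul' _ _ (by finiteness)
    _ ≤ (K : ℝ≥0∞) ^ 2 * ((K : ℝ≥0∞) ^ 2 *
        ∫⁻ b in ball a ρ, ∫⁻ b' in ball a ρ, H (ψ b, ψ b')) := by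
        gcongr
        refine le_trans (lintegral_mono_set (ball_subset_ball (by linarith)))
          (hc.lintegral_ball_le (f := fun x => ∫⁻ b' in ball a ρ, H (x, ψ b')) ?_)
        exact (hHm.comp (measurable_fst.prodMk (hψ.comp measurable_snd))).lintegral_prod_right'
    _ ≤ (K : ℝ≥0∞) ^ 2 * ((K : ℝ≥0∞) ^ 2 *
        (((L : ℝ≥0∞) + 1) ^ 3 * (16 * NNReal.pi * ENNReal.ofReal ((L + 1) * δ) *
          (9 * K ^ 2 * L ^ 2 * ∫⁻ x, ‖tangentialGradient Γ χ x‖ₑ ^ 2 ∂surfaceMeasure Γ)))) := by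
        gcongr
        refine le_trans ?_ (mul_le_mul_right (hflat.trans (mul_le_mul_right hgrad _)) _)
        rw [← lintegral_const_mul' _ _ (by finiteness)]
        refine setLIntegral_mono' measurableSet_ball fun b hb => ?_
        rw [← lintegral_const_mul' _ _ (by finiteness), inter_comm,
          ← Measure.restrict_restrict measurableSet_ball]
        exact (setLIntegral_mono' measurableSet_ball (hpt b hb)).trans
          (lintegral_indicator measurableSet_ball _).le
    _ = _ := by
        have : ENNReal.ofReal ((L + 1) * δ) = (L + 1) * ENNReal.ofReal δ := by
          rw [ENNReal.ofReal_mul hL1.le, ENNReal.ofReal_add L.coe_nonneg zero_le_one,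
            ENNReal.ofReal_coe_nnreal, ENNReal.ofReal_one]
        rw [this]
        ring

end IsChart

namespace IsClosedLipschitzSurface

variable {Γ : Set E3}

/-- The part of the Gagliardo seminorm of order `1/2` that comes from pairs of points at distance
less than `δ` is controlled by the surface gradient; smooth functions. -/
lemma exists_near_le_smooth (h : IsClosedLipschitzSurface Γ) :
    ∃ C : ℝ≥0∞, ∃ δ₀ : ℝ, C ≠ ⊤ ∧ 0 < δ₀ ∧ ∀ φ : E3 → ℂ, ContDiff ℝ ∞ φ → ∀ δ : ℝ, 0 < δ → δ ≤ δ₀ →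
      ∫⁻ x, ∫⁻ y in ball x δ, ‖halfQuotient φ (x, y)‖ₑ ^ 2 ∂surfaceMeasure Γ ∂surfaceMeasure Γ ≤
        C * ENNReal.ofReal δ * ∫⁻ x, ‖tangentialGradient Γ φ x‖ₑ ^ 2 ∂surfaceMeasure Γ := by
  have := h.induction_on_charts (p := fun S => ∃ C : ℝ≥0∞, ∃ δ₀ : ℝ, C ≠ ⊤ ∧ 0 < δ₀ ∧
      ∀ φ : E3 → ℂ, ContDiff ℝ ∞ φ → ∀ δ : ℝ, 0 < δ → δ ≤ δ₀ →
      ∫⁻ x in S, ∫⁻ y in ball x δ, ‖halfQuotient φ (x, y)‖ₑ ^ 2 ∂surfaceMeasure Γ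
        ∂surfaceMeasure Γ ≤
        C * ENNReal.ofReal δ * ∫⁻ x, ‖tangentialGradient Γ φ x‖ₑ ^ 2 ∂surfaceMeasure Γ)
    ⟨0, 1, by simp⟩ ?_ ?_ ?_
  · simpa only [h.restrict_self] using this
  · rintro S T hST ⟨C, δ₀, hC, hδ, hh⟩
    exact ⟨C, δ₀, hC, hδ, fun φ hφ δ h0 h1 => (lintegral_mono_set hST).trans (hh φ hφ δ h0 h1)⟩
  · rintro S T ⟨C, δ₀, hC, hδ, hh⟩ ⟨C', δ₀', hC', hδ', hh'⟩
    refine ⟨C + C', min δ₀ δ₀', by finiteness, lt_min hδ hδ', fun φ hφ δ h0 h1 => ?_⟩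
    refine (lintegral_union_le _ _ _).trans ?_
    rw [add_mul, add_mul]
    exact add_le_add (hh φ hφ δ h0 (h1.trans (min_le_left _ _)))
      (hh' φ hφ δ h0 (h1.trans (min_le_right _ _)))
  · intro ψ a ρ s K L hc
    refine ⟨(K : ℝ≥0∞) ^ 4 * (L + 1) ^ 3 * (16 * NNReal.pi * (L + 1)) * (9 * K ^ 2 * L ^ 2), s,
      by finiteness, hc.scale_pos, fun φ hφ δ h0 h1 => ?_⟩
    obtain ⟨χ, hχ, ⟨C, hC⟩, hχ1, hχ2⟩ := exists_lipschitz_eqOn h.isCompact.isBounded hφ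
    have key := hc.lintegral_near_le hC (hχ.differentiable (by simp))
      (h.aestronglyMeasurable_tangentialGradient hχ).enorm h0 h1
    have e1 : ∫⁻ x, ‖tangentialGradient Γ χ x‖ₑ ^ 2 ∂surfaceMeasure Γ =
        ∫⁻ x, ‖tangentialGradient Γ φ x‖ₑ ^ 2 ∂surfaceMeasure Γ :=
      lintegral_congr_ae (h.ae_mem.mono fun x hx => by simp only [hχ2 hx])
    have e2 : ∫⁻ x in ball (ψ a) s, ∫⁻ y in ball x δ, ‖halfQuotient χ (x, y)‖ₑ ^ 2
          ∂surfaceMeasure Γ ∂surfaceMeasure Γ =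
        ∫⁻ x in ball (ψ a) s, ∫⁻ y in ball x δ, ‖halfQuotient φ (x, y)‖ₑ ^ 2
          ∂surfaceMeasure Γ ∂surfaceMeasure Γ := by
      refine lintegral_congr_ae ((ae_restrict_of_ae h.ae_mem).mono fun x hx => ?_)
      refine lintegral_congr_ae ((ae_restrict_of_ae h.ae_mem).mono fun y hy => ?_)
      simp only [halfQuotient, hχ1 hx, hχ1 hy]
    rw [e1, e2] at key
    exact key

end IsClosedLipschitzSurface

section

variable {α F : Type*} [MeasurableSpace α] [NormedAddCommGroup F] {μ : Measure α}

lemma eLpNorm_two_sq (f : α → F) (μ : Measure α) :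
    eLpNorm f 2 μ ^ 2 = ∫⁻ x, ‖f x‖ₑ ^ 2 ∂μ := by
  have := eLpNorm_nnreal_pow_eq_lintegral (μ := μ) (f := f) (p := 2) (by norm_num)
  simpa using this

lemma lintegral_enorm_sq_Lp (f : Lp F 2 μ) : ∫⁻ x, ‖f x‖ₑ ^ 2 ∂μ = ‖f‖ₑ ^ 2 := by
  rw [Lp.enorm_def, eLpNorm_two_sq]

end

lemma _root_.ENNReal.add_sq_le_two_mul (a b : ℝ≥0∞) : (a + b) ^ 2 ≤ 2 * (a ^ 2 + b ^ 2) := by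
  rcases eq_or_ne a ⊤ with rfl | ha
  · simp
  rcases eq_or_ne b ⊤ with rfl | hb
  · simp
  lift a to ℝ≥0 using ha
  lift b to ℝ≥0 using hb
  exact_mod_cast add_sq_le (a := a) (b := b)

lemma measurable_halfQuotient {u : E3 → ℂ} (hu : Measurable u) : Measurable (halfQuotient u) := by
  unfold halfQuotient
  exact (measurable_dist.pow_const _).inv.smul
    ((hu.comp measurable_fst).sub (hu.comp measurable_snd))

lemma measurableSet_near (δ : ℝ) : MeasurableSet {z : E3 × E3 | dist z.2 z.1 < δ} :=
  (isOpen_lt (by fun_prop) continuous_const).measurableSet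

lemma lintegral_near_eq {Γ : Set E3} [IsFiniteMeasure (surfaceMeasure Γ)] (δ : ℝ)
    {f : E3 × E3 → ℝ≥0∞} (hf : Measurable f) :
    ∫⁻ z in {z : E3 × E3 | dist z.2 z.1 < δ}, f z ∂(surfaceMeasure Γ).prod (surfaceMeasure Γ) =
      ∫⁻ x, ∫⁻ y in ball x δ, f (x, y) ∂surfaceMeasure Γ ∂surfaceMeasure Γ := by
  rw [← lintegral_indicator (measurableSet_near δ),
    lintegral_prod _ (hf.indicator (measurableSet_near δ)).aemeasurable]
  refine lintegral_congr fun x => ?_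
  rw [← lintegral_indicator measurableSet_ball]
  rfl

namespace IsClosedLipschitzSurface

variable {Γ : Set E3}

/-- Fatou's lemma along an almost everywhere convergent subsequence of smooth approximants; the
right sides converge because the gradients do so in L². -/
lemma exists_near_le (h : IsClosedLipschitzSurface Γ) :
    ∃ C : ℝ≥0∞, ∃ δ₀ : ℝ, C ≠ ⊤ ∧ 0 < δ₀ ∧ ∀ w ∈ (smoothGradientGraph Γ).topologicalClosure,
      ∀ δ : ℝ, 0 < δ → δ ≤ δ₀ →
      ∫⁻ z in {z : E3 × E3 | dist z.2 z.1 < δ}, ‖halfQuotient w.1 z‖ₑ ^ 2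
        ∂(surfaceMeasure Γ).prod (surfaceMeasure Γ) ≤ C * ENNReal.ofReal δ * ‖w.2‖ₑ ^ 2 := by
  have hfin := h.isFiniteMeasure
  obtain ⟨C, δ₀, hC, hδ₀, hh⟩ := h.exists_near_le_smooth
  refine ⟨C, δ₀, hC, hδ₀, fun w hw δ h0 h1 => ?_⟩
  obtain ⟨u, hu, hlim⟩ := mem_closure_iff_seq_limit.1 hw
  have hl1 : Tendsto (fun n => (u n).1) atTop (𝓝 w.1) := (continuous_fst.tendsto _).comp hlim
  have hl2 : Tendsto (fun n => (u n).2) atTop (𝓝 w.2) := (continuous_snd.tendsto _).comp hlim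
  obtain ⟨ns, hmono, hns⟩ := (tendstoInMeasure_of_tendsto_Lp hl1).exists_seq_tendsto_ae
  choose φ hφ hφ1 hφ2 using hu
  have hae : ∀ᵐ x ∂surfaceMeasure Γ, Tendsto (fun n => φ (ns n) x) atTop (𝓝 (w.1 x)) := by
    filter_upwards [hns, ae_all_iff.2 fun n => hφ1 n] with x hx hφx
    exact hx.congr fun n => hφx _
  have hprod : ∀ᵐ z ∂(surfaceMeasure Γ).prod (surfaceMeasure Γ),
      Tendsto (fun n => ‖halfQuotient (φ (ns n)) z‖ₑ ^ 2) atTop (𝓝 (‖halfQuotient w.1 z‖ₑ ^ 2)) := by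
    filter_upwards [Measure.quasiMeasurePreserving_fst.ae hae,
      Measure.quasiMeasurePreserving_snd.ae hae] with z hz1 hz2
    exact ENNReal.Tendsto.pow ((hz1.sub hz2).const_smul _).enorm
  calc ∫⁻ z in {z : E3 × E3 | dist z.2 z.1 < δ}, ‖halfQuotient w.1 z‖ₑ ^ 2
        ∂(surfaceMeasure Γ).prod (surfaceMeasure Γ)
      = ∫⁻ z in {z : E3 × E3 | dist z.2 z.1 < δ},
          liminf (fun n => ‖halfQuotient (φ (ns n)) z‖ₑ ^ 2) atTop
        ∂(surfaceMeasure Γ).prod (surfaceMeasure Γ) :=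
        lintegral_congr_ae ((ae_restrict_of_ae hprod).mono fun z hz => hz.liminf_eq.symm)
    _ ≤ liminf (fun n => ∫⁻ z in {z : E3 × E3 | dist z.2 z.1 < δ},
          ‖halfQuotient (φ (ns n)) z‖ₑ ^ 2 ∂(surfaceMeasure Γ).prod (surfaceMeasure Γ)) atTop :=
        lintegral_liminf_le fun n =>
          measurable_enorm_halfQuotient_sq (hφ _).continuous.measurable
    _ ≤ liminf (fun n => C * ENNReal.ofReal δ * ‖(u (ns n)).2‖ₑ ^ 2) atTop := by
        refine liminf_le_liminf (Eventually.of_forall fun n => ?_)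
        rw [lintegral_near_eq δ (measurable_enorm_halfQuotient_sq (hφ _).continuous.measurable),
          ← lintegral_enorm_sq_Lp]
        refine (hh _ (hφ _) δ h0 h1).trans (le_of_eq ?_)
        congr 1
        exact lintegral_congr_ae ((hφ2 (ns n)).mono fun x hx => by simp only [hx])
    _ = C * ENNReal.ofReal δ * ‖w.2‖ₑ ^ 2 := by
        refine Tendsto.liminf_eq ?_
        exact ENNReal.Tendsto.const_mul (ENNReal.Tendsto.pow
          (hl2.comp hmono.tendsto_atTop).enorm) (.inr (by finiteness))

/-- Off the diagonal strip the kernel is at most `δ⁻³`, and |a - b|² ≤ 2(|a|² + |b|²); the two terms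
have equal integrals. -/
lemma lintegral_far_le (h : IsClosedLipschitzSurface Γ) (u : L2 Γ) {δ : ℝ} :
      ∫⁻ z in {z : E3 × E3 | dist z.2 z.1 < δ}ᶜ, ‖halfQuotient u z‖ₑ ^ 2
        ∂(surfaceMeasure Γ).prod (surfaceMeasure Γ) ≤
      4 * (ENNReal.ofReal δ ^ 3)⁻¹ * surfaceMeasure Γ univ * ‖u‖ₑ ^ 2 := by
  have hfin := h.isFiniteMeasure
  have hum : Measurable fun x => ‖u x‖ₑ ^ 2 :=
    ((Lp.stronglyMeasurable u).measurable).enorm.pow_const 2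
  calc ∫⁻ z in {z : E3 × E3 | dist z.2 z.1 < δ}ᶜ, ‖halfQuotient u z‖ₑ ^ 2
        ∂(surfaceMeasure Γ).prod (surfaceMeasure Γ)
      ≤ ∫⁻ z, 2 * (ENNReal.ofReal δ ^ 3)⁻¹ * (‖u z.1‖ₑ ^ 2 + ‖u z.2‖ₑ ^ 2)
        ∂(surfaceMeasure Γ).prod (surfaceMeasure Γ) := by
        refine le_trans ?_ (setLIntegral_le_lintegral {z : E3 × E3 | dist z.2 z.1 < δ}ᶜ _)
        refine setLIntegral_mono' (measurableSet_near δ).compl fun z hz => ?_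
        rw [enorm_halfQuotient_sq, mul_comm 2, mul_assoc]
        gcongr
        · rw [edist_comm, edist_dist]
          exact ENNReal.ofReal_le_ofReal (not_lt.1 hz)
        · exact (pow_le_pow_left₀ zero_le (enorm_sub_le) 2).trans (ENNReal.add_sq_le_two_mul _ _)
    _ = _ := by
        have hm1 : Measurable fun z : E3 × E3 => ‖u z.1‖ₑ ^ 2 := hum.comp measurable_fst
        have hm2 : Measurable fun z : E3 × E3 => ‖u z.2‖ₑ ^ 2 := hum.comp measurable_snd
        have hm3 : Measurable fun z : E3 × E3 => ‖u z.1‖ₑ ^ 2 + ‖u z.2‖ₑ ^ 2 := hm1.add hm2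
        rw [lintegral_const_mul _ hm3, lintegral_add_left hm1,
          lintegral_prod _ hm1.aemeasurable, lintegral_prod _ hm2.aemeasurable]
        simp only [lintegral_const, lintegral_enorm_sq_Lp]
        rw [lintegral_mul_const _ hum, lintegral_enorm_sq_Lp]
        ring

/-- An interpolation inequality for the Gagliardo seminorm of order `1/2`. -/
lemma exists_lintegral_halfQuotient_le (h : IsClosedLipschitzSurface Γ) :
    ∃ C : ℝ≥0∞, ∃ δ₀ : ℝ, C ≠ ⊤ ∧ 0 < δ₀ ∧ ∀ w ∈ (smoothGradientGraph Γ).topologicalClosure,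
      ∀ δ : ℝ, 0 < δ → δ ≤ δ₀ →
      ∫⁻ z, ‖halfQuotient w.1 z‖ₑ ^ 2 ∂(surfaceMeasure Γ).prod (surfaceMeasure Γ) ≤
        C * ENNReal.ofReal δ * ‖w.2‖ₑ ^ 2 +
          4 * (ENNReal.ofReal δ ^ 3)⁻¹ * surfaceMeasure Γ univ * ‖w.1‖ₑ ^ 2 := by
  obtain ⟨C, δ₀, hC, hδ₀, hh⟩ := h.exists_near_le
  refine ⟨C, δ₀, hC, hδ₀, fun w hw δ h0 h1 => ?_⟩
  rw [← lintegral_add_compl _ (measurableSet_near δ)]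
  exact add_le_add (hh w hw δ h0 h1) (h.lintegral_far_le _)

lemma memLp_halfQuotient_iff (h : IsClosedLipschitzSurface Γ) (u : L2 Γ) :
    MemLp (halfQuotient u) 2 ((surfaceMeasure Γ).prod (surfaceMeasure Γ)) ↔
      ∫⁻ z, ‖halfQuotient u z‖ₑ ^ 2 ∂(surfaceMeasure Γ).prod (surfaceMeasure Γ) < ⊤ := by
  have hfin := h.isFiniteMeasure
  rw [MemLp, and_iff_right
    (measurable_halfQuotient (Lp.stronglyMeasurable u).measurable).aestronglyMeasurable,
    ← eLpNorm_two_sq, ENNReal.pow_lt_top_iff]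
  simp

lemma mem_H1_iff {u : L2 Γ} :
    u ∈ H1 Γ ↔ ∃ g, (u, g) ∈ (smoothGradientGraph Γ).topologicalClosure := by
  simp [H1, surfaceGradient, Submodule.toLinearPMap_domain]

/-- Closability enters here: only because of it is the closure of the graph again the graph of an
operator. -/
lemma mem_graph (h : IsClosedLipschitzSurface Γ) (u : H1 Γ) :
    ((u : L2 Γ), surfaceGradient Γ u) ∈ (smoothGradientGraph Γ).topologicalClosure :=
  Submodule.mem_graph_toLinearPMap (fun _ hw h0 => h.snd_eq_zero_of_fst_eq_zero hw h0) u

lemma surfaceGradient_eq (h : IsClosedLipschitzSurface Γ) {u : H1 Γ} {g : L2Vec Γ}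
    (hg : ((u : L2 Γ), g) ∈ (smoothGradientGraph Γ).topologicalClosure) :
    surfaceGradient Γ u = g := by
  have := h.snd_eq_zero_of_fst_eq_zero (sub_mem (h.mem_graph u) hg) (sub_self _)
  exact sub_eq_zero.1 this

theorem H1_le_halfSubspace (h : IsClosedLipschitzSurface Γ) : H1 Γ ≤ halfSubspace Γ := by
  intro u hu
  obtain ⟨g, hg⟩ := mem_H1_iff.1 hu
  obtain ⟨C, δ₀, hC, hδ₀, hh⟩ := h.exists_lintegral_halfQuotient_le
  refine (h.memLp_halfQuotient_iff u).2 ((hh _ hg δ₀ hδ₀ le_rfl).trans_lt ?_)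
  have := h.measure_lt_top
  have h2 : (ENNReal.ofReal δ₀ ^ 3)⁻¹ ≠ ⊤ := by
    simpa using hδ₀
  have h3 := this.ne
  finiteness

end IsClosedLipschitzSurface

/-! ### The norm and completeness of H^{1/2}. -/

namespace HHalf

variable {Γ : Set E3}

lemma norm_embed (u : HHalf Γ) : ‖embed u‖ = ‖u‖ := rfl

lemma isometry_embed : Isometry (embed (Γ := Γ)) :=
  AddMonoidHomClass.isometry_of_norm _ norm_embed

lemma enorm_sq (u : HHalf Γ) : ‖u‖ₑ ^ 2 = ‖toL2 u‖ₑ ^ 2 +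
    ∫⁻ z, ‖halfQuotient (toL2 u) z‖ₑ ^ 2 ∂(surfaceMeasure Γ).prod (surfaceMeasure Γ) := by
  have h1 : ‖u‖ ^ 2 = ‖toL2 u‖ ^ 2 +
      ‖(memLp_halfQuotient u).toLp (halfQuotient (toL2 u))‖ ^ 2 := by
    rw [← norm_embed, WithLp.prod_norm_sq_eq_of_L2]
    rfl
  have h2 : ∫⁻ z, ‖halfQuotient (toL2 u) z‖ₑ ^ 2 ∂(surfaceMeasure Γ).prod (surfaceMeasure Γ) =
      ‖(memLp_halfQuotient u).toLp (halfQuotient (toL2 u))‖ₑ ^ 2 := by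
    rw [← lintegral_enorm_sq_Lp]
    exact lintegral_congr_ae ((memLp_halfQuotient u).coeFn_toLp.symm.fun_comp fun c => ‖c‖ₑ ^ 2)
  rw [h2, ← ofReal_norm, ← ofReal_norm, ← ofReal_norm, ← ENNReal.ofReal_pow (norm_nonneg _), h1,
    ENNReal.ofReal_add (by positivity) (by positivity), ENNReal.ofReal_pow (norm_nonneg _),
    ENNReal.ofReal_pow (norm_nonneg _)]

lemma norm_toL2_le (u : HHalf Γ) : ‖toL2 u‖ ≤ ‖u‖ := by
  rw [← norm_embed]
  exact WithLp.norm_fst_le _ (embed u)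

lemma toL2_injective : Function.Injective (toL2 (Γ := Γ)) := Subtype.val_injective

/-- The inclusion of `H^{1/2}(Γ)` in `L²(Γ)` as a bounded operator. -/
def toL2L (Γ : Set E3) : HHalf Γ →L[ℂ] L2 Γ :=
  toL2.mkContinuous 1 fun u => by simpa using norm_toL2_le u

@[simp] lemma toL2L_apply (u : HHalf Γ) : toL2L Γ u = toL2 u := rfl

/-- Along a subsequence the functions converge almost everywhere on Γ, and along a further one their
quotients do so on Γ × Γ. Hence the second component of the limit is the quotient of the first. -/
lemma isClosed_range_embed [SFinite (surfaceMeasure Γ)] :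
    IsClosed (range (embed (Γ := Γ))) := by
  refine IsSeqClosed.isClosed fun y y₀ hy hlim => ?_
  choose u hu using hy
  have h1 : Tendsto (fun n => toL2 (u n)) atTop (𝓝 y₀.fst) := by
    have : Tendsto (fun n => (y n).fst) atTop (𝓝 y₀.fst) :=
      ((WithLp.prod_continuous_ofLp 2 _ _).fst.tendsto _).comp hlim
    refine this.congr fun n => ?_
    rw [← hu]
    rfl
  have h2 : Tendsto (fun n => (memLp_halfQuotient (u n)).toLp (halfQuotient (toL2 (u n)))) atTop
      (𝓝 y₀.snd) := by
    have : Tendsto (fun n => (y n).snd) atTop (𝓝 y₀.snd) :=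
      ((WithLp.prod_continuous_ofLp 2 _ _).snd.tendsto _).comp hlim
    refine this.congr fun n => ?_
    rw [← hu]
    rfl
  obtain ⟨ns, hns, hae⟩ := (tendstoInMeasure_of_tendsto_Lp h1).exists_seq_tendsto_ae
  obtain ⟨ms, hms, hae2⟩ := (tendstoInMeasure_of_tendsto_Lp
    (h2.comp hns.tendsto_atTop)).exists_seq_tendsto_ae
  have hq : halfQuotient y₀.fst =ᵐ[(surfaceMeasure Γ).prod (surfaceMeasure Γ)] y₀.snd := by
    filter_upwards [Measure.quasiMeasurePreserving_fst.ae hae,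
      Measure.quasiMeasurePreserving_snd.ae hae, hae2,
      ae_all_iff.2 fun n => (memLp_halfQuotient (u n)).coeFn_toLp] with z hz1 hz2 hz3 hz4
    refine tendsto_nhds_unique (((hz1.sub hz2).const_smul _).comp hms.tendsto_atTop)
      (hz3.congr fun n => ?_)
    simp only [Function.comp_apply, hz4]
    rfl
  have hmem : y₀.fst ∈ halfSubspace Γ := (memLp_congr_ae hq).2 (Lp.memLp y₀.snd)
  refine ⟨⟨y₀.fst, hmem⟩, ?_⟩
  refine WithLp.ofLp_injective 2 (Prod.ext rfl (Lp.ext ?_))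
  exact (MemLp.coeFn_toLp (p := 2) hmem).trans hq

lemma completeSpace [SFinite (surfaceMeasure Γ)] : CompleteSpace (HHalf Γ) :=
  (completeSpace_iff_isComplete_range isometry_embed.isUniformInducing).2
    isClosed_range_embed.isComplete

end HHalf

/-! ### The energy space -/

/-- The space `H¹(Γ)` with the inner product `κ²⟨u, v⟩ + ⟨∇u, ∇v⟩`, realised by the pairs
`(κ u, ∇u)`. -/
def energySpace (Γ : Set E3) (κ : ℝ) : Submodule ℂ (WithLp 2 (L2 Γ × L2Vec Γ)) :=
  (smoothGradientGraph Γ).topologicalClosure.comap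
    ((((κ : ℂ)⁻¹ • ContinuousLinearMap.fst ℂ (L2 Γ) (L2Vec Γ)).prod
      (ContinuousLinearMap.snd ℂ (L2 Γ) (L2Vec Γ))).comp
      (WithLp.prodContinuousLinearEquiv 2 ℂ (L2 Γ) (L2Vec Γ) :
        WithLp 2 (L2 Γ × L2Vec Γ) →L[ℂ] L2 Γ × L2Vec Γ)).toLinearMap

variable {Γ : Set E3} {κ : ℝ}

lemma mem_energySpace {w : WithLp 2 (L2 Γ × L2Vec Γ)} : w ∈ energySpace Γ κ ↔
    ((κ : ℂ)⁻¹ • w.fst, w.snd) ∈ (smoothGradientGraph Γ).topologicalClosure := Iff.rfl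

lemma isClosed_energySpace : IsClosed (energySpace Γ κ : Set (WithLp 2 (L2 Γ × L2Vec Γ))) :=
  (Submodule.isClosed_topologicalClosure _).preimage (ContinuousLinearMap.continuous _)

instance : CompleteSpace (energySpace Γ κ) := isClosed_energySpace.completeSpace_coe

namespace energySpace

lemma mem_H1 (w : energySpace Γ κ) : (κ : ℂ)⁻¹ • w.1.fst ∈ H1 Γ :=
  IsClosedLipschitzSurface.mem_H1_iff.2 ⟨_, mem_energySpace.1 w.2⟩

/-- The element of the energy space given by a function in `H¹(Γ)`. -/
def ofH1 (hΓ : IsClosedLipschitzSurface Γ) (hκ : κ ≠ 0) (u : H1 Γ) : energySpace Γ κ :=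
  ⟨WithLp.toLp 2 ((κ : ℂ) • (u : L2 Γ), surfaceGradient Γ u), mem_energySpace.2 (by
    have := hΓ.mem_graph u
    rwa [WithLp.toLp_fst, WithLp.toLp_snd, smul_smul,
      inv_mul_cancel₀ (Complex.ofReal_ne_zero.2 hκ), one_smul])⟩

/-- This turns the weak equation into a Riesz representation. The arguments are swapped because
`inner` is antilinear in the first one. -/
lemma inner_ofH1 (hΓ : IsClosedLipschitzSurface Γ) (hκ : κ ≠ 0) (u τ : H1 Γ) :
    inner ℂ (ofH1 hΓ hκ τ) (ofH1 hΓ hκ u) = shiftedLaplacian Γ κ u τ := by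
  rw [Submodule.coe_inner, WithLp.prod_inner_apply]
  simp only [ofH1, shiftedLaplacian, laplaceBeltrami, pairing, inner_smul_left, inner_smul_right,
    Complex.conj_ofReal]
  ring

/-- The embedding of the energy space in `H^{1/2}(Γ)`, as a linear map. -/
def toHHalfₗ (hΓ : IsClosedLipschitzSurface Γ) (κ : ℝ) : energySpace Γ κ →ₗ[ℂ] HHalf Γ where
  toFun w := ⟨(κ : ℂ)⁻¹ • w.1.fst, hΓ.H1_le_halfSubspace (mem_H1 w)⟩
  map_add' _ _ := Subtype.ext (smul_add _ _ _)
  map_smul' _ _ := Subtype.ext (smul_comm _ _ _)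

lemma toL2_toHHalfₗ (hΓ : IsClosedLipschitzSurface Γ) (w : energySpace Γ κ) :
    (toHHalfₗ hΓ κ w).toL2 = (κ : ℂ)⁻¹ • w.1.fst := rfl

/-- For small `ε` the `H^{1/2}` norm is bounded by `ε` times the energy norm plus a multiple of the
`L²` norm. -/
lemma exists_enorm_toHHalf_sq_le (hΓ : IsClosedLipschitzSurface Γ) (κ : ℝ) :
    ∃ C : ℝ≥0∞, ∃ δ₀ : ℝ, C ≠ ⊤ ∧ 0 < δ₀ ∧ ∀ δ : ℝ, 0 < δ → δ ≤ δ₀ → ∃ A : ℝ≥0∞, A ≠ ⊤ ∧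
      ∀ w : energySpace Γ κ, ‖toHHalfₗ hΓ κ w‖ₑ ^ 2 ≤ C * ENNReal.ofReal δ * ‖w‖ₑ ^ 2 +
        A * ‖(toHHalfₗ hΓ κ w).toL2‖ₑ ^ 2 := by
  obtain ⟨C, δ₀, hC, hδ₀, hh⟩ := hΓ.exists_lintegral_halfQuotient_le
  refine ⟨C, δ₀, hC, hδ₀, fun δ h0 h1 =>
    ⟨1 + 4 * (ENNReal.ofReal δ ^ 3)⁻¹ * surfaceMeasure Γ univ, ?_, fun w => ?_⟩⟩
  · have h3 := hΓ.measure_lt_top.ne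
    have h2 : (ENNReal.ofReal δ ^ 3)⁻¹ ≠ ⊤ := by simpa using h0
    finiteness
  · have h2 : ‖w.1.snd‖ₑ ≤ ‖w‖ₑ := WithLp.enorm_snd_le _ w.1
    rw [HHalf.enorm_sq]
    refine (add_le_add_right (hh _ (mem_energySpace.1 w.2) δ h0 h1) _).trans ?_
    rw [add_mul, one_mul, toL2_toHHalfₗ]
    calc _ = C * ENNReal.ofReal δ * ‖w.1.snd‖ₑ ^ 2 + (‖(κ : ℂ)⁻¹ • w.1.fst‖ₑ ^ 2 +
          4 * (ENNReal.ofReal δ ^ 3)⁻¹ * surfaceMeasure Γ univ * ‖(κ : ℂ)⁻¹ • w.1.fst‖ₑ ^ 2) := by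
          ring
      _ ≤ _ := by gcongr

lemma exists_norm_toHHalf_le (hΓ : IsClosedLipschitzSurface Γ) (κ : ℝ) :
    ∃ M : ℝ, ∀ w : energySpace Γ κ, ‖toHHalfₗ hΓ κ w‖ ≤ M * ‖w‖ := by
  obtain ⟨C, δ₀, hC, hδ₀, hh⟩ := exists_enorm_toHHalf_sq_le hΓ κ
  obtain ⟨A, hA, hw⟩ := hh δ₀ hδ₀ le_rfl
  set B : ℝ≥0∞ := C * ENNReal.ofReal δ₀ + A * ‖(κ : ℂ)⁻¹‖ₑ ^ 2 with hB
  have hBt : B ≠ ⊤ := by finiteness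
  have key : ∀ w : energySpace Γ κ, ‖toHHalfₗ hΓ κ w‖ₑ ^ 2 ≤ B * ‖w‖ₑ ^ 2 := by
    intro w
    refine (hw w).trans ?_
    rw [hB, add_mul, toL2_toHHalfₗ, enorm_smul, mul_pow, ← mul_assoc]
    gcongr
    exact WithLp.enorm_fst_le _ w.1
  refine ⟨√B.toReal, fun w => ?_⟩
  have h1 := ENNReal.toReal_mono (by finiteness) (key w)
  rw [ENNReal.toReal_mul, ENNReal.toReal_pow, ENNReal.toReal_pow, toReal_enorm, toReal_enorm] at h1
  rw [← Real.sqrt_sq (norm_nonneg w), ← Real.sqrt_mul ENNReal.toReal_nonneg]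
  exact Real.le_sqrt_of_sq_le h1

/-- The embedding of the energy space in `H^{1/2}(Γ)`. -/
def toHHalf (hΓ : IsClosedLipschitzSurface Γ) (κ : ℝ) : energySpace Γ κ →L[ℂ] HHalf Γ :=
  (toHHalfₗ hΓ κ).mkContinuousOfExistsBound (exists_norm_toHHalf_le hΓ κ)

lemma toHHalf_apply (hΓ : IsClosedLipschitzSurface Γ) (w : energySpace Γ κ) :
    toHHalf hΓ κ w = toHHalfₗ hΓ κ w := rfl

lemma toHHalf_ofH1 (hΓ : IsClosedLipschitzSurface Γ) (hκ : κ ≠ 0) (u : HHalf Γ)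
    (hu : u.toL2 ∈ H1 Γ) : toHHalf hΓ κ (ofH1 hΓ hκ ⟨u.toL2, hu⟩) = u := by
  refine HHalf.toL2_injective ?_
  rw [toHHalf_apply, toL2_toHHalfₗ]
  change (κ : ℂ)⁻¹ • (κ : ℂ) • u.toL2 = u.toL2
  rw [smul_smul, inv_mul_cancel₀ (Complex.ofReal_ne_zero.2 hκ), one_smul]

lemma ofH1_toHHalf (hΓ : IsClosedLipschitzSurface Γ) (hκ : κ ≠ 0) (w : energySpace Γ κ)
    (h : (toHHalf hΓ κ w).toL2 ∈ H1 Γ) : ofH1 hΓ hκ ⟨(toHHalf hΓ κ w).toL2, h⟩ = w := by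
  refine Subtype.ext (WithLp.ofLp_injective 2 (Prod.ext ?_ ?_))
  · change (κ : ℂ) • (κ : ℂ)⁻¹ • w.1.fst = _
    rw [smul_smul, mul_inv_cancel₀ (Complex.ofReal_ne_zero.2 hκ), one_smul]
    rfl
  · exact hΓ.surfaceGradient_eq (mem_energySpace.1 w.2)

end energySpace

/-! ### Averages at a given scale -/

/-- A smooth weight that is `1` if `dist x z ≤ ε` and `0` if `dist x z ≥ 2 * ε`. -/
def weight (ε : ℝ) (x z : E3) : ℝ :=
  (⟨1, 2, one_pos, one_lt_two⟩ : ContDiffBump (0 : E3)) (ε⁻¹ • (x - z))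

lemma weight_nonneg (ε : ℝ) (x z : E3) : 0 ≤ weight ε x z := ContDiffBump.nonneg _

lemma weight_le_one (ε : ℝ) (x z : E3) : weight ε x z ≤ 1 := ContDiffBump.le_one _

lemma weight_eq_one {ε : ℝ} (hε : 0 < ε) {x z : E3} (h : dist x z ≤ ε) : weight ε x z = 1 := by
  refine ContDiffBump.one_of_mem_closedBall _ ?_
  rw [mem_closedBall_zero_iff, norm_smul, norm_inv, Real.norm_of_nonneg hε.le, ← dist_eq_norm,
    inv_mul_le_iff₀ hε]
  simpa using h

lemma weight_eq_zero {ε : ℝ} (hε : 0 < ε) {x z : E3} (h : 2 * ε ≤ dist x z) :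
    weight ε x z = 0 := by
  refine ContDiffBump.zero_of_le_dist _ ?_
  rw [dist_zero_right, norm_smul, norm_inv, Real.norm_of_nonneg hε.le, ← dist_eq_norm,
    le_inv_mul_iff₀ hε]
  linarith

/-- All weights are rescaled translates of one bump, whose Lipschitz constant `Λ` serves every
scale. -/
lemma exists_weight_lipschitz :
    ∃ Λ : ℝ≥0, ∀ ε : ℝ, 0 < ε → ∀ x y z, |weight ε x z - weight ε y z| ≤ Λ * (ε⁻¹ * dist x y) := by
  obtain ⟨Λ, hΛ⟩ := ((⟨1, 2, one_pos, one_lt_two⟩ : ContDiffBump (0 : E3)).contDiff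
    (n := 1)).lipschitzWith_of_hasCompactSupport (ContDiffBump.hasCompactSupport _) (by simp)
  refine ⟨Λ, fun ε hε x y z => ?_⟩
  have := hΛ.dist_le_mul (ε⁻¹ • (x - z)) (ε⁻¹ • (y - z))
  rwa [dist_smul₀, dist_sub_right, norm_inv, Real.norm_of_nonneg hε.le] at this

lemma continuous_weight (ε : ℝ) : Continuous fun p : E3 × E3 => weight ε p.1 p.2 :=
  (ContDiffBump.continuous _).comp (by fun_prop)

lemma contDiff_integral_weight {F : Type*} [NormedAddCommGroup F] [NormedSpace ℝ F]
    {μ : Measure E3} {u : E3 → F} (hu : Integrable u μ) {ε : ℝ} (hε : 0 < ε) :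
    ContDiff ℝ ∞ fun x => ∫ z, weight ε x z • u z ∂μ := by
  set η : ContDiffBump (0 : E3) := ⟨1, 2, one_pos, one_lt_two⟩ with hη
  have h1 : HasCompactSupport fun x : E3 => η (ε⁻¹ • x) :=
    η.hasCompactSupport.comp_smul (inv_ne_zero hε.ne')
  have h2 : ContDiff ℝ ∞ fun x : E3 => η (ε⁻¹ • x) := η.contDiff.comp (contDiff_const_smul _)
  exact h1.contDiff_convolution_right (n := ⊤) (ContinuousLinearMap.lsmul ℝ ℝ).flip
    hu.locallyIntegrable h2

/-- The mean mass seen by the weight. -/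
def mass (μ : Measure E3) (ε : ℝ) (x : E3) : ℝ := ∫ z, weight ε x z ∂μ

/-- The weighted average of `u` at scale `ε`. -/
def average (μ : Measure E3) (ε : ℝ) (u : E3 → ℂ) (x : E3) : ℂ :=
  (mass μ ε x)⁻¹ • ∫ z, weight ε x z • u z ∂μ

/-- Smooth functions with positive lower bound on a set have smooth reciprocals there. -/
lemma exists_contDiff_inv {κ : ℝ} (hκ : 0 < κ) :
    ∃ G : ℝ → ℝ, ContDiff ℝ ∞ G ∧ ∀ t, κ ≤ t → G t = t⁻¹ := by
  refine ⟨fun t => Real.smoothTransition (2 * t / κ - 1) * t⁻¹, ?_, fun t ht => ?_⟩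
  · rw [contDiff_iff_contDiffAt]
    intro t
    rcases eq_or_ne t 0 with rfl | h0
    · have : (fun t => Real.smoothTransition (2 * t / κ - 1) * t⁻¹) =ᶠ[𝓝 0] fun _ => (0 : ℝ) := by
        filter_upwards [Iio_mem_nhds (show (0 : ℝ) < κ / 2 by positivity)] with t ht
        rw [Real.smoothTransition.zero_of_nonpos, zero_mul]
        rw [sub_nonpos, div_le_one hκ]
        linarith [mem_Iio.1 ht]
      exact contDiffAt_const.congr_of_eventuallyEq this
    · exact (Real.smoothTransition.contDiff.contDiffAt.comp t (by fun_prop)).mul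
        (contDiffAt_inv ℝ h0)
  · simp only
    rw [Real.smoothTransition.one_of_one_le, one_mul]
    rw [le_sub_iff_add_le, le_div_iff₀ hκ]
    linarith

section Estimates

variable {μ : Measure E3} {u : E3 → ℂ} {ε : ℝ}

lemma integrable_weight [IsFiniteMeasure μ] (x : E3) : Integrable (fun z => weight ε x z) μ :=
  Integrable.of_bound ((continuous_weight ε).comp (Continuous.prodMk_right x)).aestronglyMeasurable 1
    (Eventually.of_forall fun z => by
      rw [Real.norm_of_nonneg (weight_nonneg _ _ _)]; exact weight_le_one _ _ _)

lemma integrable_weight_smul (hu : Integrable u μ) (x : E3) :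
    Integrable (fun z => weight ε x z • u z) μ :=
  hu.norm.mono' ((((continuous_weight ε).comp
    (Continuous.prodMk_right x)).aestronglyMeasurable (μ := μ)).smul hu.1)
    (Eventually.of_forall fun z => by
      rw [norm_smul, Real.norm_of_nonneg (weight_nonneg _ _ _)]
      exact mul_le_of_le_one_left (norm_nonneg _) (weight_le_one _ _ _))

lemma measure_ball_le_enorm_mass [IsFiniteMeasure μ] (hε : 0 < ε) (x : E3) :
    μ (ball x ε) ≤ ‖mass μ ε x‖ₑ := by
  have h0 : 0 ≤ mass μ ε x := integral_nonneg fun z => weight_nonneg _ _ _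
  rw [Real.enorm_eq_ofReal h0, mass, ofReal_integral_eq_lintegral_ofReal (integrable_weight x)
    (Eventually.of_forall fun z => weight_nonneg _ _ _), ← setLIntegral_one]
  refine le_trans ?_ (setLIntegral_le_lintegral (ball x ε) _)
  refine setLIntegral_mono' measurableSet_ball fun z hz => ?_
  rw [weight_eq_one hε (mem_ball'.1 hz).le, ENNReal.ofReal_one]

lemma mass_smul_average_sub [IsFiniteMeasure μ] (hu : Integrable u μ) {x : E3}
    (hx : mass μ ε x ≠ 0) (c : ℂ) :
    mass μ ε x • (average μ ε u x - c) = ∫ z, weight ε x z • (u z - c) ∂μ := by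
  simp_rw [smul_sub]
  rw [integral_sub (integrable_weight_smul hu x) ((integrable_weight x).smul_const c),
    integral_smul_const, average, smul_smul, mul_inv_cancel₀ hx, one_smul]
  rfl

/-- The weight at `y` vanishes beyond distance `2 * ε` from `y`, hence outside `ball x (4 * ε)`. -/
lemma enorm_integral_weight_le (hε : 0 < ε) {x y : E3} (hxy : dist x y ≤ ε) (w : E3 → ℂ) :
    ‖∫ z, weight ε y z • w z ∂μ‖ₑ ≤ ∫⁻ z in ball x (4 * ε), ‖w z‖ₑ ∂μ := by
  refine (enorm_integral_le_lintegral_enorm _).trans ?_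
  rw [← lintegral_indicator measurableSet_ball]
  refine lintegral_mono fun z => ?_
  by_cases hz : z ∈ ball x (4 * ε)
  · rw [indicator_of_mem hz, enorm_smul]
    refine mul_le_of_le_one_left' ?_
    rw [Real.enorm_eq_ofReal (weight_nonneg _ _ _), ENNReal.ofReal_le_one]
    exact weight_le_one _ _ _
  · rw [indicator_of_notMem hz, weight_eq_zero hε, zero_smul, enorm_zero]
    rw [mem_ball', not_lt] at hz
    linarith [dist_triangle x y z]

lemma enorm_weight_sub_le {Λ : ℝ≥0}
    (hΛ : ∀ x y z, |weight ε x z - weight ε y z| ≤ Λ * (ε⁻¹ * dist x y)) (hε : 0 < ε) (x y z : E3) :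
    ‖weight ε x z - weight ε y z‖ₑ ≤ Λ * ((ENNReal.ofReal ε)⁻¹ * edist x y) := by
  rw [← ofReal_norm, Real.norm_eq_abs]
  refine (ENNReal.ofReal_le_ofReal (hΛ x y z)).trans (le_of_eq ?_)
  rw [ENNReal.ofReal_mul Λ.coe_nonneg, ENNReal.ofReal_mul (by positivity),
    ENNReal.ofReal_inv_of_pos hε, edist_dist, ENNReal.ofReal_coe_nnreal]

lemma enorm_integral_weight_sub_le {Λ : ℝ≥0}
    (hΛ : ∀ x y z, |weight ε x z - weight ε y z| ≤ Λ * (ε⁻¹ * dist x y)) (hε : 0 < ε)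
    {x y : E3} (hxy : dist x y ≤ ε) {F : Type*} [NormedAddCommGroup F] [NormedSpace ℝ F]
    (w : E3 → F) (h1 : Integrable (fun z => weight ε x z • w z) μ)
    (h2 : Integrable (fun z => weight ε y z • w z) μ) :
    ‖∫ z, weight ε x z • w z ∂μ - ∫ z, weight ε y z • w z ∂μ‖ₑ ≤
      Λ * ((ENNReal.ofReal ε)⁻¹ * edist x y) * ∫⁻ z in ball x (4 * ε), ‖w z‖ₑ ∂μ := by
  rw [← integral_sub h1 h2]
  refine (enorm_integral_le_lintegral_enorm _).trans ?_
  have hfin : ENNReal.ofReal ε ≠ 0 := by simpa using hε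
  rw [← lintegral_const_mul' _ _ (by finiteness), ← lintegral_indicator measurableSet_ball]
  refine lintegral_mono fun z => ?_
  by_cases hz : z ∈ ball x (4 * ε)
  · rw [indicator_of_mem hz, ← sub_smul, enorm_smul]
    gcongr
    exact enorm_weight_sub_le hΛ hε x y z
  · rw [mem_ball', not_lt] at hz
    rw [weight_eq_zero hε (by linarith), weight_eq_zero hε (by linarith [dist_triangle x y z])]
    simp

/-- The mean square oscillation of `u` near `x` (not normalised). -/
def oscillation (μ : Measure E3) (ε : ℝ) (u : E3 → ℂ) (x : E3) : ℝ≥0∞ :=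
  ∫⁻ z in ball x (4 * ε), ‖u z - u x‖ₑ ^ 2 ∂μ

variable {C c : ℝ≥0∞} {x y : E3}

lemma lintegral_sub_sq_le (hm : Measurable u) (hε : 0 < ε)
    (hC : ∀ r : ℝ, 0 < r → μ (ball x r) ≤ C * ENNReal.ofReal r ^ 2) :
    (∫⁻ z in ball x (4 * ε), ‖u z - u x‖ₑ ∂μ) ^ 2 ≤
      16 * C * ENNReal.ofReal ε ^ 2 * oscillation μ ε u x := by
  refine (sq_lintegral_le _ (hm.sub_const _).enorm.aemeasurable).trans ?_
  rw [Measure.restrict_apply_univ]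
  refine mul_le_mul_left ((hC _ (by positivity)).trans (le_of_eq ?_)) _
  rw [ENNReal.ofReal_mul zero_le_four, ENNReal.ofReal_ofNat]
  ring

lemma enorm_average_sub_le [IsFiniteMeasure μ] (hu : Integrable u μ) (hε : 0 < ε)
    (hc0 : c ≠ 0) (hct : c ≠ ⊤) (hc : c * ENNReal.ofReal ε ^ 2 ≤ μ (ball y ε))
    (hxy : dist x y ≤ ε) :
    ‖average μ ε u y - u x‖ₑ ≤
      (c * ENNReal.ofReal ε ^ 2)⁻¹ * ∫⁻ z in ball x (4 * ε), ‖u z - u x‖ₑ ∂μ := by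
  have he : ENNReal.ofReal ε ≠ 0 := by simpa using hε
  have hm := hc.trans (measure_ball_le_enorm_mass hε y)
  have hm0 : mass μ ε y ≠ 0 := by
    intro h0
    rw [h0, enorm_zero] at hm
    exact mul_ne_zero hc0 (pow_ne_zero 2 he) (le_antisymm hm zero_le)
  rw [← ENNReal.mul_le_iff_le_inv (mul_ne_zero hc0 (pow_ne_zero 2 he)) (by finiteness)]
  refine (mul_le_mul_left hm _).trans ?_
  rw [← enorm_smul, mass_smul_average_sub hu hm0]
  exact enorm_integral_weight_le hε hxy _

/-- The difference, multiplied by the mass at `x`, splits into a change of weight applied to `u - u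
x` and a change of mass applied to `average y - u x`. Each change is Lipschitz in the centre and
gains `dist x y / ε`. -/
lemma enorm_average_sub_average_le [IsFiniteMeasure μ] {Λ : ℝ≥0}
    (hΛ : ∀ x y z, |weight ε x z - weight ε y z| ≤ Λ * (ε⁻¹ * dist x y))
    (hu : Integrable u μ) (hε : 0 < ε)
    (hc0 : c ≠ 0) (hct : c ≠ ⊤) (hcx : c * ENNReal.ofReal ε ^ 2 ≤ μ (ball x ε))
    (hcy : c * ENNReal.ofReal ε ^ 2 ≤ μ (ball y ε))
    (hC : ∀ r : ℝ, 0 < r → μ (ball x r) ≤ C * ENNReal.ofReal r ^ 2) (hxy : dist x y ≤ ε) :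
    ‖average μ ε u x - average μ ε u y‖ₑ ≤
      (c * ENNReal.ofReal ε ^ 2)⁻¹ * (Λ * ((ENNReal.ofReal ε)⁻¹ * edist x y) * (1 + 16 * C * c⁻¹) *
        ∫⁻ z in ball x (4 * ε), ‖u z - u x‖ₑ ∂μ) := by
  have he : ENNReal.ofReal ε ≠ 0 := by simpa using hε
  have hne : ∀ y, c * ENNReal.ofReal ε ^ 2 ≤ μ (ball y ε) → mass μ ε y ≠ 0 := by
    intro y hy h0
    have hm := hy.trans (measure_ball_le_enorm_mass hε y)
    rw [h0, enorm_zero] at hm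
    exact mul_ne_zero hc0 (pow_ne_zero 2 he) (le_antisymm hm zero_le)
  rw [← ENNReal.mul_le_iff_le_inv (mul_ne_zero hc0 (pow_ne_zero 2 he)) (by finiteness)]
  refine (mul_le_mul_left (hcx.trans (measure_ball_le_enorm_mass hε x)) _).trans ?_
  rw [← enorm_smul]
  have hw : Integrable (fun z => u z - u x) μ := hu.sub (integrable_const _)
  have hsplit : mass μ ε x • (average μ ε u x - average μ ε u y) =
      (∫ z, weight ε x z • (u z - u x) ∂μ - ∫ z, weight ε y z • (u z - u x) ∂μ) -
      (mass μ ε x - mass μ ε y) • (average μ ε u y - u x) := by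
    rw [← mass_smul_average_sub hu (hne x hcx), ← mass_smul_average_sub hu (hne y hcy)]
    module
  have hmass : ‖mass μ ε x - mass μ ε y‖ₑ ≤
      Λ * ((ENNReal.ofReal ε)⁻¹ * edist x y) * (16 * C * ENNReal.ofReal ε ^ 2) := by
    have := enorm_integral_weight_sub_le hΛ hε hxy (fun _ => (1 : ℝ)) (μ := μ)
      (by simpa using integrable_weight x) (by simpa using integrable_weight y)
    simp only [smul_eq_mul, mul_one, enorm_one, setLIntegral_one] at this
    refine this.trans (mul_le_mul_right ((hC _ (by positivity)).trans (le_of_eq ?_)) _)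
    rw [ENNReal.ofReal_mul zero_le_four, ENNReal.ofReal_ofNat]
    ring
  rw [hsplit]
  refine enorm_sub_le.trans ?_
  rw [enorm_smul]
  refine (add_le_add (enorm_integral_weight_sub_le hΛ hε hxy _ (integrable_weight_smul hw x)
    (integrable_weight_smul hw y)) (mul_le_mul' hmass
      (enorm_average_sub_le hu hε hc0 hct hcy hxy))).trans (le_of_eq ?_)
  have hcancel : ENNReal.ofReal ε ^ 2 * (c * ENNReal.ofReal ε ^ 2)⁻¹ = c⁻¹ := by
    rw [ENNReal.mul_inv (.inl hc0) (.inl hct), mul_comm c⁻¹, ← mul_assoc,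
      ENNReal.mul_inv_cancel (pow_ne_zero 2 he) (by finiteness), one_mul]
  rw [← hcancel]
  ring

lemma enorm_average_sub_sq_le [IsFiniteMeasure μ] (hm : Measurable u) (hu : Integrable u μ)
    (hε : 0 < ε) (hc0 : c ≠ 0) (hct : c ≠ ⊤) (hc : c * ENNReal.ofReal ε ^ 2 ≤ μ (ball y ε))
    (hC : ∀ r : ℝ, 0 < r → μ (ball x r) ≤ C * ENNReal.ofReal r ^ 2) (hxy : dist x y ≤ ε) :
    ‖average μ ε u y - u x‖ₑ ^ 2 ≤
      16 * C * c⁻¹ ^ 2 * (ENNReal.ofReal ε)⁻¹ ^ 2 * oscillation μ ε u x := by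
  have he : ENNReal.ofReal ε ≠ 0 := by simpa using hε
  refine (pow_le_pow_left₀ zero_le (enorm_average_sub_le hu hε hc0 hct hc hxy) 2).trans ?_
  rw [mul_pow]
  refine (mul_le_mul_right (lintegral_sub_sq_le hm hε hC) _).trans (le_of_eq ?_)
  rw [ENNReal.mul_inv (.inl hc0) (.inl hct), ENNReal.inv_pow]
  generalize hE : ENNReal.ofReal ε = e at *
  have hee : e⁻¹ * e = 1 := ENNReal.inv_mul_cancel he (by rw [← hE]; finiteness)
  calc (c⁻¹ * e⁻¹ ^ 2) ^ 2 * (16 * C * e ^ 2 * oscillation μ ε u x)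
      = 16 * C * c⁻¹ ^ 2 * e⁻¹ ^ 2 * (e⁻¹ * e) ^ 2 * oscillation μ ε u x := by ring
    _ = _ := by rw [hee]; ring

lemma enorm_average_sub_average_sq_le [IsFiniteMeasure μ] {Λ : ℝ≥0}
    (hΛ : ∀ x y z, |weight ε x z - weight ε y z| ≤ Λ * (ε⁻¹ * dist x y)) (hm : Measurable u)
    (hu : Integrable u μ) (hε : 0 < ε)
    (hc0 : c ≠ 0) (hct : c ≠ ⊤) (hcx : c * ENNReal.ofReal ε ^ 2 ≤ μ (ball x ε))
    (hcy : c * ENNReal.ofReal ε ^ 2 ≤ μ (ball y ε))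
    (hC : ∀ r : ℝ, 0 < r → μ (ball x r) ≤ C * ENNReal.ofReal r ^ 2) (hxy : dist x y ≤ ε) :
    ‖average μ ε u x - average μ ε u y‖ₑ ^ 2 ≤
      16 * C * c⁻¹ ^ 2 * Λ ^ 2 * (1 + 16 * C * c⁻¹) ^ 2 * (ENNReal.ofReal ε)⁻¹ ^ 4 *
        edist x y ^ 2 * oscillation μ ε u x := by
  have he : ENNReal.ofReal ε ≠ 0 := by simpa using hε
  refine (pow_le_pow_left₀ zero_le
    (enorm_average_sub_average_le hΛ hu hε hc0 hct hcx hcy hC hxy) 2).trans ?_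
  rw [mul_pow, mul_pow]
  refine (mul_le_mul_right (mul_le_mul_right (lintegral_sub_sq_le hm hε hC) _) _).trans
    (le_of_eq ?_)
  rw [ENNReal.mul_inv (.inl hc0) (.inl hct), ENNReal.inv_pow]
  generalize hE : ENNReal.ofReal ε = e at *
  have hee : e⁻¹ * e = 1 := ENNReal.inv_mul_cancel he (by rw [← hE]; finiteness)
  calc _ = 16 * C * c⁻¹ ^ 2 * Λ ^ 2 * (1 + 16 * C * c⁻¹) ^ 2 * e⁻¹ ^ 4 *
        edist x y ^ 2 * (e⁻¹ * e) ^ 2 * oscillation μ ε u x := by ring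
    _ = _ := by rw [hee]; ring

end Estimates

/-! ### Smooth approximation that is stable in H^{1/2}. -/

/-- The square of the Gagliardo seminorm of order `1/2`. -/
def halfEnergy (Γ : Set E3) (u : E3 → ℂ) : ℝ≥0∞ :=
  ∫⁻ z, ‖halfQuotient u z‖ₑ ^ 2 ∂(surfaceMeasure Γ).prod (surfaceMeasure Γ)

namespace IsClosedLipschitzSurface

variable {Γ : Set E3}

/-- For `y` in `ball x (4 * ε)` one has 1 ≤ (4ε)³ / |x - y|³ when `y ≠ x`, so the oscillation is at
most 64ε³ times the local Gagliardo integral. -/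
lemma lintegral_oscillation_le (h : IsClosedLipschitzSurface Γ) {u : E3 → ℂ} (hu : Measurable u)
    {ε : ℝ} :
    ∫⁻ x, oscillation (surfaceMeasure Γ) ε u x ∂surfaceMeasure Γ ≤
      64 * ENNReal.ofReal ε ^ 3 * halfEnergy Γ u := by
  have hfin := h.isFiniteMeasure
  have he4 : ENNReal.ofReal (4 * ε) ^ 3 = 64 * ENNReal.ofReal ε ^ 3 := by
    rw [ENNReal.ofReal_mul zero_le_four, ENNReal.ofReal_ofNat]
    ring
  have hpt : ∀ x, oscillation (surfaceMeasure Γ) ε u x ≤ 64 * ENNReal.ofReal ε ^ 3 *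
      ∫⁻ y in ball x (4 * ε), ‖halfQuotient u (x, y)‖ₑ ^ 2 ∂surfaceMeasure Γ := by
    intro x
    rw [oscillation, ← lintegral_const_mul' _ _ (by finiteness)]
    refine setLIntegral_mono' measurableSet_ball fun y hy => ?_
    rw [enorm_halfQuotient_sq, ← enorm_neg (u y - u x), neg_sub, ← mul_assoc]
    rcases eq_or_ne x y with rfl | hxy
    · simp
    · refine le_mul_of_one_le_left' ?_
      have h0 : edist x y ^ 3 ≠ 0 := pow_ne_zero 3 (edist_pos.2 hxy).ne'
      rw [← he4, ← ENNReal.mul_inv_cancel h0 (by finiteness)]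
      gcongr
      rw [edist_dist]
      exact ENNReal.ofReal_le_ofReal (mem_ball'.1 hy).le
  refine (lintegral_mono hpt).trans ?_
  rw [lintegral_const_mul' _ _ (by finiteness),
    ← lintegral_near_eq _ (measurable_enorm_halfQuotient_sq hu)]
  exact mul_le_mul_right (setLIntegral_le_lintegral _ _) _

/-- Ahlfors regularity of `Γ`, with constants for both bounds. -/
lemma exists_ahlfors (h : IsClosedLipschitzSurface Γ) :
    ∃ C c : ℝ≥0∞, ∃ r₀ : ℝ, C ≠ ⊤ ∧ c ≠ 0 ∧ c ≠ ⊤ ∧ 0 < r₀ ∧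
      (∀ x ∈ Γ, ∀ r : ℝ, 0 < r → surfaceMeasure Γ (ball x r) ≤ C * ENNReal.ofReal r ^ 2) ∧
      ∀ x ∈ Γ, ∀ r : ℝ, 0 < r → r ≤ r₀ →
        c * ENNReal.ofReal r ^ 2 ≤ surfaceMeasure Γ (ball x r) := by
  obtain ⟨C, hC, hup⟩ := h.exists_measure_ball_le
  obtain ⟨c, r₀, hc, hr₀, hlow⟩ := h.exists_le_measure_ball
  exact ⟨C, min c 1, r₀, hC, (lt_min (pos_iff_ne_zero.2 hc) one_pos).ne',
    (min_le_right c 1).trans_lt ENNReal.one_lt_top |>.ne, hr₀, hup, fun x hx r h0 h1 =>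
    (mul_le_mul_left (min_le_left _ _) _).trans (hlow x hx r h0 h1)⟩

/-- Averages are restrictions of smooth functions. -/
lemma exists_smooth_eq_average (h : IsClosedLipschitzSurface Γ) {u : E3 → ℂ}
    (hu : Integrable u (surfaceMeasure Γ)) {ε : ℝ} (hε : 0 < ε) {c : ℝ≥0∞} (hc0 : c ≠ 0)
    (hct : c ≠ ⊤) (hc : ∀ x ∈ Γ, c * ENNReal.ofReal ε ^ 2 ≤ surfaceMeasure Γ (ball x ε)) :
    ∃ F : E3 → ℂ, ContDiff ℝ ∞ F ∧ EqOn F (average (surfaceMeasure Γ) ε u) Γ := by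
  have hfin := h.isFiniteMeasure
  have hpos : 0 < (c * ENNReal.ofReal ε ^ 2).toReal :=
    ENNReal.toReal_pos (mul_ne_zero hc0 (pow_ne_zero 2 (by simpa using hε))) (by finiteness)
  -- The mass is bounded below only on Γ, so its reciprocal is replaced by a function that is smooth
  -- on the whole line.
  obtain ⟨G, hG, hGinv⟩ := exists_contDiff_inv hpos
  have hmass : ContDiff ℝ ∞ (mass (surfaceMeasure Γ) ε) := by
    have := contDiff_integral_weight (integrable_const (1 : ℝ)) hε (μ := surfaceMeasure Γ)
    simp only [smul_eq_mul, mul_one] at this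
    exact this
  refine ⟨fun x => G (mass (surfaceMeasure Γ) ε x) • ∫ z, weight ε x z • u z ∂surfaceMeasure Γ,
    (hG.comp hmass).smul (contDiff_integral_weight hu hε), fun x hx => ?_⟩
  have h0 : 0 ≤ mass (surfaceMeasure Γ) ε x := integral_nonneg fun z => weight_nonneg _ _ _
  have h1 := (hc x hx).trans (measure_ball_le_enorm_mass hε x)
  rw [Real.enorm_eq_ofReal h0] at h1
  have h2 : (c * ENNReal.ofReal ε ^ 2).toReal ≤ mass (surfaceMeasure Γ) ε x :=
    ENNReal.toReal_le_of_le_ofReal h0 h1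
  simp only [hGinv _ h2, average]

/-- Write `F` as `u` plus the error `F - u`. The truncated kernel integrates to at most `8 * C / ε`
in either variable, so the error contributes its squared L² norm divided by `ε`, which is harmless
when that square is O(ε). -/
lemma lintegral_far_energy_le (h : IsClosedLipschitzSurface Γ) {C : ℝ≥0∞}
    (hC : ∀ x ∈ Γ, ∀ r : ℝ, 0 < r → surfaceMeasure Γ (ball x r) ≤ C * ENNReal.ofReal r ^ 2)
    {u F : E3 → ℂ} (hu : Measurable u) (hF : Measurable F) {ε : ℝ} (hε : 0 < ε) :
    ∫⁻ z in {z : E3 × E3 | dist z.2 z.1 < ε}ᶜ, ‖halfQuotient F z‖ₑ ^ 2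
        ∂(surfaceMeasure Γ).prod (surfaceMeasure Γ) ≤
      2 * halfEnergy Γ u + 64 * C * (ENNReal.ofReal ε)⁻¹ *
        ∫⁻ x, ‖F x - u x‖ₑ ^ 2 ∂surfaceMeasure Γ := by
  have hfin := h.isFiniteMeasure
  set S : Set (E3 × E3) := {z : E3 × E3 | dist z.2 z.1 < ε}ᶜ with hS
  have hSm : MeasurableSet S := (measurableSet_near ε).compl
  set k : E3 × E3 → ℝ≥0∞ := S.indicator fun z => (edist z.1 z.2 ^ 3)⁻¹ with hk
  have hkm : Measurable k := (measurable_edist.pow_const 3).inv.indicator hSm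
  have hksymm : ∀ x y, k (x, y) = k (y, x) := fun x y => by
    by_cases hxy : (x, y) ∈ S
    · have hyx : (y, x) ∈ S := by simpa [S, dist_comm] using hxy
      rw [hk, indicator_of_mem hxy, indicator_of_mem hyx, edist_comm]
    · have hyx : (y, x) ∉ S := by simpa [S, dist_comm] using hxy
      rw [hk, indicator_of_notMem hxy, indicator_of_notMem hyx]
  set w : E3 → ℝ≥0∞ := fun x => ‖F x - u x‖ₑ ^ 2 with hw
  have hwm : Measurable w := (hF.sub hu).enorm.pow_const 2
  have hkint : ∀ x ∈ Γ, ∫⁻ y, k (x, y) ∂surfaceMeasure Γ ≤ 8 * C * (ENNReal.ofReal ε)⁻¹ := by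
    intro x hx
    refine le_trans (le_of_eq ?_) (lintegral_inv_edist_cube_le (hC x hx) hε)
    rw [← lintegral_indicator measurableSet_ball.compl]
    rfl
  have hrow : ∫⁻ x, (∫⁻ y, k (x, y) * w x ∂surfaceMeasure Γ) ∂surfaceMeasure Γ ≤
      8 * C * (ENNReal.ofReal ε)⁻¹ * ∫⁻ x, w x ∂surfaceMeasure Γ := by
    rw [← lintegral_const_mul _ hwm]
    refine lintegral_mono_ae (h.ae_mem.mono fun x hx => ?_)
    have hkx : Measurable fun y => k (x, y) := hkm.comp measurable_prodMk_left
    rw [lintegral_mul_const _ hkx]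
    exact mul_le_mul_left (hkint x hx) _
  have hm1 : Measurable fun z : E3 × E3 => k z * w z.1 := hkm.mul (hwm.comp measurable_fst)
  have hm2 : Measurable fun z : E3 × E3 => k z * w z.2 := hkm.mul (hwm.comp measurable_snd)
  have h1 : ∫⁻ z, k z * w z.1 ∂(surfaceMeasure Γ).prod (surfaceMeasure Γ) ≤
      8 * C * (ENNReal.ofReal ε)⁻¹ * ∫⁻ x, w x ∂surfaceMeasure Γ := by
    rw [lintegral_prod _ hm1.aemeasurable]
    exact hrow
  have h2 : ∫⁻ z, k z * w z.2 ∂(surfaceMeasure Γ).prod (surfaceMeasure Γ) ≤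
      8 * C * (ENNReal.ofReal ε)⁻¹ * ∫⁻ x, w x ∂surfaceMeasure Γ := by
    rw [lintegral_prod_symm _ hm2.aemeasurable]
    simpa only [hksymm] using hrow
  have hmE := measurable_enorm_halfQuotient_sq hu
  have hmw : Measurable fun z : E3 × E3 => k z * w z.1 + k z * w z.2 := hm1.add hm2
  rw [← lintegral_indicator hSm]
  calc _ ≤ ∫⁻ z, (2 * ‖halfQuotient u z‖ₑ ^ 2 + 4 * (k z * w z.1 + k z * w z.2))
        ∂(surfaceMeasure Γ).prod (surfaceMeasure Γ) := by
        refine lintegral_mono fun z => ?_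
        by_cases hz : z ∈ S
        · rw [indicator_of_mem hz, enorm_halfQuotient_sq, enorm_halfQuotient_sq, hk,
            indicator_of_mem hz]
          have e1 : ‖F z.1 - F z.2‖ₑ ^ 2 ≤ 2 * (‖u z.1 - u z.2‖ₑ ^ 2 + 2 * (w z.1 + w z.2)) := by
            have : F z.1 - F z.2 = (u z.1 - u z.2) + ((F z.1 - u z.1) - (F z.2 - u z.2)) := by ring
            rw [this]
            refine (pow_le_pow_left₀ zero_le (enorm_add_le _ _) 2).trans
              ((ENNReal.add_sq_le_two_mul _ _).trans ?_)
            gcongr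
            exact (pow_le_pow_left₀ zero_le enorm_sub_le 2).trans (ENNReal.add_sq_le_two_mul _ _)
          refine (mul_le_mul_right e1 _).trans (le_of_eq ?_)
          ring
        · rw [indicator_of_notMem hz]
          exact zero_le
    _ = 2 * halfEnergy Γ u + 4 * (∫⁻ z, k z * w z.1 ∂(surfaceMeasure Γ).prod (surfaceMeasure Γ) +
          ∫⁻ z, k z * w z.2 ∂(surfaceMeasure Γ).prod (surfaceMeasure Γ)) := by
        rw [lintegral_add_left (hmE.const_mul 2), lintegral_const_mul _ hmE,
          lintegral_const_mul _ hmw, lintegral_add_left hm1]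
        rfl
    _ ≤ 2 * halfEnergy Γ u + 4 * (8 * C * (ENNReal.ofReal ε)⁻¹ * ∫⁻ x, w x ∂surfaceMeasure Γ +
          8 * C * (ENNReal.ofReal ε)⁻¹ * ∫⁻ x, w x ∂surfaceMeasure Γ) := by gcongr
    _ = _ := by ring

/-- Approximation by smooth functions that is stable in `H^{1/2}(Γ)`. -/
lemma exists_smooth_approx (h : IsClosedLipschitzSurface Γ) :
    ∃ A : ℝ≥0∞, ∃ ε₀ : ℝ, A ≠ ⊤ ∧ 0 < ε₀ ∧ ∀ u : E3 → ℂ, Measurable u →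
      Integrable u (surfaceMeasure Γ) → ∀ ε : ℝ, 0 < ε → ε ≤ ε₀ → ∃ F : E3 → ℂ, ContDiff ℝ ∞ F ∧
        ∫⁻ x, ‖F x - u x‖ₑ ^ 2 ∂surfaceMeasure Γ ≤ A * ENNReal.ofReal ε * halfEnergy Γ u ∧
        halfEnergy Γ F ≤ A * halfEnergy Γ u := by
  have hfin := h.isFiniteMeasure
  obtain ⟨C, c, ε₀, hCt, hc0, hct, hε₀, hup, hlow⟩ := h.exists_ahlfors
  obtain ⟨Λ, hΛ⟩ := exists_weight_lipschitz
  have hcit : c⁻¹ ≠ ⊤ := ENNReal.inv_ne_top.2 hc0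
  set K₁ : ℝ≥0∞ := 16 * C * c⁻¹ ^ 2 with hK₁
  set K₂ : ℝ≥0∞ := 16 * C * c⁻¹ ^ 2 * Λ ^ 2 * (1 + 16 * C * c⁻¹) ^ 2 with hK₂
  have hK₁t : K₁ ≠ ⊤ := by finiteness
  have hK₂t : K₂ ≠ ⊤ := by finiteness
  refine ⟨64 * K₁ + (1024 * C * K₂ + (2 + 4096 * C * K₁)), ε₀, by finiteness, hε₀,
    fun u hu hui ε h0 h1 => ?_⟩
  have he : ENNReal.ofReal ε ≠ 0 := by simpa using h0
  have het : ENNReal.ofReal ε ≠ ⊤ := by finiteness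
  have hee : (ENNReal.ofReal ε)⁻¹ * ENNReal.ofReal ε = 1 := ENNReal.inv_mul_cancel he het
  have heit : (ENNReal.ofReal ε)⁻¹ ≠ ⊤ := ENNReal.inv_ne_top.2 he
  have hlowε : ∀ x ∈ Γ, c * ENNReal.ofReal ε ^ 2 ≤ surfaceMeasure Γ (ball x ε) :=
    fun x hx => hlow x hx ε h0 h1
  obtain ⟨F, hF, hFavg⟩ := h.exists_smooth_eq_average hui h0 hc0 hct hlowε
  have hosc := h.lintegral_oscillation_le hu (ε := ε)
  -- The pointwise bound costs `ε⁻²`, and the integrated oscillation supplies `ε³`.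
  have happrox : ∫⁻ x, ‖F x - u x‖ₑ ^ 2 ∂surfaceMeasure Γ ≤
      64 * K₁ * ENNReal.ofReal ε * halfEnergy Γ u := by
    calc ∫⁻ x, ‖F x - u x‖ₑ ^ 2 ∂surfaceMeasure Γ
        ≤ ∫⁻ x, K₁ * (ENNReal.ofReal ε)⁻¹ ^ 2 * oscillation (surfaceMeasure Γ) ε u x
            ∂surfaceMeasure Γ := by
          refine lintegral_mono_ae (h.ae_mem.mono fun x hx => ?_)
          rw [hFavg hx]
          exact enorm_average_sub_sq_le hu hui h0 hc0 hct (hlowε x hx) (hup x hx)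
            (by rw [dist_self]; exact h0.le)
      _ ≤ K₁ * (ENNReal.ofReal ε)⁻¹ ^ 2 * (64 * ENNReal.ofReal ε ^ 3 * halfEnergy Γ u) := by
          rw [lintegral_const_mul' _ _ (by finiteness)]
          gcongr
      _ = 64 * K₁ * ENNReal.ofReal ε * ((ENNReal.ofReal ε)⁻¹ * ENNReal.ofReal ε) ^ 2 *
          halfEnergy Γ u := by ring
      _ = _ := by rw [hee]; ring
  -- The powers of `ε` cancel: `-4` from the Lipschitz bound on averages, `1` from integrating the
  -- kernel `1 / |x - y|`, and `3` from the oscillation.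
  have hnear : ∫⁻ z in {z : E3 × E3 | dist z.2 z.1 < ε}, ‖halfQuotient F z‖ₑ ^ 2
        ∂(surfaceMeasure Γ).prod (surfaceMeasure Γ) ≤ 1024 * C * K₂ * halfEnergy Γ u := by
    rw [lintegral_near_eq _ (measurable_enorm_halfQuotient_sq hF.continuous.measurable)]
    calc _ ≤ ∫⁻ x, 16 * C * K₂ * (ENNReal.ofReal ε)⁻¹ ^ 3 * oscillation (surfaceMeasure Γ) ε u x
            ∂surfaceMeasure Γ := by
          refine lintegral_mono_ae (h.ae_mem.mono fun x hx => ?_)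
          have hpt : ∀ᵐ y ∂(surfaceMeasure Γ).restrict (ball x ε), ‖halfQuotient F (x, y)‖ₑ ^ 2 ≤
              K₂ * (ENNReal.ofReal ε)⁻¹ ^ 4 * oscillation (surfaceMeasure Γ) ε u x *
                (edist x y)⁻¹ := by
            filter_upwards [ae_restrict_of_ae h.ae_mem, ae_restrict_mem measurableSet_ball]
              with y hy hyx
            rw [enorm_halfQuotient_sq, hFavg hx, hFavg hy]
            refine (mul_le_mul_right (enorm_average_sub_average_sq_le (hΛ ε h0) hu hui h0 hc0 hct
              (hlowε x hx) (hlowε y hy) (hup x hx) (mem_ball'.1 hyx).le) _).trans ?_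
            rcases eq_or_ne x y with rfl | hxy
            · simp
            · have hd : edist x y ≠ 0 := (edist_pos.2 hxy).ne'
              have hdd : (edist x y)⁻¹ * edist x y = 1 := ENNReal.inv_mul_cancel hd (by finiteness)
              rw [ENNReal.inv_pow]
              refine le_of_eq ?_
              calc _ = K₂ * (ENNReal.ofReal ε)⁻¹ ^ 4 * oscillation (surfaceMeasure Γ) ε u x *
                    (edist x y)⁻¹ * ((edist x y)⁻¹ * edist x y) ^ 2 := by rw [hK₂]; ring
                _ = _ := by rw [hdd, one_pow, mul_one]
          have hmd : Measurable fun y => (edist x y)⁻¹ := (measurable_edist_right).inv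
          refine (lintegral_mono_ae hpt).trans ?_
          rw [lintegral_const_mul _ hmd]
          refine (mul_le_mul_right (lintegral_inv_edist_ball_le hCt (hup x hx) h0) _).trans
            (le_of_eq ?_)
          calc _ = 16 * C * K₂ * (ENNReal.ofReal ε)⁻¹ ^ 3 *
                oscillation (surfaceMeasure Γ) ε u x *
                ((ENNReal.ofReal ε)⁻¹ * ENNReal.ofReal ε) := by ring
            _ = _ := by rw [hee, mul_one]
      _ ≤ 16 * C * K₂ * (ENNReal.ofReal ε)⁻¹ ^ 3 *
            (64 * ENNReal.ofReal ε ^ 3 * halfEnergy Γ u) := by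
          rw [lintegral_const_mul' _ _ (by finiteness)]
          gcongr
      _ = 1024 * C * K₂ * ((ENNReal.ofReal ε)⁻¹ * ENNReal.ofReal ε) ^ 3 * halfEnergy Γ u := by ring
      _ = _ := by rw [hee]; ring
  have hfar := h.lintegral_far_energy_le hup hu hF.continuous.measurable h0
  have hfar' : ∫⁻ z in {z : E3 × E3 | dist z.2 z.1 < ε}ᶜ, ‖halfQuotient F z‖ₑ ^ 2
        ∂(surfaceMeasure Γ).prod (surfaceMeasure Γ) ≤ (2 + 4096 * C * K₁) * halfEnergy Γ u := by
    refine hfar.trans ((add_le_add_right (mul_le_mul_right happrox _) _).trans (le_of_eq ?_))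
    calc _ = 2 * halfEnergy Γ u + 4096 * C * K₁ *
          ((ENNReal.ofReal ε)⁻¹ * ENNReal.ofReal ε) * halfEnergy Γ u := by ring
      _ = _ := by rw [hee]; ring
  refine ⟨F, hF, happrox.trans ?_, ?_⟩
  · gcongr
    exact le_self_add
  · rw [halfEnergy, ← lintegral_add_compl _ (measurableSet_near ε), add_mul, add_mul]
    exact (add_le_add hnear hfar').trans le_add_self

end IsClosedLipschitzSurface

/-! ### Density of H¹ in H^{1/2} through weak limits. -/

section WeakLimits

variable {H K : Type*} [NormedAddCommGroup H] [InnerProductSpace ℂ H] [CompleteSpace H]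
  [NormedAddCommGroup K] [InnerProductSpace ℂ K] [CompleteSpace K]

/-- The orthogonal complement of the range of the adjoint is the kernel of `T`. -/
lemma denseRange_adjoint {T : H →L[ℂ] K} (hT : Function.Injective T) :
    Dense (LinearMap.range T.adjoint.toLinearMap : Set H) := by
  rw [Submodule.dense_iff_topologicalClosure_eq_top, Submodule.topologicalClosure_eq_top_iff,
    ContinuousLinearMap.orthogonal_range, ContinuousLinearMap.adjoint_adjoint]
  exact LinearMap.ker_eq_bot.2 hT

/-- A vector orthogonal to a bounded sequence is orthogonal to its limit in a weaker norm. -/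
lemma inner_eq_zero_of_tendsto {T : H →L[ℂ] K} (hT : Function.Injective T) {x : ℕ → H} {y t : H}
    {M : ℝ} (hM : ∀ n, ‖x n‖ ≤ M) (hx : Tendsto (fun n => T (x n)) atTop (𝓝 (T y)))
    (ht : ∀ n, inner ℂ t (x n) = 0) : inner ℂ t y = 0 := by
  have hM' : 0 ≤ M := (norm_nonneg _).trans (hM 0)
  -- For `s = T.adjoint z`, the inner product of `t` with `y` is that of `t - s` with `y - x n` plus
  -- that of `z` with `T y - T (x n)`; the last term tends to zero. Density then lets `s` approach
  -- `t`.
  have hkey : ∀ s ∈ (LinearMap.range T.adjoint.toLinearMap : Set H),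
      ‖(inner ℂ t y : ℂ)‖ ≤ ‖t - s‖ * (‖y‖ + M) := by
    rintro _ ⟨z, rfl⟩
    have hlim : Tendsto (fun n => ‖(inner ℂ (t - T.adjoint z) (y - x n) : ℂ)‖) atTop
        (𝓝 ‖(inner ℂ t y : ℂ)‖) := by
      have h1 : Tendsto (fun n => (inner ℂ t y : ℂ) - inner ℂ z (T y - T (x n))) atTop
          (𝓝 (inner ℂ t y - inner ℂ z (T y - T y))) :=
        (tendsto_const_nhds.inner (tendsto_const_nhds.sub hx)).const_sub _
      rw [sub_self, inner_zero_right, sub_zero] at h1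
      refine h1.norm.congr fun n => ?_
      rw [inner_sub_left, inner_sub_right t, ht, sub_zero, ContinuousLinearMap.adjoint_inner_left,
        map_sub]
    refine le_of_tendsto hlim (Eventually.of_forall fun n => ?_)
    refine (norm_inner_le_norm _ _).trans ?_
    refine mul_le_mul_of_nonneg_left ((norm_sub_le _ _).trans ?_) (norm_nonneg _)
    linarith [hM n]
  obtain ⟨s, hs, hlim⟩ := mem_closure_iff_seq_limit.1 (denseRange_adjoint hT t)
  have h0 : Tendsto (fun n => ‖t - s n‖ * (‖y‖ + M)) atTop (𝓝 (‖t - t‖ * (‖y‖ + M))) :=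
    (tendsto_const_nhds.sub hlim).norm.mul_const _
  rw [sub_self, norm_zero, zero_mul] at h0
  exact norm_le_zero_iff.1 (ge_of_tendsto' h0 fun n => hkey _ (hs n))

end WeakLimits

section Conj

variable {H : Type*} [NormedAddCommGroup H] [InnerProductSpace ℂ H]

/-- The linear functional conjugate to an antilinear one. -/
def conjFunctional (θ : H →L⋆[ℂ] ℂ) : H →L[ℂ] ℂ :=
  ((starL ℂ : ℂ ≃L⋆[ℂ] ℂ) : ℂ →L⋆[ℂ] ℂ).comp θ

lemma conjFunctional_apply (θ : H →L⋆[ℂ] ℂ) (v : H) : conjFunctional θ v = star (θ v) := rfl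

end Conj

variable {Γ : Set E3}

lemma HHalf.enorm_sq_eq (u : HHalf Γ) :
    ‖u‖ₑ ^ 2 = ‖u.toL2‖ₑ ^ 2 + halfEnergy Γ u.toL2 := u.enorm_sq

lemma halfEnergy_congr {u v : E3 → ℂ} (h : u =ᵐ[surfaceMeasure Γ] v) :
    halfEnergy Γ u = halfEnergy Γ v :=
  lintegral_congr_ae ((halfQuotient_congr Γ h).fun_comp fun c => ‖c‖ₑ ^ 2)

namespace IsClosedLipschitzSurface

/-- The approximants are close to `u` only in L²; in H^{1/2} they are merely bounded, which is all
the weak limit needs. -/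
lemma exists_mem_H1_approx (h : IsClosedLipschitzSurface Γ) :
    ∃ A : ℝ≥0∞, ∃ ε₀ : ℝ, A ≠ ⊤ ∧ 0 < ε₀ ∧ ∀ u : HHalf Γ, ∀ ε : ℝ, 0 < ε → ε ≤ ε₀ →
      ∃ v : HHalf Γ, v.toL2 ∈ H1 Γ ∧
        ‖v.toL2 - u.toL2‖ₑ ^ 2 ≤ A * ENNReal.ofReal ε * ‖u‖ₑ ^ 2 ∧ ‖v‖ₑ ^ 2 ≤ A * ‖u‖ₑ ^ 2 := by
  have hfin := h.isFiniteMeasure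
  obtain ⟨A, ε₀, hA, hε₀, hh⟩ := h.exists_smooth_approx
  refine ⟨2 * (1 + A * ENNReal.ofReal ε₀) + 2 * A, ε₀, by finiteness, hε₀, fun u ε h0 h1 => ?_⟩
  obtain ⟨F, hF, hFu, hFE⟩ := hh u.toL2 (Lp.stronglyMeasurable u.toL2).measurable
    ((Lp.memLp u.toL2).integrable one_le_two) ε h0 h1
  have hmem : (h.memLp_of_continuous hF.continuous).toLp F ∈ H1 Γ :=
    mem_H1_iff.2 ⟨_, Submodule.le_topologicalClosure _ (mem_smoothGradientGraph h hF)⟩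
  set v : HHalf Γ := ⟨_, h.H1_le_halfSubspace hmem⟩ with hv
  have hvF : v.toL2 =ᵐ[surfaceMeasure Γ] F :=
    MemLp.coeFn_toLp (h.memLp_of_continuous hF.continuous)
  have hE : halfEnergy Γ u.toL2 ≤ ‖u‖ₑ ^ 2 := by
    rw [HHalf.enorm_sq_eq]
    exact le_add_self
  have hu2 : ‖u.toL2‖ₑ ^ 2 ≤ ‖u‖ₑ ^ 2 := by
    rw [HHalf.enorm_sq_eq]
    exact le_self_add
  have hd : ‖v.toL2 - u.toL2‖ₑ ^ 2 ≤ A * ENNReal.ofReal ε * ‖u‖ₑ ^ 2 := by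
    rw [← lintegral_enorm_sq_Lp]
    calc _ = ∫⁻ x, ‖F x - u.toL2 x‖ₑ ^ 2 ∂surfaceMeasure Γ := by
          refine lintegral_congr_ae ?_
          filter_upwards [hvF, Lp.coeFn_sub v.toL2 u.toL2] with x h2 h3
          rw [h3, Pi.sub_apply, h2]
      _ ≤ _ := hFu.trans (by gcongr)
  refine ⟨v, hmem, hd.trans ?_, ?_⟩
  · gcongr
    calc A ≤ A + A := le_self_add
      _ = 2 * A := (two_mul A).symm
      _ ≤ _ := le_add_self
  · rw [HHalf.enorm_sq_eq, halfEnergy_congr hvF]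
    have h2 : ‖v.toL2‖ₑ ^ 2 ≤ 2 * (‖u.toL2‖ₑ ^ 2 + ‖v.toL2 - u.toL2‖ₑ ^ 2) := by
      refine le_trans (pow_le_pow_left₀ zero_le ?_ 2) (ENNReal.add_sq_le_two_mul _ _)
      calc ‖v.toL2‖ₑ = ‖u.toL2 + (v.toL2 - u.toL2)‖ₑ := by rw [add_sub_cancel]
        _ ≤ _ := enorm_add_le _ _
    have h3 : A * ‖u‖ₑ ^ 2 ≤ 2 * (A * ‖u‖ₑ ^ 2) := by
      rw [two_mul]
      exact le_self_add
    calc _ ≤ 2 * (‖u‖ₑ ^ 2 + A * ENNReal.ofReal ε₀ * ‖u‖ₑ ^ 2) + 2 * (A * ‖u‖ₑ ^ 2) := by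
          refine add_le_add (h2.trans ?_) ((hFE.trans (by gcongr)).trans h3)
          gcongr
          exact hd.trans (by gcongr)
      _ = _ := by ring

/-- `H¹(Γ)` is dense in `H^{1/2}(Γ)`: a functional that vanishes on `H¹(Γ)` is zero. -/
theorem eq_zero_of_forall_H1 (h : IsClosedLipschitzSurface Γ) {θ : HNegHalf Γ}
    (hθ : ∀ v : HHalf Γ, v.toL2 ∈ H1 Γ → θ v = 0) : θ = 0 := by
  have hfin := h.isFiniteMeasure
  have hcomplete : CompleteSpace (HHalf Γ) := HHalf.completeSpace
  obtain ⟨A, ε₀, hA, hε₀, hh⟩ := h.exists_mem_H1_approx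
  set t : HHalf Γ := (InnerProductSpace.toDual ℂ (HHalf Γ)).symm (conjFunctional θ) with ht
  have hθt : ∀ v, inner ℂ t v = star (θ v) := fun v => by
    rw [ht, InnerProductSpace.toDual_symm_apply, conjFunctional_apply]
  ext u
  have hpos : ∀ n : ℕ, 0 < ε₀ * (1 / 2) ^ n := fun n => by positivity
  choose v hv1 hv2 hv3 using fun n : ℕ => hh u (ε₀ * (1 / 2) ^ n) (hpos n)
    (mul_le_of_le_one_right hε₀.le (pow_le_one₀ (by norm_num) (by norm_num)))
  have hlim : Tendsto (fun n => HHalf.toL2L Γ (v n)) atTop (𝓝 (HHalf.toL2L Γ u)) := by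
    have h1 : Tendsto (fun n : ℕ => A * ENNReal.ofReal (ε₀ * (1 / 2) ^ n) * ‖u‖ₑ ^ 2) atTop
        (𝓝 (A * ENNReal.ofReal (ε₀ * 0) * ‖u‖ₑ ^ 2)) := by
      refine ENNReal.Tendsto.mul_const (ENNReal.Tendsto.const_mul (ENNReal.tendsto_ofReal
        (Tendsto.const_mul _ (tendsto_pow_atTop_nhds_zero_of_lt_one (by norm_num) (by norm_num))))
        (.inr hA)) (.inr (by finiteness))
    rw [mul_zero, ENNReal.ofReal_zero, mul_zero, zero_mul] at h1
    have h2 := tendsto_of_tendsto_of_tendsto_of_le_of_le tendsto_const_nhds h1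
      (fun _ => zero_le) hv2
    rw [tendsto_iff_edist_tendsto_0]
    have h3 := (ENNReal.continuous_rpow_const (y := (1 / 2 : ℝ))).tendsto 0 |>.comp h2
    simp only [ENNReal.zero_rpow_of_pos (show (0 : ℝ) < 1 / 2 by norm_num)] at h3
    refine h3.congr fun n => ?_
    simp only [Function.comp_apply, HHalf.toL2L_apply, edist_eq_enorm_sub]
    rw [← ENNReal.rpow_natCast, ← ENNReal.rpow_mul]
    norm_num
  have hbd : ∀ n, ‖v n‖ ≤ √(A.toReal * ‖u‖ ^ 2) := fun n => by
    refine Real.le_sqrt_of_sq_le ?_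
    have := ENNReal.toReal_mono (by finiteness) (hv3 n)
    simpa using this
  have := inner_eq_zero_of_tendsto (T := HHalf.toL2L Γ) HHalf.toL2_injective hbd hlim
    (t := t) fun n => by rw [hθt, hθ _ (hv1 n), star_zero]
  rw [hθt, star_eq_zero] at this
  exact this

end IsClosedLipschitzSurface

/-! ### Rellich compactness. -/

/-- An operator that is bounded, up to small multiples of the norm, by operators of finite rank, is
compact. -/
lemma isCompactOperator_of_norm_sq_le {G Y : Type*} [NormedAddCommGroup G] [NormedSpace ℂ G]
    [NormedAddCommGroup Y] [NormedSpace ℂ Y] [CompleteSpace Y] (J : G →L[ℂ] Y)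
    (h : ∀ η : ℝ, 0 < η → ∃ (ι : Type) (_ : Fintype ι) (T : G →L[ℂ] (ι → ℂ)) (B : ℝ),
      ∀ w, ‖J w‖ ^ 2 ≤ η * ‖w‖ ^ 2 + B * ‖T w‖ ^ 2) : IsCompactOperator J := by
  refine (isCompactOperator_iff_isCompact_closure_image_ball J.toLinearMap one_pos).2 ?_
  refine TotallyBounded.isCompact_of_isClosed (TotallyBounded.closure ?_) isClosed_closure
  refine Metric.totallyBounded_of_finite_discretization fun ε hε => ?_
  -- Two vectors of the unit ball differ by at most 2 in norm, so `ε ^ 2 / 8` contributes at most `ε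
  -- ^ 2 / 2`; the choice of `ρ` bounds the finite-rank term by `ε ^ 2 / 4`.
  obtain ⟨ι, _, T, B, hB⟩ := h (ε ^ 2 / 8) (by positivity)
  set ρ : ℝ := ε / (4 * (|B| + 1)) with hρ
  have hρ0 : 0 < ρ := by positivity
  have hbdd : Bornology.IsBounded (T '' ball 0 1) := by
    refine (isBounded_closedBall (x := (0 : ι → ℂ)) (r := ‖T‖)).subset ?_
    rintro _ ⟨w, hw, rfl⟩
    rw [mem_closedBall_zero_iff]
    exact T.le_of_opNorm_le_of_le le_rfl (mem_ball_zero_iff.1 hw).le |>.trans (by simp)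
  -- A finite `ρ`-net of the image under `T` colours the unit ball; vectors of one colour have
  -- images under `J` closer than `ε`.
  obtain ⟨t, ht, hcov⟩ := Metric.totallyBounded_iff.1
    (hbdd.isCompact_closure.totallyBounded.subset subset_closure) ρ hρ0
  have hex : ∀ y : J.toLinearMap '' ball 0 1, ∃ w ∈ ball (0 : G) 1, J w = y ∧
      ∃ p : t, T w ∈ ball p.1 ρ := by
    rintro ⟨_, w, hw, rfl⟩
    obtain ⟨p, hp, hmem⟩ := mem_iUnion₂.1 (hcov ⟨w, hw, rfl⟩)
    exact ⟨w, hw, rfl, ⟨p, hp⟩, hmem⟩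
  choose w hw hJ p hp using hex
  have : Fintype t := ht.fintype
  refine ⟨ULift t, inferInstance, fun x => ⟨p x⟩, fun x y hxy => ?_⟩
  replace hxy : p x = p y := ULift.up.inj hxy
  have h1 : ‖w x - w y‖ ≤ 2 := (norm_sub_le _ _).trans (by
    linarith [mem_ball_zero_iff.1 (hw x), mem_ball_zero_iff.1 (hw y)])
  have h2 : ‖T (w x - w y)‖ ≤ 2 * ρ := by
    rw [map_sub, ← dist_eq_norm]
    have e1 := mem_ball.1 (hp x)
    have e2 := mem_ball.1 (hp y)
    rw [← hxy] at e2
    linarith [dist_triangle_right (T (w x)) (T (w y)) (p x)]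
  have h3 := hB (w x - w y)
  rw [map_sub, hJ, hJ, ← dist_eq_norm] at h3
  have h4 : B * ‖T (w x - w y)‖ ^ 2 ≤ ε ^ 2 / 4 := by
    have e1 : B ≤ (|B| + 1) ^ 2 := by nlinarith [le_abs_self B, abs_nonneg B]
    calc B * ‖T (w x - w y)‖ ^ 2 ≤ (|B| + 1) ^ 2 * (2 * ρ) ^ 2 := by gcongr
      _ = ε ^ 2 / 4 := by
        rw [hρ]
        field_simp
        ring
  have h5 : ‖w x - w y‖ ^ 2 ≤ 2 ^ 2 := pow_le_pow_left₀ (norm_nonneg _) h1 2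
  refine lt_of_pow_lt_pow_left₀ 2 hε.le ?_
  nlinarith [pow_pos hε 2]

lemma continuous_weight_right (ε : ℝ) (x : E3) : Continuous (weight ε x) :=
  (ContDiffBump.continuous _).comp (by fun_prop)

variable {Γ : Set E3}

namespace IsClosedLipschitzSurface

lemma exists_clm_eq_average (h : IsClosedLipschitzSurface Γ) (ε : ℝ) (x : E3) :
    ∃ L : L2 Γ →L[ℂ] ℂ, ∀ u : L2 Γ, L u = average (surfaceMeasure Γ) ε u x := by
  have hfin := h.isFiniteMeasure
  have hcc : Continuous fun z => (weight ε x z : ℂ) :=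
    Complex.continuous_ofReal.comp (continuous_weight_right ε x)
  have hw := h.memLp_of_continuous hcc
  refine ⟨(((mass (surfaceMeasure Γ) ε x)⁻¹ : ℝ) : ℂ) • innerSL ℂ (hw.toLp _), fun u => ?_⟩
  have h1 : innerSL ℂ (hw.toLp _) u = ∫ z, weight ε x z • u z ∂surfaceMeasure Γ := by
    rw [innerSL_apply_apply, L2.inner_def]
    refine integral_congr_ae (hw.coeFn_toLp.mono fun z hz => ?_)
    simp only [hz, RCLike.inner_apply, Complex.conj_ofReal, Complex.real_smul]
    ring
  change (((mass (surfaceMeasure Γ) ε x)⁻¹ : ℝ) : ℂ) • innerSL ℂ (hw.toLp _) u = _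
  rw [h1, Complex.coe_smul, average]

/-- The `L²` norm is bounded by a small multiple of the `H^{1/2}` seminorm and an operator of finite
rank. -/
lemma exists_enorm_sq_le_add_finiteRank (h : IsClosedLipschitzSurface Γ) :
    ∃ A B : ℝ≥0∞, ∃ ε₀ : ℝ, A ≠ ⊤ ∧ B ≠ ⊤ ∧ 0 < ε₀ ∧ ∀ ε : ℝ, 0 < ε → ε ≤ ε₀ →
      ∃ (ι : Type) (_ : Fintype ι) (L : L2 Γ →L[ℂ] (ι → ℂ)), ∀ u : L2 Γ,
        ‖u‖ₑ ^ 2 ≤ A * ENNReal.ofReal ε * halfEnergy Γ u + B * ‖L u‖ₑ ^ 2 := by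
  have hfin := h.isFiniteMeasure
  obtain ⟨C, c, ε₀, hCt, hc0, hct, hε₀, hup, hlow⟩ := h.exists_ahlfors
  have hcit : c⁻¹ ≠ ⊤ := ENNReal.inv_ne_top.2 hc0
  set K₁ : ℝ≥0∞ := 16 * C * c⁻¹ ^ 2 with hK₁
  refine ⟨128 * K₁, 2 * surfaceMeasure Γ univ, ε₀, by finiteness, by finiteness, hε₀,
    fun ε h0 h1 => ?_⟩
  have he : ENNReal.ofReal ε ≠ 0 := by simpa using h0
  have hee : (ENNReal.ofReal ε)⁻¹ * ENNReal.ofReal ε = 1 :=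
    ENNReal.inv_mul_cancel he (by finiteness)
  have heit : (ENNReal.ofReal ε)⁻¹ ≠ ⊤ := ENNReal.inv_ne_top.2 he
  -- The finite-rank operator collects the averages at the centres of a finite `ε`-net of Γ; every
  -- value of `u` is compared with the average at a nearby centre.
  obtain ⟨t, htΓ, ht, hcov⟩ := h.isCompact.finite_cover_balls h0
  choose L hL using h.exists_clm_eq_average ε
  let : Fintype t := ht.fintype
  refine ⟨t, inferInstance, ContinuousLinearMap.pi fun i : t => L i, fun u => ?_⟩
  set N := ‖(fun i : t => L i u)‖ₑ with hN
  have hum : Measurable u := (Lp.stronglyMeasurable u).measurable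
  have hpt : ∀ x ∈ Γ, ‖u x‖ₑ ^ 2 ≤ 2 * (K₁ * (ENNReal.ofReal ε)⁻¹ ^ 2) *
      oscillation (surfaceMeasure Γ) ε u x + 2 * N ^ 2 := by
    intro x hx
    obtain ⟨y, hy, hxy⟩ := mem_iUnion₂.1 (hcov hx)
    have e1 := enorm_average_sub_sq_le hum ((Lp.memLp u).integrable one_le_two) h0 hc0 hct
      (hlow y (htΓ hy) ε h0 h1) (hup x hx) (mem_ball.1 hxy).le
    have e2 : ‖average (surfaceMeasure Γ) ε u y‖ₑ ≤ N := by
      rw [← hL, hN, ← ofReal_norm, ← ofReal_norm]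
      exact ENNReal.ofReal_le_ofReal (norm_le_pi_norm (fun i : t => L i u) ⟨y, hy⟩)
    calc ‖u x‖ₑ ^ 2 = ‖average (surfaceMeasure Γ) ε u y -
            (average (surfaceMeasure Γ) ε u y - u x)‖ₑ ^ 2 := by rw [sub_sub_cancel]
      _ ≤ 2 * (‖average (surfaceMeasure Γ) ε u y‖ₑ ^ 2 +
            ‖average (surfaceMeasure Γ) ε u y - u x‖ₑ ^ 2) :=
          (pow_le_pow_left₀ zero_le enorm_sub_le 2).trans (ENNReal.add_sq_le_two_mul _ _)
      _ ≤ 2 * (N ^ 2 + K₁ * (ENNReal.ofReal ε)⁻¹ ^ 2 *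
            oscillation (surfaceMeasure Γ) ε u x) := by gcongr
      _ = _ := by ring
  rw [← lintegral_enorm_sq_Lp]
  refine (lintegral_mono_ae (h.ae_mem.mono hpt)).trans ?_
  rw [lintegral_add_right _ measurable_const, lintegral_const, lintegral_const_mul' _ _
    (by finiteness)]
  refine (add_le_add_left (mul_le_mul_right (h.lintegral_oscillation_le hum) _) _).trans
    (le_of_eq ?_)
  calc _ = 128 * K₁ * ENNReal.ofReal ε * ((ENNReal.ofReal ε)⁻¹ * ENNReal.ofReal ε) ^ 2 *
        halfEnergy Γ u + 2 * surfaceMeasure Γ univ * N ^ 2 := by ring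
    _ = _ := by
      rw [hee, one_pow, mul_one]
      rfl

end IsClosedLipschitzSurface

namespace energySpace

/-- Rellich's theorem: `H¹(Γ)` embeds compactly in `H^{1/2}(Γ)`. -/
theorem isCompactOperator_toHHalf (hΓ : IsClosedLipschitzSurface Γ) (κ : ℝ) :
    IsCompactOperator (toHHalf hΓ κ) := by
  have hfin := hΓ.isFiniteMeasure
  have hcomplete : CompleteSpace (HHalf Γ) := HHalf.completeSpace
  obtain ⟨C, δ₀, hC, hδ₀, h1⟩ := exists_enorm_toHHalf_sq_le hΓ κ
  obtain ⟨A, B, ε₀, hA, hB, hε₀, h2⟩ := hΓ.exists_enorm_sq_le_add_finiteRank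
  refine isCompactOperator_of_norm_sq_le _ fun η hη => ?_
  -- `δ` absorbs the gradient term into η / 2. The constant `M` depends on `δ`, so `ε` is chosen
  -- only afterwards, to absorb the seminorm in the L² term into the other half.
  set δ : ℝ := min δ₀ (η / (2 * (C.toReal + 1))) with hδ
  have hδ0 : 0 < δ := lt_min hδ₀ (by positivity)
  obtain ⟨M, hM, h3⟩ := h1 δ hδ0 (min_le_left _ _)
  set J := toHHalf hΓ κ with hJ
  set ε : ℝ := min ε₀ (η / (2 * (M.toReal * A.toReal * ‖J‖ ^ 2 + 1))) with hε
  have hε0 : 0 < ε := lt_min hε₀ (by positivity)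
  obtain ⟨ι, _, L, hL⟩ := h2 ε hε0 (min_le_left _ _)
  refine ⟨ι, inferInstance, L.comp ((HHalf.toL2L Γ).comp J), M.toReal * B.toReal, fun w => ?_⟩
  have h4 : ‖J w‖ₑ ^ 2 ≤ C * ENNReal.ofReal δ * ‖w‖ₑ ^ 2 +
      M * (A * ENNReal.ofReal ε * ‖J w‖ₑ ^ 2 + B * ‖L (J w).toL2‖ₑ ^ 2) := by
    refine (h3 w).trans ?_
    gcongr
    refine (hL _).trans (add_le_add_left (mul_le_mul_right ?_ _) _)
    rw [HHalf.enorm_sq_eq]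
    exact le_add_self
  have h5 : ‖J w‖ ^ 2 ≤ C.toReal * δ * ‖w‖ ^ 2 +
      M.toReal * (A.toReal * ε * ‖J w‖ ^ 2 + B.toReal * ‖L (J w).toL2‖ ^ 2) := by
    have := ENNReal.toReal_mono (by finiteness) h4
    rw [ENNReal.toReal_add (by finiteness) (by finiteness), ENNReal.toReal_mul (a := M),
      ENNReal.toReal_add (by finiteness) (by finiteness)] at this
    simpa [hδ0.le, hε0.le] using this
  have h6 : ‖J w‖ ^ 2 ≤ ‖J‖ ^ 2 * ‖w‖ ^ 2 := by
    rw [← mul_pow]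
    exact pow_le_pow_left₀ (norm_nonneg _) (J.le_opNorm w) 2
  have h7 : C.toReal * δ ≤ η / 2 := by
    calc C.toReal * δ ≤ (C.toReal + 1) * (η / (2 * (C.toReal + 1))) := by
          gcongr
          · linarith
          · exact min_le_right _ _
      _ = η / 2 := by field_simp
  have h8 : M.toReal * A.toReal * ‖J‖ ^ 2 * ε ≤ η / 2 := by
    calc _ ≤ (M.toReal * A.toReal * ‖J‖ ^ 2 + 1) *
          (η / (2 * (M.toReal * A.toReal * ‖J‖ ^ 2 + 1))) := by
          gcongr
          · linarith
          · exact min_le_right _ _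
      _ = η / 2 := by field_simp
  calc ‖J w‖ ^ 2 ≤ C.toReal * δ * ‖w‖ ^ 2 +
        M.toReal * (A.toReal * ε * (‖J‖ ^ 2 * ‖w‖ ^ 2) + B.toReal * ‖L (J w).toL2‖ ^ 2) := by
        refine h5.trans ?_
        gcongr
    _ = C.toReal * δ * ‖w‖ ^ 2 + M.toReal * A.toReal * ‖J‖ ^ 2 * ε * ‖w‖ ^ 2 +
          M.toReal * B.toReal * ‖L (J w).toL2‖ ^ 2 := by ring
    _ ≤ η / 2 * ‖w‖ ^ 2 + η / 2 * ‖w‖ ^ 2 + M.toReal * B.toReal * ‖L (J w).toL2‖ ^ 2 := by gcongr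
    _ = η * ‖w‖ ^ 2 + M.toReal * B.toReal * ‖L (J w).toL2‖ ^ 2 := by ring

end energySpace

/-! ### Riesz representation and the regulariser. -/

variable {Γ : Set E3} {κ : ℝ}

namespace energySpace

/-- The Riesz representative in the energy space of an antilinear functional on `H^{1/2}(Γ)`. -/
def riesz (hΓ : IsClosedLipschitzSurface Γ) (κ : ℝ) : HNegHalf Γ →L[ℂ] energySpace Γ κ :=
  LinearMap.mkContinuous
    -- Conjugation and the inverse Riesz map are both antilinear, so the composite is linear in `θ`.
    { toFun := fun θ => (InnerProductSpace.toDual ℂ (energySpace Γ κ)).symm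
        ((conjFunctional θ).comp (toHHalf hΓ κ))
      map_add' := fun θ η => by
        refine ext_inner_left ℂ fun w => ?_
        rw [← inner_conj_symm, ← inner_conj_symm w (_ + _), inner_add_left]
        simp [InnerProductSpace.toDual_symm_apply, conjFunctional_apply]
      map_smul' := fun c θ => by
        refine ext_inner_left ℂ fun w => ?_
        rw [← inner_conj_symm, ← inner_conj_symm w (_ • _), inner_smul_left]
        simp [InnerProductSpace.toDual_symm_apply, conjFunctional_apply] } ‖toHHalf hΓ κ‖
    fun θ => by
      refine ((InnerProductSpace.toDual ℂ (energySpace Γ κ)).symm.norm_map _).trans_le ?_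
      refine ContinuousLinearMap.opNorm_le_bound _ (by positivity) fun w => ?_
      rw [ContinuousLinearMap.comp_apply, conjFunctional_apply, norm_star]
      calc ‖θ (toHHalf hΓ κ w)‖ ≤ ‖θ‖ * (‖toHHalf hΓ κ‖ * ‖w‖) :=
            θ.le_of_opNorm_le_of_le le_rfl ((toHHalf hΓ κ).le_opNorm w)
        _ = _ := by ring

lemma inner_riesz (hΓ : IsClosedLipschitzSurface Γ) (θ : HNegHalf Γ) (w : energySpace Γ κ) :
    inner ℂ w (riesz hΓ κ θ) = θ (toHHalf hΓ κ w) := by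
  rw [← inner_conj_symm w]
  change (starRingEnd ℂ) (inner ℂ ((InnerProductSpace.toDual ℂ (energySpace Γ κ)).symm
    ((conjFunctional θ).comp (toHHalf hΓ κ))) w) = _
  rw [InnerProductSpace.toDual_symm_apply, ContinuousLinearMap.comp_apply, conjFunctional_apply]
  exact star_star _

end energySpace

namespace IsClosedLipschitzSurface

open energySpace

lemma toL2_toHHalf_mem_H1 (hΓ : IsClosedLipschitzSurface Γ) (w : energySpace Γ κ) :
    (toHHalf hΓ κ w).toL2 ∈ H1 Γ := mem_H1 w

/-- Test functions in H¹(Γ) are exactly the images of energy vectors, so the weak equation says that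
the energy vector of `u` and the Riesz vector of `θ` have the same inner products with everything.
-/
theorem solvesWeakly_iff (hΓ : IsClosedLipschitzSurface Γ) (hκ : κ ≠ 0) {θ : HNegHalf Γ}
    {u : HHalf Γ} :
    SolvesWeakly (shiftedLaplacian Γ κ) θ u ↔ u = toHHalf hΓ κ (riesz hΓ κ θ) := by
  constructor
  · rintro ⟨hu, h⟩
    have key : ofH1 hΓ hκ ⟨u.toL2, hu⟩ = riesz hΓ κ θ := by
      refine ext_inner_left ℂ fun w => ?_
      rw [inner_riesz, ← h _ (hΓ.toL2_toHHalf_mem_H1 w), ← inner_ofH1 hΓ hκ, ofH1_toHHalf]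
    rw [← key, toHHalf_ofH1]
  · rintro rfl
    refine ⟨hΓ.toL2_toHHalf_mem_H1 _, fun τ hτ => ?_⟩
    rw [← inner_ofH1 hΓ hκ, ofH1_toHHalf, inner_riesz, toHHalf_ofH1]

theorem existsUnique_solvesWeakly (hΓ : IsClosedLipschitzSurface Γ) (hκ : κ ≠ 0)
    (θ : HNegHalf Γ) : ∃! u, SolvesWeakly (shiftedLaplacian Γ κ) θ u :=
  ⟨_, (hΓ.solvesWeakly_iff hκ).2 rfl, fun _ h => (hΓ.solvesWeakly_iff hκ).1 h⟩

lemma solvesWeakly_regulariser (hΓ : IsClosedLipschitzSurface Γ) (hκ : κ ≠ 0)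
    (θ : HNegHalf Γ) :
    SolvesWeakly (shiftedLaplacian Γ κ) θ (shiftedLaplaceRegulariser Γ κ θ) := by
  have h := (hΓ.existsUnique_solvesWeakly hκ θ).exists
  rw [shiftedLaplaceRegulariser, weakInverse, dif_pos h]
  exact h.choose_spec

/-- Linearity and compactness are read off this factorisation. -/
lemma regulariser_eq (hΓ : IsClosedLipschitzSurface Γ) (hκ : κ ≠ 0) :
    shiftedLaplaceRegulariser Γ κ = (toHHalf hΓ κ).comp (riesz hΓ κ) :=
  funext fun θ => (hΓ.solvesWeakly_iff hκ).1 (hΓ.solvesWeakly_regulariser hκ θ)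

lemma shiftedLaplacian_self (u : H1 Γ) : shiftedLaplacian Γ κ u u =
    ((‖surfaceGradient Γ u‖ ^ 2 + κ ^ 2 * ‖(u : L2 Γ)‖ ^ 2 : ℝ) : ℂ) := by
  rw [shiftedLaplacian, laplaceBeltrami, pairing, inner_self_eq_norm_sq_to_K,
    inner_self_eq_norm_sq_to_K]
  push_cast
  simp only [Complex.coe_algebraMap]
  ring

/-- The energy identity `⟨θ, R θ⟩ = ‖∇ R θ‖² + κ² ‖R θ‖²`. -/
theorem apply_regulariser (hΓ : IsClosedLipschitzSurface Γ) (hκ : κ ≠ 0) (θ : HNegHalf Γ)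
    (hu : (shiftedLaplaceRegulariser Γ κ θ).toL2 ∈ H1 Γ) :
    θ (shiftedLaplaceRegulariser Γ κ θ) =
      ((‖surfaceGradient Γ ⟨(shiftedLaplaceRegulariser Γ κ θ).toL2, hu⟩‖ ^ 2 +
        κ ^ 2 * ‖(shiftedLaplaceRegulariser Γ κ θ).toL2‖ ^ 2 : ℝ) : ℂ) := by
  obtain ⟨hu', h⟩ := hΓ.solvesWeakly_regulariser hκ θ
  rw [← h _ hu, shiftedLaplacian_self]

/-- A zero solution would make `θ` vanish on H¹(Γ), hence everywhere by density. -/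
theorem regulariser_ne_zero (hΓ : IsClosedLipschitzSurface Γ) (hκ : κ ≠ 0) {θ : HNegHalf Γ}
    (hθ : θ ≠ 0) : (shiftedLaplaceRegulariser Γ κ θ).toL2 ≠ 0 := by
  intro h0
  refine hθ (hΓ.eq_zero_of_forall_H1 fun v hv => ?_)
  have h1 : shiftedLaplaceRegulariser Γ κ θ = 0 :=
    HHalf.toL2_injective (h0.trans (map_zero _).symm)
  obtain ⟨hu, h⟩ := hΓ.solvesWeakly_regulariser hκ θ
  have h2 : (⟨(shiftedLaplaceRegulariser Γ κ θ).toL2, hu⟩ : H1 Γ) = 0 := Subtype.ext h0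
  rw [← h v hv, h2]
  simp [shiftedLaplacian, laplaceBeltrami, pairing]

theorem energy_pos (hΓ : IsClosedLipschitzSurface Γ) (hκ : κ ≠ 0) {θ : HNegHalf Γ}
    (hθ : θ ≠ 0) (hu : (shiftedLaplaceRegulariser Γ κ θ).toL2 ∈ H1 Γ) :
    0 < ‖surfaceGradient Γ ⟨(shiftedLaplaceRegulariser Γ κ θ).toL2, hu⟩‖ ^ 2 +
      κ ^ 2 * ‖(shiftedLaplaceRegulariser Γ κ θ).toL2‖ ^ 2 := by
  have := norm_pos_iff.2 (hΓ.regulariser_ne_zero hκ hθ)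
  positivity

theorem isStabilisationOperator (hΓ : IsClosedLipschitzSurface Γ) (hκ : κ ≠ 0) :
    IsStabilisationOperator (shiftedLaplaceRegulariser Γ κ) := by
  refine ⟨?_, ?_, fun θ hθ => ?_⟩
  · rw [hΓ.regulariser_eq hκ]
    exact ((toHHalf hΓ κ).comp (riesz hΓ κ)).toLinearMap.isLinear
  · rw [hΓ.regulariser_eq hκ]
    exact (isCompactOperator_toHHalf hΓ κ).comp_clm (riesz hΓ κ)
  · obtain ⟨hu, -⟩ := hΓ.solvesWeakly_regulariser hκ θ
    rw [hΓ.apply_regulariser hκ θ hu, Complex.ofReal_re]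
    exact hΓ.energy_pos hκ hθ hu

end IsClosedLipschitzSurface

lemma shiftedLaplaceRegulariser_one (Γ : Set E3) :
    shiftedLaplaceRegulariser Γ 1 = modifiedHelmholtzRegulariser Γ := by
  have : shiftedLaplacian Γ 1 = modifiedHelmholtz Γ := by
    funext u τ
    simp [shiftedLaplacian, modifiedHelmholtz]
  rw [shiftedLaplaceRegulariser, modifiedHelmholtzRegulariser, this]

end SurfaceSobolev

end

theorem mainTheorem2 (Ω : Set E3) (hΩ : IsOpen Ω) (hb : Bornology.IsBounded Ω)
    (hΓ : IsClosedLipschitzSurface (frontier Ω)) (κ : ℝ) (hκ : 0 < κ) :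
    -- the operator is well defined
    H1 (frontier Ω) ≤ halfSubspace (frontier Ω) ∧
    (∀ θ : HNegHalf (frontier Ω), ∃! u : HHalf (frontier Ω),
      SolvesWeakly (shiftedLaplacian (frontier Ω) κ) θ u) ∧
    -- the energy identity and positivity
    (∀ θ : HNegHalf (frontier Ω),
      ∃ hu : (shiftedLaplaceRegulariser (frontier Ω) κ θ).toL2 ∈ H1 (frontier Ω),
        θ (shiftedLaplaceRegulariser (frontier Ω) κ θ) =
          ((‖surfaceGradient (frontier Ω)
                ⟨(shiftedLaplaceRegulariser (frontier Ω) κ θ).toL2, hu⟩‖ ^ 2 +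
            κ ^ 2 * ‖(shiftedLaplaceRegulariser (frontier Ω) κ θ).toL2‖ ^ 2 : ℝ) : ℂ) ∧
        (θ ≠ 0 →
          0 < ‖surfaceGradient (frontier Ω)
                ⟨(shiftedLaplaceRegulariser (frontier Ω) κ θ).toL2, hu⟩‖ ^ 2 +
            κ ^ 2 * ‖(shiftedLaplaceRegulariser (frontier Ω) κ θ).toL2‖ ^ 2)) ∧
    -- it is a valid stabilisation operator
    IsStabilisationOperator (shiftedLaplaceRegulariser (frontier Ω) κ) ∧
    -- the case `κ = 1`
    shiftedLaplaceRegulariser (frontier Ω) 1 = modifiedHelmholtzRegulariser (frontier Ω) := by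
  refine ⟨hΓ.H1_le_halfSubspace, hΓ.existsUnique_solvesWeakly hκ.ne', fun θ => ?_,
    hΓ.isStabilisationOperator hκ.ne', shiftedLaplaceRegulariser_one _⟩
  obtain ⟨hu, -⟩ := hΓ.solvesWeakly_regulariser hκ.ne' θ
  exact ⟨hu, hΓ.apply_regulariser hκ.ne' θ hu, fun hθ => hΓ.energy_pos hκ.ne' hθ hu⟩
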